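/- Let $\mathbb R_+=[0,\infty)$, let $W\in C^\infty(\mathbb R_+)$ (smooth up to $0$) be a real-valued potential such that $W(x)\ge 1$ for every $x\in\mathbb R_+$ and such that for every $k\in\mathbb N$ there is $C_k>0$ with $$|W^{(k)}(x)|\le C_k\,W(x)\qquad\text{for all }x\in\mathbb R_+ .\tag{1}$$ Consider the unbounded operator $A$ on the complex Hilbert space $L^2(\mathbb R_+)$ given by $$D(A)=\{u\in H^2(\mathbb R_+):\ u(0)=0,\ Wu\in L^2(\mathbb R_+)\},\qquad Au=-u''+Wu .$$ Then $A$ is self-adjoint and positive: $(Au\,|\,u)>0$ for every nonzero $u\in D(A)$. In particular $A$ has a unique nonnegative self-adjoint square root $A^{1/2}$, and for integers $s\ge1$ one sets $A^{s/2}=(A^{1/2})^s$ with its natural domain. For every integer $s\ge 1$, $$D(A^{s/2})=\Big\{u\in L^2(\mathbb R_+):\ W^{\frac{s-k}2}u^{(k)}\in L^2(\mathbb R_+)\ \text{for } 0\le k\le s,\ \text{ and }\ \Big(\Big(-\tfrac{d^2}{dx^2}+W\Big)^p u\Big)(0)=0\ \text{for } 0\le p\le \Big\lfloor\tfrac{s-1}2\Big\rfloor\Big\},$$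 where derivatives are taken in the sense of distributions on $(0,\infty)$, and values at $0$ are those of the representative that is continuous on $[0,\infty)$. Moreover, on this space the norm $\|A^{s/2}u\|_{L^2}$ is equivalent to $$\sum_{k=0}^s\big\|W^{\frac{s-k}2}u^{(k)}\big\|_{L^2},$$ with constants that depend only on $s$ and on the constants $C_k$ in (1) for $k$ in a finite set depending only on $s$. -/

import Mathlib

open MeasureTheory Set
open scoped ContDiff ENNReal

namespace HalfLine

noncomputable section

/-! ### Unbounded operators: natural composition, integer powers, positive square root -/

section Operators

variable {H : Type*} [NormedAddCommGroup H] [InnerProductSpace ℂ H]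

/-- The composition `S ∘ T` of two unbounded operators on its natural domain
`{u ∈ D(T) : T u ∈ D(S)}`. -/
def opComp (S T : H →ₗ.[ℂ] H) : H →ₗ.[ℂ] H where
  domain := (S.domain.comap T.toFun).map T.domain.subtype
  toFun :=
    { toFun := fun u =>
        S ⟨T ⟨u.1, by obtain ⟨v, -, hv⟩ := u.2; exact hv ▸ v.2⟩,
          by obtain ⟨_, v, hv, rfl⟩ := u; exact hv⟩
      map_add' := by
        rintro ⟨_, u, hu, rfl⟩ ⟨_, v, hv, rfl⟩
        rw [← LinearPMap.map_add]
        congr 1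
        ext1
        exact LinearPMap.map_add T u v
      map_smul' := by
        rintro c ⟨_, u, hu, rfl⟩
        rw [RingHom.id_apply, ← LinearPMap.map_smul]
        congr 1
        ext1
        exact LinearPMap.map_smul T c u }

/-- The membership in the domain of a composition, unfolded. -/
theorem mem_opComp_domain {S T : H →ₗ.[ℂ] H} {u : H} :
    u ∈ (opComp S T).domain ↔ ∃ h : u ∈ T.domain, T ⟨u, h⟩ ∈ S.domain := by
  constructor
  · rintro ⟨v, hv, rfl⟩
    exact ⟨v.2, hv⟩
  · rintro ⟨h, hS⟩
    exact ⟨⟨u, h⟩, hS, rfl⟩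

/-- The powers `B ^ n` of an unbounded operator, on their natural domains. -/
def opPow (B : H →ₗ.[ℂ] H) : ℕ → (H →ₗ.[ℂ] H)
  | 0 => LinearMap.toPMap LinearMap.id ⊤
  | n + 1 => opComp B (opPow B n)

variable [CompleteSpace H]

/-- `B` is a nonnegative self-adjoint operator with `B ∘ B = A`, domains included. -/
structure IsPosSqrt (A B : H →ₗ.[ℂ] H) : Prop where
  selfAdjoint : IsSelfAdjoint B
  nonneg : ∀ u : B.domain, 0 ≤ (inner ℂ (B u) (u : H)).re
  sq : opComp B B = A

open Classical in
/-- The square root `A ^ (1/2)` of a nonnegative self-adjoint operator: the nonnegative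
self-adjoint operator whose square is `A`. (If there is none, the value is `A`.) -/
def posSqrt (A : H →ₗ.[ℂ] H) : H →ₗ.[ℂ] H :=
  if h : ∃ B, IsPosSqrt A B then h.choose else A

/-- `A ^ (s/2) = (A ^ (1/2)) ^ s` for a natural number `s`, on its natural domain. -/
def halfPow (A : H →ₗ.[ℂ] H) (s : ℕ) : H →ₗ.[ℂ] H :=
  opPow (posSqrt A) s

end Operators

/-! ### Weak derivatives on the open half-line -/

/-- Lebesgue measure on `(0, ∞)`. -/
abbrev volPos : Measure ℝ := volume.restrict (Ioi 0)

/-- The complex Hilbert space `L²(ℝ₊)`. -/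
abbrev L2 : Type := Lp ℂ 2 volPos

/-- Real test functions: smooth, with compact support contained in `(0, ∞)`. -/
structure IsTest (φ : ℝ → ℝ) : Prop where
  smooth : ContDiff ℝ ∞ φ
  compact : HasCompactSupport φ
  supp : tsupport φ ⊆ Ioi 0

/-- `f ^ (k) = g` in the sense of distributions on `(0, ∞)`, for locally integrable `f`, `g`. -/
structure HasWeakDeriv (k : ℕ) (f g : ℝ → ℂ) : Prop where
  left : LocallyIntegrableOn f (Ioi 0)
  right : LocallyIntegrableOn g (Ioi 0)
  eq : ∀ φ : ℝ → ℝ, IsTest φ →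
    ∫ x in Ioi 0, iteratedDeriv k φ x • f x = (-1) ^ k * ∫ x in Ioi 0, φ x • g x

open Classical in
/-- A representative of the distributional derivative `f ^ (k)` on `(0, ∞)`, when that derivative
is a locally integrable function (and `0` otherwise). -/
def weakDeriv (k : ℕ) (f : ℝ → ℂ) : ℝ → ℂ :=
  if h : ∃ g, HasWeakDeriv k f g then h.choose else 0

/-- `f ∈ H^m(ℝ₊)`: the distributional derivatives of `f` of order `≤ m` are in `L²(ℝ₊)`. -/
def MemSobolev (m : ℕ) (f : ℝ → ℂ) : Prop :=
  ∀ k ≤ m, ∃ g, HasWeakDeriv k f g ∧ MemLp g 2 volPos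

/-- `f(0) = 0`, in the sense that `f` has a representative which is continuous on `[0, ∞)` and
vanishes at `0`. -/
def VanishesAtZero (f : ℝ → ℂ) : Prop :=
  ∃ g : ℝ → ℂ, ContinuousOn g (Ici 0) ∧ f =ᵐ[volPos] g ∧ g 0 = 0

/-- The differential expression `-φ'' + W φ` on functions. -/
def schrodingerExpr (W : ℝ → ℝ) (φ : ℝ → ℝ) : ℝ → ℝ :=
  fun x => -iteratedDeriv 2 φ x + W x * φ x

/-- `(-d²/dx² + W) ^ p f = g` in the sense of distributions on `(0, ∞)`, for locally integrable
`f`, `g` (the differential expression is real and formally symmetric). -/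
structure IsSchrodingerPow (W : ℝ → ℝ) (p : ℕ) (f g : ℝ → ℂ) : Prop where
  left : LocallyIntegrableOn f (Ioi 0)
  right : LocallyIntegrableOn g (Ioi 0)
  eq : ∀ φ : ℝ → ℝ, IsTest φ →
    ∫ x in Ioi 0, (schrodingerExpr W)^[p] φ x • f x = ∫ x in Ioi 0, φ x • g x

/-! ### Helper facts needed to build the operator -/

theorem IsTest.iteratedDeriv_continuous {φ : ℝ → ℝ} (hφ : IsTest φ) (k : ℕ) :
    Continuous (iteratedDeriv k φ) :=
  hφ.smooth.continuous_iteratedDeriv k (by exact_mod_cast le_top)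

theorem IsTest.tsupport_iteratedDeriv {φ : ℝ → ℝ} (k : ℕ) :
    tsupport (iteratedDeriv k φ) ⊆ tsupport φ := by
  induction k with
  | zero => simp
  | succ k ih =>
    rw [iteratedDeriv_succ]
    exact (closure_minimal (support_deriv_subset (f := iteratedDeriv k φ))
      (isClosed_tsupport _)).trans ih

theorem IsTest.integrableOn {φ : ℝ → ℝ} (hφ : IsTest φ) (k : ℕ) {f : ℝ → ℂ}
    (hf : LocallyIntegrableOn f (Ioi 0)) :
    IntegrableOn (fun x => iteratedDeriv k φ x • f x) (Ioi 0) := by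
  have hK : IsCompact (tsupport φ) := hφ.compact
  have h1 : IntegrableOn f (tsupport φ) := hf.integrableOn_compact_subset hφ.supp hK
  have h2 : IntegrableOn (fun x => iteratedDeriv k φ x • f x) (tsupport φ) :=
    h1.continuousOn_smul (hφ.iteratedDeriv_continuous k).continuousOn hK
  refine h2.of_forall_sdiff_eq_zero measurableSet_Ioi ?_
  intro x hx
  rw [image_eq_zero_of_notMem_tsupport (fun h => hx.2 (IsTest.tsupport_iteratedDeriv k h)),
    zero_smul]

theorem HasWeakDeriv.add {k : ℕ} {f g f' g' : ℝ → ℂ} (h : HasWeakDeriv k f g)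
    (h' : HasWeakDeriv k f' g') : HasWeakDeriv k (f + f') (g + g') where
  left := h.left.add h'.left
  right := h.right.add h'.right
  eq φ hφ := by
    have e0 := fun {f : ℝ → ℂ} hf => hφ.integrableOn 0 (f := f) hf
    simp only [iteratedDeriv_zero] at e0
    simp only [Pi.add_apply, smul_add]
    rw [integral_add (hφ.integrableOn k h.left) (hφ.integrableOn k h'.left),
      integral_add (e0 h.right) (e0 h'.right), h.eq φ hφ, h'.eq φ hφ, mul_add]

theorem HasWeakDeriv.const_smul {k : ℕ} {f g : ℝ → ℂ} (c : ℂ) (h : HasWeakDeriv k f g) :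
    HasWeakDeriv k (c • f) (c • g) where
  left := h.left.smul c
  right := h.right.smul c
  eq φ hφ := by
    simp only [Pi.smul_apply, smul_comm _ c]
    rw [integral_smul, integral_smul, h.eq φ hφ, smul_eq_mul, smul_eq_mul]
    ring

theorem HasWeakDeriv.congr {k : ℕ} {f g f' g' : ℝ → ℂ} (h : HasWeakDeriv k f g)
    (hf : f =ᵐ[volPos] f') (hg : g =ᵐ[volPos] g') : HasWeakDeriv k f' g' where
  left := by
    intro x hx
    obtain ⟨s, hs, hi⟩ := h.left x hx
    refine ⟨s ∩ Ioi 0, Filter.inter_mem hs self_mem_nhdsWithin, ?_⟩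
    exact (hi.mono_set inter_subset_left).congr_fun_ae
      (ae_mono (Measure.restrict_mono inter_subset_right le_rfl) hf)
  right := by
    intro x hx
    obtain ⟨s, hs, hi⟩ := h.right x hx
    refine ⟨s ∩ Ioi 0, Filter.inter_mem hs self_mem_nhdsWithin, ?_⟩
    exact (hi.mono_set inter_subset_left).congr_fun_ae
      (ae_mono (Measure.restrict_mono inter_subset_right le_rfl) hg)
  eq φ hφ := by
    have e1 : ∫ x in Ioi 0, iteratedDeriv k φ x • f' x
        = ∫ x in Ioi 0, iteratedDeriv k φ x • f x :=
      integral_congr_ae (hf.mono fun x hx => by simp only [hx])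
    have e2 : ∫ x in Ioi 0, φ x • g' x = ∫ x in Ioi 0, φ x • g x :=
      integral_congr_ae (hg.mono fun x hx => by simp only [hx])
    rw [e1, e2, h.eq φ hφ]

theorem HasWeakDeriv.unique {k : ℕ} {f g g' : ℝ → ℂ} (h : HasWeakDeriv k f g)
    (h' : HasWeakDeriv k f g') : g =ᵐ[volPos] g' := by
  have key : ∀ᵐ x, x ∈ Ioi (0 : ℝ) → (g - g') x = 0 := by
    refine isOpen_Ioi.ae_eq_zero_of_integral_contDiff_smul_eq_zero (h.right.sub h'.right) ?_
    intro φ h1 h2 h3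
    have hφ : IsTest φ := ⟨h1, h2, h3⟩
    have e0 := fun {f : ℝ → ℂ} hf => hφ.integrableOn 0 (f := f) hf
    simp only [iteratedDeriv_zero] at e0
    have e1 : ∫ x, φ x • (g - g') x = ∫ x in Ioi 0, φ x • (g - g') x := by
      refine (setIntegral_eq_integral_of_forall_compl_eq_zero fun x hx => ?_).symm
      rw [image_eq_zero_of_notMem_tsupport (fun h => hx (h3 h)), zero_smul]
    have e2 := (h.eq φ hφ).symm.trans (h'.eq φ hφ)
    have e3 := mul_left_cancel₀ (pow_ne_zero k (neg_ne_zero.2 (one_ne_zero (α := ℂ)))) e2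
    rw [e1]
    simp only [Pi.sub_apply, smul_sub]
    rw [integral_sub (e0 h.right) (e0 h'.right), e3, sub_self]
  have := (ae_restrict_iff' measurableSet_Ioi).2 key
  exact this.mono fun x hx => sub_eq_zero.1 hx

theorem hasWeakDeriv_weakDeriv {k : ℕ} {f : ℝ → ℂ} (h : ∃ g, HasWeakDeriv k f g) :
    HasWeakDeriv k f (weakDeriv k f) := by
  rw [weakDeriv, dif_pos h]
  exact h.choose_spec

theorem HasWeakDeriv.weakDeriv_eq {k : ℕ} {f g : ℝ → ℂ} (h : HasWeakDeriv k f g) :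
    weakDeriv k f =ᵐ[volPos] g :=
  (hasWeakDeriv_weakDeriv ⟨g, h⟩).unique h

theorem locallyIntegrableOn_of_memLp {f : ℝ → ℂ} (hf : MemLp f 2 volPos) :
    LocallyIntegrableOn f (Ioi 0) :=
  locallyIntegrableOn_of_locallyIntegrable_restrict (hf.locallyIntegrable (by norm_num))

/-! ### The Schrödinger operator with Dirichlet condition -/

/-- The domain `{u ∈ H²(ℝ₊) : u(0) = 0, W u ∈ L²(ℝ₊)}`. -/
def schrodingerDomain (W : ℝ → ℝ) : Submodule ℂ L2 where
  carrier := {u | MemSobolev 2 u ∧ VanishesAtZero u ∧ MemLp (fun x => (W x : ℂ) * u x) 2 volPos}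
  zero_mem' := by
    have hz : (0 : ℝ → ℂ) =ᵐ[volPos] ((0 : L2) : ℝ → ℂ) := (Lp.coeFn_zero ℂ 2 volPos).symm
    refine ⟨fun k _ => ⟨0, ?_, MemLp.zero⟩, ⟨0, continuousOn_const, hz.symm, rfl⟩, ?_⟩
    · refine HasWeakDeriv.congr (f := 0) (g := 0) ⟨?_, ?_, ?_⟩ hz (Filter.EventuallyEq.refl _ _)
      · exact locallyIntegrableOn_zero
      · exact locallyIntegrableOn_zero
      · intro φ _
        simp
    · refine (MemLp.zero (ε := ℂ)).ae_eq (hz.mono fun x hx => ?_)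
      change (0 : ℂ) = (W x : ℂ) * ((0 : L2) : ℝ → ℂ) x
      rw [← hx, Pi.zero_apply, mul_zero]
  add_mem' := by
    rintro u v ⟨hu, ⟨gu, cu, eu, zu⟩, wu⟩ ⟨hv, ⟨gv, cv, ev, zv⟩, wv⟩
    have hadd : (u : ℝ → ℂ) + (v : ℝ → ℂ) =ᵐ[volPos] ((u + v : L2) : ℝ → ℂ) := (Lp.coeFn_add u v).symm
    refine ⟨fun k hk => ?_, ⟨gu + gv, cu.add cv, hadd.symm.trans (eu.add ev), by simp [zu, zv]⟩, ?_⟩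
    · obtain ⟨g, hg, mg⟩ := hu k hk
      obtain ⟨g', hg', mg'⟩ := hv k hk
      exact ⟨g + g', (hg.add hg').congr hadd (Filter.EventuallyEq.refl _ _), mg.add mg'⟩
    · refine (wu.add wv).ae_eq (hadd.mono fun x hx => ?_)
      simp only [Pi.add_apply] at hx ⊢
      rw [← hx, mul_add]
  smul_mem' := by
    rintro c u ⟨hu, ⟨gu, cu, eu, zu⟩, wu⟩
    have hsm : c • (u : ℝ → ℂ) =ᵐ[volPos] ((c • u : L2) : ℝ → ℂ) := (Lp.coeFn_smul c u).symm
    refine ⟨fun k hk => ?_, ⟨c • gu, cu.const_smul c,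
      hsm.symm.trans (eu.const_smul c), by simp [zu]⟩, ?_⟩
    · obtain ⟨g, hg, mg⟩ := hu k hk
      exact ⟨c • g, (hg.const_smul c).congr hsm (Filter.EventuallyEq.refl _ _), mg.const_smul c⟩
    · refine (wu.const_smul c).ae_eq (hsm.mono fun x hx => ?_)
      simp only [Pi.smul_apply, smul_eq_mul] at hx ⊢
      rw [← hx]
      ring

theorem schrodingerDomain_memLp {W : ℝ → ℝ} {u : L2} (hu : u ∈ schrodingerDomain W) :
    MemLp (fun x => -weakDeriv 2 u x + (W x : ℂ) * u x) 2 volPos := by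
  obtain ⟨g, hg, mg⟩ := hu.1 2 le_rfl
  exact ((mg.ae_eq hg.weakDeriv_eq.symm).neg).add hu.2.2

/-- The operator `A u = -u'' + W u` on `L²(ℝ₊)` with domain
`{u ∈ H²(ℝ₊) : u(0) = 0, W u ∈ L²(ℝ₊)}`. -/
def schrodinger (W : ℝ → ℝ) : L2 →ₗ.[ℂ] L2 where
  domain := schrodingerDomain W
  toFun :=
    { toFun := fun u => (schrodingerDomain_memLp u.2).toLp _
      map_add' := by
        intro u v
        have hadd := (Lp.coeFn_add (u : L2) v).symm
        obtain ⟨g, hg, -⟩ := u.2.1 2 le_rfl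
        obtain ⟨g', hg', -⟩ := v.2.1 2 le_rfl
        have hs := ((hg.add hg').congr hadd (Filter.EventuallyEq.refl _ _)).weakDeriv_eq
        rw [← MemLp.toLp_add, MemLp.toLp_eq_toLp_iff]
        filter_upwards [hadd, hg.weakDeriv_eq, hg'.weakDeriv_eq, hs] with x h1 h2 h3 h4
        simp only [Submodule.coe_add, Pi.add_apply] at h1 h4 ⊢
        rw [h2, h3, h4, ← h1]
        ring
      map_smul' := by
        intro c u
        have hsm := (Lp.coeFn_smul c (u : L2)).symm
        obtain ⟨g, hg, -⟩ := u.2.1 2 le_rfl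
        have hs := ((hg.const_smul c).congr hsm (Filter.EventuallyEq.refl _ _)).weakDeriv_eq
        rw [RingHom.id_apply, ← MemLp.toLp_const_smul, MemLp.toLp_eq_toLp_iff]
        filter_upwards [hsm, hg.weakDeriv_eq, hs] with x h1 h2 h4
        simp only [Submodule.coe_smul, Pi.smul_apply, smul_eq_mul] at h1 h4 ⊢
        rw [h2, h4, ← h1]
        ring }

/-! ### The potentials, the weighted spaces and their norms -/

/-- `W` is smooth on `[0, ∞)`, `W ≥ 1`, and each derivative of `W` is bounded by a multiple
of `W`. -/
structure IsAdmissible (W : ℝ → ℝ) : Prop where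
  smooth : ContDiffOn ℝ ∞ W (Ici 0)
  one_le : ∀ x, 0 ≤ x → 1 ≤ W x
  deriv_le : ∀ k : ℕ, ∃ C : ℝ, 0 < C ∧
    ∀ x, 0 ≤ x → |iteratedDerivWithin k W (Ici 0) x| ≤ C * W x

/-- The function `W ^ ((s - k) / 2) f ^ (k)` on `(0, ∞)`. -/
def weightedDeriv (W : ℝ → ℝ) (s k : ℕ) (f : ℝ → ℂ) : ℝ → ℂ :=
  fun x => ((W x ^ (((s : ℝ) - k) / 2) : ℝ) : ℂ) * weakDeriv k f x

/-- For all `0 ≤ k ≤ s`, `W ^ ((s - k) / 2) f ^ (k) ∈ L²(ℝ₊)`. -/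
def MemWeighted (W : ℝ → ℝ) (s : ℕ) (f : ℝ → ℂ) : Prop :=
  ∀ k ≤ s, (∃ g, HasWeakDeriv k f g) ∧ MemLp (weightedDeriv W s k f) 2 volPos

/-- The iterated boundary conditions `((-d²/dx² + W) ^ p f)(0) = 0` for `0 ≤ p ≤ ⌊(s - 1) / 2⌋`
(used for `s ≥ 1`). -/
def BoundaryConditions (W : ℝ → ℝ) (s : ℕ) (f : ℝ → ℂ) : Prop :=
  ∀ p ≤ (s - 1) / 2, ∃ g, IsSchrodingerPow W p f g ∧ VanishesAtZero g

/-- `∑_{k ≤ s} ‖W ^ ((s - k) / 2) f ^ (k)‖` with the norm of `L²(ℝ₊)`. -/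
def weightedNorm (W : ℝ → ℝ) (s : ℕ) (f : ℝ → ℂ) : ℝ :=
  ∑ k ∈ Finset.range (s + 1), (eLpNorm (weightedDeriv W s k f) 2 volPos).toReal

end

end HalfLine

namespace HalfLine

open scoped NNReal

/-! The proof is an induction on `s` in steps of two, resting on A^((s+2)/2) = A^(s/2) ∘ A
(`halfPow_add_two`). Put f = Au. The boundary conditions of order s+2 for u are u(0) = 0 together
with those of order s for f (`forall_boundary_succ_iff`), so it remains to see that the weighted
norm of order s+2 of u is comparable to that of order s of f.

One direction is Leibniz: f^(k) = (Wu)^(k) - u^(k+2), with |W^(j)| ≤ M W and W ≥ 1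
(`exists_eWeightedNorm_rhs_le`). For the other (`exists_eWeightedNorm_le_rhs`), u and u' are
controlled by an energy estimate: multiply the equation by W^m times the conjugate of u and
integrate by parts. Since (W^m)'' = O(W^m), each such estimate gains one power of W over the
previous one (`energy_step`, `energy_estimate`). Higher derivatives then follow from u^(k+2) =
(Wu)^(k) - f^(k).

The base case s = 0 is trivial. For s = 1, D(A^(1/2)) is the form domain: U(0) = 0 with U' and
W^(1/2) U in L², and ‖A^(1/2) u‖² = ‖U'‖² + ‖W^(1/2) U‖² (`exists_inForm_halfPow_one`,
`mem_halfPow_one_of_inForm`).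

Self-adjointness: an element v of D(A*) solves the equation in distributions and vanishes at 0, and
the energy estimate then yields Wv ∈ L², so v ∈ D(A). As A ≥ 1, it has a bounded nonnegative inverse
T. The square root of A is the inverse of √T, unique because √T is, and all operator identities are
checked on bounded inverses.

Every constant is chosen before W, from `s` and a common bound M for finitely many of the C_k. -/

/-! ### Absolutely continuous functions on the closed half-line -/

/-- `F` is a primitive on `[0, ∞)` of the locally integrable function `f`. -/
structure IsPrim (F f : ℝ → ℂ) : Prop where
  int : ∀ x, 0 ≤ x → IntervalIntegrable f volume 0 x
  eq : ∀ x, 0 ≤ x → F x = F 0 + ∫ t in (0 : ℝ)..x, f t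

/-- Increments of ∫ f are dominated by those of the real function ∫ ‖f‖, which is absolutely
continuous. -/
theorem absolutelyContinuousOnInterval_integral {f : ℝ → ℂ} {a b : ℝ}
    (h : IntervalIntegrable f volume a b) :
    AbsolutelyContinuousOnInterval (fun x ↦ ∫ v in a..x, f v) a b := by
  have hn := h.norm.absolutelyContinuousOnInterval_intervalIntegral (c := a) (by simp)
  rw [absolutelyContinuousOnInterval_iff] at hn ⊢
  intro ε hε
  obtain ⟨δ, hδ, H⟩ := hn ε hε
  refine ⟨δ, hδ, fun E hE hs => lt_of_le_of_lt (Finset.sum_le_sum fun i hi => ?_) (H E hE hs)⟩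
  have h1 := (hE.1 i hi).1
  have h2 := (hE.1 i hi).2
  have s1 : uIcc a (E.2 i).1 ⊆ uIcc a b := uIcc_subset_uIcc_left h1
  have s2 : uIcc a (E.2 i).2 ⊆ uIcc a b := uIcc_subset_uIcc_left h2
  rw [dist_comm, dist_comm (∫ v in a..(E.2 i).1, ‖f v‖), dist_eq_norm, dist_eq_norm,
    intervalIntegral.integral_interval_sub_left (h.mono_set s2) (h.mono_set s1),
    intervalIntegral.integral_interval_sub_left (h.norm.mono_set s2) (h.norm.mono_set s1)]
  exact intervalIntegral.norm_integral_le_abs_integral_norm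

/-- The difference between FG and the primitive of fG + Fg is absolutely continuous with derivative
zero almost everywhere, hence constant. Most integrations by parts below are instances of this. -/
theorem IsPrim.mul {F f G g : ℝ → ℂ} (hF : IsPrim F f) (hG : IsPrim G g) :
    IsPrim (fun x => F x * G x) (fun x => f x * G x + F x * g x) := by
  have cont : ∀ {F f : ℝ → ℂ}, IsPrim F f → ∀ x, 0 ≤ x → ContinuousOn F (uIcc 0 x) := by
    intro F f hF x hx
    refine ((absolutelyContinuousOnInterval_integral (hF.int x hx)).continuousOn.const_add
      (F 0)).congr fun y hy => ?_
    rw [uIcc_of_le hx] at hy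
    exact hF.eq y hy.1
  have hint : ∀ x, 0 ≤ x → IntervalIntegrable (fun x => f x * G x + F x * g x) volume 0 x :=
    fun x hx => ((hF.int x hx).mul_continuousOn (cont hG x hx)).add
      ((hG.int x hx).continuousOn_mul (cont hF x hx))
  refine ⟨hint, fun x hx => ?_⟩
  -- F and G are constrained only on [0, ∞). P and Q agree with them there and, being indefinite
  -- integrals, have the expected two-sided derivatives almost everywhere on the interval.
  set P : ℝ → ℂ := fun x => F 0 + ∫ t in (0 : ℝ)..x, f t
  set Q : ℝ → ℂ := fun x => G 0 + ∫ t in (0 : ℝ)..x, g t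
  have hc : ∀ c : ℂ, AbsolutelyContinuousOnInterval (fun _ : ℝ => c) 0 x := fun c =>
    ((LipschitzWith.const c).lipschitzOnWith (K := 0)).absolutelyContinuousOnInterval
  have aP : AbsolutelyContinuousOnInterval P 0 x :=
    (hc (F 0)).fun_add (absolutelyContinuousOnInterval_integral (hF.int x hx))
  have aQ : AbsolutelyContinuousOnInterval Q 0 x :=
    (hc (G 0)).fun_add (absolutelyContinuousOnInterval_integral (hG.int x hx))
  have aPQ : AbsolutelyContinuousOnInterval (fun y => P y * Q y) 0 x := aP.fun_smul aQ
  have aI := absolutelyContinuousOnInterval_integral (hint x hx)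
  have aD := aPQ.fun_sub aI
  have hd : ∀ᵐ y, y ∈ uIcc 0 x → HasDerivAt (fun y => P y * Q y -
      ∫ v in (0 : ℝ)..y, (f v * G v + F v * g v)) 0 y := by
    filter_upwards [(hF.int x hx).ae_hasDerivAt_integral, (hG.int x hx).ae_hasDerivAt_integral,
      (hint x hx).ae_hasDerivAt_integral] with y h1 h2 h3 hy
    have k1 := (h1 hy 0 left_mem_uIcc).const_add (F 0)
    have k2 := (h2 hy 0 left_mem_uIcc).const_add (G 0)
    have k3 := (k1.mul k2).sub (h3 hy 0 left_mem_uIcc)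
    have hy0 : 0 ≤ y := by rw [uIcc_of_le hx] at hy; exact hy.1
    rw [← hF.eq y hy0, ← hG.eq y hy0, sub_self] at k3
    exact k3
  obtain ⟨C, hC⟩ := aD.const_of_ae_hasDerivAt_zero hd
  have e1 := hC 0 left_mem_uIcc
  have e2 := hC x right_mem_uIcc
  have e3 := e2.trans e1.symm
  simp only [P, Q, intervalIntegral.integral_same, add_zero, sub_zero] at e3
  rw [← hF.eq x hx, ← hG.eq x hx] at e3
  linear_combination e3

theorem IsPrim.continuousOn {F f : ℝ → ℂ} (hF : IsPrim F f) : ContinuousOn F (Ici 0) := by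
  intro x hx
  have h : ContinuousOn F (Icc 0 (x + 1)) := by
    have := (absolutelyContinuousOnInterval_integral
      (hF.int (x + 1) (by linarith [mem_Ici.1 hx]))).continuousOn.const_add (F 0)
    rw [uIcc_of_le (by linarith [mem_Ici.1 hx])] at this
    exact this.congr fun y hy => hF.eq y hy.1
  refine (h x ⟨hx, by linarith⟩).mono_of_mem_nhdsWithin ?_
  rw [← Ici_inter_Iic]
  exact Filter.inter_mem self_mem_nhdsWithin (mem_nhdsWithin_of_mem_nhds (Iic_mem_nhds (by linarith)))

theorem IsPrim.congr {F f g : ℝ → ℂ} (hF : IsPrim F f) (h : f =ᵐ[volPos] g) : IsPrim F g := by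
  have key : ∀ x, 0 ≤ x → f =ᵐ[volume.restrict (Ioc 0 x)] g := fun x _ =>
    ae_mono (Measure.restrict_mono Ioc_subset_Ioi_self le_rfl) h
  refine ⟨fun x hx => (hF.int x hx).congr_ae ?_, fun x hx => ?_⟩
  · rw [uIoc_of_le hx]
    exact key x hx
  · rw [hF.eq x hx, intervalIntegral.integral_of_le hx, intervalIntegral.integral_of_le hx,
      integral_congr_ae (key x hx)]

theorem IsPrim.conj {F f : ℝ → ℂ} (hF : IsPrim F f) :
    IsPrim (fun x => starRingEnd ℂ (F x)) (fun x => starRingEnd ℂ (f x)) := by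
  refine ⟨fun x hx => ?_, fun x hx => ?_⟩
  · have := hF.int x hx
    rw [intervalIntegrable_iff] at this ⊢
    exact this.congr' (Complex.continuous_conj.comp_aestronglyMeasurable this.1)
      (Filter.Eventually.of_forall fun y => (RCLike.norm_conj _).symm)
  · rw [hF.eq x hx, map_add, intervalIntegral.integral_of_le hx,
      intervalIntegral.integral_of_le hx, integral_conj]

theorem isPrim_integral {f : ℝ → ℂ} (hf : ∀ x, 0 ≤ x → IntervalIntegrable f volume 0 x) (c : ℂ) :
    IsPrim (fun x => c + ∫ t in (0 : ℝ)..x, f t) f :=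
  ⟨hf, fun x _ => by simp⟩

theorem isPrim_of_hasDerivAt {F f : ℝ → ℂ} (hF : ContinuousOn F (Ici 0))
    (hd : ∀ x, 0 < x → HasDerivAt F (f x) x) (hf : ContinuousOn f (Ici 0)) : IsPrim F f := by
  have hi : ∀ x, 0 ≤ x → IntervalIntegrable f volume 0 x := fun x hx =>
    (hf.mono (by rw [uIcc_of_le hx]; exact Icc_subset_Ici_self)).intervalIntegrable
  refine ⟨hi, fun x hx => ?_⟩
  rw [intervalIntegral.integral_eq_sub_of_hasDerivAt_of_le hx (hF.mono Icc_subset_Ici_self)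
    (fun y hy => hd y hy.1) (hi x hx)]
  ring

theorem IsPrim.integral_eq_zero {F f : ℝ → ℂ} (hF : IsPrim F f) {X : ℝ} (hX : 0 ≤ X)
    (h0 : F 0 = 0) (h1 : F X = 0) : ∫ t in (0 : ℝ)..X, f t = 0 := by
  have := hF.eq X hX
  rw [h0, h1, zero_add] at this
  exact this.symm

theorem setIntegral_Ioi_eq_intervalIntegral {E : Type*} [NormedAddCommGroup E] [NormedSpace ℝ E]
    {h : ℝ → E} {X : ℝ} (hX : 0 ≤ X)
    (hz : ∀ x, X < x → h x = 0) : ∫ x in Ioi 0, h x = ∫ x in (0 : ℝ)..X, h x := by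
  rw [intervalIntegral.integral_of_le hX]
  refine setIntegral_eq_of_subset_of_forall_sdiff_eq_zero measurableSet_Ioi Ioc_subset_Ioi_self ?_
  rintro x ⟨hx, hx'⟩
  exact hz x (not_le.1 fun h => hx' ⟨hx, h⟩)

/-! ### Test functions -/

theorem IsTest.eq_zero_of_nonpos {φ : ℝ → ℝ} (hφ : IsTest φ) (k : ℕ) {x : ℝ} (hx : x ≤ 0) :
    iteratedDeriv k φ x = 0 :=
  image_eq_zero_of_notMem_tsupport fun h =>
    absurd (hφ.supp (IsTest.tsupport_iteratedDeriv k h)) (not_lt.2 hx)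

theorem IsTest.exists_bounds {φ : ℝ → ℝ} (hφ : IsTest φ) :
    ∃ a X : ℝ, 0 < a ∧ a < X ∧ tsupport φ ⊆ Icc a X := by
  rcases (tsupport φ).eq_empty_or_nonempty with h | h
  · exact ⟨1, 2, by norm_num, by norm_num, by simp [h]⟩
  · have hK : IsCompact (tsupport φ) := hφ.compact
    obtain ⟨a, ha, hm⟩ := hK.exists_isLeast h
    obtain ⟨b, hb, hM⟩ := hK.exists_isGreatest h
    exact ⟨a, b + 1, hφ.supp ha, by linarith [hM ha], fun x hx => ⟨hm hx, by linarith [hM hx]⟩⟩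

theorem IsTest.exists_eq_zero {φ : ℝ → ℝ} (hφ : IsTest φ) :
    ∃ X : ℝ, 0 ≤ X ∧ ∀ k x, X ≤ x → iteratedDeriv k φ x = 0 := by
  obtain ⟨a, X, ha, haX, hs⟩ := hφ.exists_bounds
  refine ⟨X + 1, by linarith, fun k x hx => image_eq_zero_of_notMem_tsupport fun h => ?_⟩
  have := (hs (IsTest.tsupport_iteratedDeriv k h)).2
  linarith

theorem IsTest.deriv {φ : ℝ → ℝ} (hφ : IsTest φ) : IsTest (deriv φ) := by
  have h1 := IsTest.tsupport_iteratedDeriv (φ := φ) 1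
  rw [iteratedDeriv_one] at h1
  exact ⟨(contDiff_infty_iff_deriv.1 hφ.smooth).2, hφ.compact.deriv, h1.trans hφ.supp⟩

theorem IsTest.iteratedDeriv {φ : ℝ → ℝ} (hφ : IsTest φ) (k : ℕ) : IsTest (iteratedDeriv k φ) := by
  induction k with
  | zero => simpa using hφ
  | succ k ih => rw [iteratedDeriv_succ]; exact ih.deriv

theorem IsTest.isPrim {φ : ℝ → ℝ} (hφ : IsTest φ) :
    IsPrim (fun x => (φ x : ℂ)) (fun x => ((_root_.deriv φ x : ℝ) : ℂ)) := by
  refine isPrim_of_hasDerivAt (Complex.continuous_ofReal.comp hφ.smooth.continuous).continuousOn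
    (fun x _ => ?_) (Complex.continuous_ofReal.comp hφ.deriv.smooth.continuous).continuousOn
  exact ((hφ.smooth.differentiable (by simp)) x).hasDerivAt.ofReal_comp

theorem IsTest.of_tsupport {φ ψ : ℝ → ℝ} (hφ : IsTest φ) (hψ : ContDiff ℝ ∞ ψ)
    (h : tsupport ψ ⊆ tsupport φ) : IsTest ψ :=
  ⟨hψ, hφ.compact.of_isClosed_subset (isClosed_tsupport _) h, h.trans hφ.supp⟩

theorem IsTest.sub_const_mul {φ ψ : ℝ → ℝ} (hφ : IsTest φ) (hψ : IsTest ψ) (c : ℝ) :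
    IsTest (fun x => φ x - c * ψ x) := by
  have hs : tsupport (fun x => φ x - c * ψ x) ⊆ tsupport φ ∪ tsupport ψ := by
    refine closure_minimal (fun x hx => ?_) ((isClosed_tsupport _).union (isClosed_tsupport _))
    by_contra hcon
    rw [mem_union, not_or] at hcon
    apply hx
    simp [image_eq_zero_of_notMem_tsupport hcon.1, image_eq_zero_of_notMem_tsupport hcon.2]
  refine ⟨hφ.smooth.sub (contDiff_const.mul hψ.smooth), ?_, hs.trans (union_subset hφ.supp hψ.supp)⟩
  have hK : IsCompact (tsupport φ ∪ tsupport ψ) := IsCompact.union hφ.compact hψ.compact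
  exact hK.of_isClosed_subset (isClosed_tsupport _) hs

/-- The running integral vanishes to the left of the support of η and, because η has mean zero, also
to its right. -/
theorem IsTest.exists_primitive {η : ℝ → ℝ} (hη : IsTest η) (h0 : ∫ x in Ioi 0, η x = 0) :
    ∃ φ, IsTest φ ∧ _root_.deriv φ = η := by
  obtain ⟨a, X, ha, haX, hs⟩ := hη.exists_bounds
  have hc := hη.smooth.continuous
  have hz : ∀ x, x ∉ Icc a X → η x = 0 := fun x hx =>
    image_eq_zero_of_notMem_tsupport fun h => hx (hs h)
  have hd : ∀ x, HasDerivAt (fun x => ∫ t in (0 : ℝ)..x, η t) (η x) x := fun x =>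
    intervalIntegral.integral_hasDerivAt_right (hc.intervalIntegrable _ _)
      (hc.stronglyMeasurableAtFilter _ _) hc.continuousAt
  have hdv : _root_.deriv (fun x => ∫ t in (0 : ℝ)..x, η t) = η := funext fun x => (hd x).deriv
  have hsup : tsupport (fun x => ∫ t in (0 : ℝ)..x, η t) ⊆ Icc a X := by
    refine closure_minimal (fun x hx => ?_) isClosed_Icc
    by_contra hcon
    apply hx
    rcases lt_or_ge x a with hxa | hxa
    · refine intervalIntegral.integral_zero_ae (Filter.Eventually.of_forall fun t ht => ?_)
      refine hz t fun h => ?_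
      rcases le_total 0 x with h' | h'
      · rw [uIoc_of_le h'] at ht; linarith [ht.2, h.1]
      · rw [uIoc_of_ge h'] at ht; linarith [ht.2, h.1]
    · have hxX : X < x := by
        by_contra h
        exact hcon ⟨hxa, not_lt.1 h⟩
      change ∫ t in (0 : ℝ)..x, η t = 0
      rw [← setIntegral_Ioi_eq_intervalIntegral (by linarith)
        (fun t ht => hz t fun h => by linarith [h.2]), h0]
  refine ⟨fun x => ∫ t in (0 : ℝ)..x, η t, ⟨?_, ?_, ?_⟩, hdv⟩
  · rw [contDiff_infty_iff_deriv, hdv]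
    exact ⟨fun x => (hd x).differentiableAt, hη.smooth⟩
  · exact isCompact_Icc.of_isClosed_subset (isClosed_tsupport _) hsup
  · exact hsup.trans fun x hx => lt_of_lt_of_le ha hx.1

theorem exists_isTest_integral_eq_one : ∃ ψ : ℝ → ℝ, IsTest ψ ∧ ∫ x in Ioi 0, ψ x = 1 := by
  let b : ContDiffBump (1 : ℝ) := ⟨1 / 4, 1 / 2, by norm_num, by norm_num⟩
  have hs : tsupport (b.normed volume) ⊆ Ioi 0 := by
    rw [b.tsupport_normed_eq]
    intro x hx
    have := hx
    simp only [Metric.mem_closedBall, Real.dist_eq, b] at this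
    rw [abs_le] at this
    exact mem_Ioi.2 (by linarith [this.1])
  refine ⟨b.normed volume, ⟨b.contDiff_normed, b.hasCompactSupport_normed, hs⟩, ?_⟩
  refine (setIntegral_eq_integral_of_forall_compl_eq_zero fun x hx => ?_).trans
    (b.integral_normed (μ := volume))
  exact image_eq_zero_of_notMem_tsupport fun h => hx (hs h)

/-! ### Calculus of weak derivatives -/

theorem IsPrim.locallyIntegrableOn {F f : ℝ → ℂ} (hF : IsPrim F f) :
    LocallyIntegrableOn f (Ioi 0) := by
  intro x hx
  refine ⟨Ioc 0 (x + 1), ?_, ?_⟩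
  · exact mem_nhdsWithin_of_mem_nhds (Ioc_mem_nhds hx (by linarith))
  · have h := (hF.int (x + 1) (by linarith [mem_Ioi.1 hx])).1
    exact h

theorem _root_.ContinuousOn.locallyIntegrableOn_Ioi {F : ℝ → ℂ} (hF : ContinuousOn F (Ici 0)) :
    LocallyIntegrableOn F (Ioi 0) :=
  (hF.mono Ioi_subset_Ici_self).locallyIntegrableOn measurableSet_Ioi

theorem IsPrim.hasWeakDeriv {F f : ℝ → ℂ} (hF : IsPrim F f) : HasWeakDeriv 1 F f := by
  refine ⟨hF.continuousOn.locallyIntegrableOn_Ioi, hF.locallyIntegrableOn, fun φ hφ => ?_⟩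
  obtain ⟨X, hX, hz⟩ := hφ.exists_eq_zero
  have h0 : φ 0 = 0 := by simpa using hφ.eq_zero_of_nonpos 0 le_rfl
  have h1 : φ X = 0 := by simpa using hz 0 X le_rfl
  have hP := (hφ.isPrim.mul hF).integral_eq_zero hX (by simp [h0]) (by simp [h1])
  rw [setIntegral_Ioi_eq_intervalIntegral hX (fun x hx => by rw [hz 1 x hx.le, zero_smul]),
    setIntegral_Ioi_eq_intervalIntegral hX (fun x hx => by
      rw [← iteratedDeriv_zero (f := φ), hz 0 x hx.le, zero_smul])]
  rw [intervalIntegral.integral_add] at hP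
  · simp only [iteratedDeriv_one, Complex.real_smul]
    linear_combination hP
  · exact (hφ.isPrim.int X hX).mul_continuousOn
      (hF.continuousOn.mono (by rw [uIcc_of_le hX]; exact Icc_subset_Ici_self))
  · exact (hF.int X hX).continuousOn_mul
      (hφ.isPrim.continuousOn.mono (by rw [uIcc_of_le hX]; exact Icc_subset_Ici_self))

/-- If the `(k + 1)`-st distributional derivative of `f` is integrable near `0`, then its `k`-th
one is an absolutely continuous function on `[0, ∞)`. -/
theorem HasWeakDeriv.exists_isPrim {k : ℕ} {f g : ℝ → ℂ} (h : HasWeakDeriv (k + 1) f g)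
    (hg : ∀ x, 0 ≤ x → IntervalIntegrable g volume 0 x) :
    ∃ F, HasWeakDeriv k f F ∧ IsPrim F g := by
  obtain ⟨ψ, hψ, hψ1⟩ := exists_isTest_integral_eq_one
  set G : ℝ → ℂ := fun x => 0 + ∫ t in (0 : ℝ)..x, g t
  have hG : IsPrim G g := isPrim_integral hg 0
  have lG := hG.continuousOn.locallyIntegrableOn_Ioi
  -- The k-th derivative of f will differ from G by a constant. Pairing with ψ, whose integral is 1,
  -- reveals that constant as (-1)^k K.
  set K : ℂ := (∫ x in Ioi 0, iteratedDeriv k ψ x • f x) - (-1) ^ k * ∫ x in Ioi 0, ψ x • G x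
  have hF : IsPrim (fun x => (-1) ^ k * K + ∫ t in (0 : ℝ)..x, g t) g := isPrim_integral hg _
  refine ⟨_, ⟨h.left, hF.continuousOn.locallyIntegrableOn_Ioi, fun η hη => ?_⟩, hF⟩
  have e0 := fun {φ : ℝ → ℝ} (hφ : IsTest φ) {f : ℝ → ℂ} hf => hφ.integrableOn 0 (f := f) hf
  simp only [iteratedDeriv_zero] at e0
  have i0 : ∀ {φ : ℝ → ℝ}, IsTest φ → IntegrableOn φ (Ioi 0) := fun hφ =>
    (hφ.smooth.continuous.integrable_of_hasCompactSupport hφ.compact).integrableOn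
  set m : ℝ := ∫ x in Ioi 0, η x
  -- Du Bois-Reymond: η minus its mean times ψ has mean zero, so it is the derivative of a test
  -- function, to which both hypotheses apply.
  have hθ : IsTest (fun x => η x - m * ψ x) := hη.sub_const_mul hψ m
  have hθ0 : ∫ x in Ioi 0, (η x - m * ψ x) = 0 := by
    rw [integral_sub (i0 hη) ((i0 hψ).const_mul m), integral_const_mul, hψ1]
    simp [m]
  obtain ⟨φ, hφ, hφ'⟩ := hθ.exists_primitive hθ0
  have a1 := h.eq φ hφ
  have a2 := hG.hasWeakDeriv.eq φ hφ
  rw [iteratedDeriv_one, hφ'] at a2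
  rw [iteratedDeriv_succ', hφ'] at a1
  have a3 : iteratedDeriv k (fun x => η x - m * ψ x)
      = fun x => iteratedDeriv k η x - m * iteratedDeriv k ψ x := by
    funext x
    have s1 : ContDiffAt ℝ k η x := (hη.smooth.of_le (by exact_mod_cast le_top)).contDiffAt
    have s2 : ContDiffAt ℝ k ψ x := (hψ.smooth.of_le (by exact_mod_cast le_top)).contDiffAt
    rw [iteratedDeriv_fun_sub s1 (contDiffAt_const.mul s2), iteratedDeriv_const_mul_field]
  rw [a3] at a1
  simp only [sub_smul, mul_smul] at a1 a2
  have s1 : IntegrableOn (fun x => m • iteratedDeriv k ψ x • f x) (Ioi 0) :=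
    (hψ.integrableOn k h.left).smul m
  have s2 : IntegrableOn (fun x => m • ψ x • G x) (Ioi 0) := (e0 hψ lG).smul m
  rw [integral_sub (hη.integrableOn k h.left) s1, integral_smul] at a1
  rw [integral_sub (e0 hη lG) s2, integral_smul] at a2
  have a4 : ∫ x in Ioi 0, η x • ((-1) ^ k * K + ∫ t in (0 : ℝ)..x, g t)
      = m * ((-1) ^ k * K) + ∫ x in Ioi 0, η x • G x := by
    have : ∀ x, η x • ((-1) ^ k * K + ∫ t in (0 : ℝ)..x, g t)
        = (η x : ℂ) * ((-1) ^ k * K) + η x • G x := by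
      intro x
      simp only [G, zero_add, smul_add, Complex.real_smul]
    simp only [this]
    have s3 : IntegrableOn (fun x => (η x : ℂ) * ((-1) ^ k * K)) (Ioi 0) :=
      (i0 hη).ofReal.mul_const _
    rw [integral_add s3 (e0 hη lG), integral_mul_const, integral_complex_ofReal]
  rw [a4]
  have a5 : ((-1 : ℂ) ^ k) * (-1) ^ k = 1 := by rw [← mul_pow]; simp
  simp only [Complex.real_smul] at a1 a2
  simp only [K, Complex.real_smul]
  rw [pow_succ] at a1
  linear_combination a1 - (-1) ^ k * a2 - (m * ((∫ x in Ioi 0, ((iteratedDeriv k ψ x : ℝ) : ℂ) * f x)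
      - (-1) ^ k * ∫ x in Ioi 0, (ψ x : ℂ) * G x)) * a5

theorem hasWeakDeriv_zero_iff {f g : ℝ → ℂ} :
    HasWeakDeriv 0 f g ↔ LocallyIntegrableOn f (Ioi 0) ∧ f =ᵐ[volPos] g := by
  have hr : ∀ {f : ℝ → ℂ}, LocallyIntegrableOn f (Ioi 0) → HasWeakDeriv 0 f f := fun hf =>
    ⟨hf, hf, fun φ _ => by simp⟩
  exact ⟨fun h => ⟨h.left, (hr h.left).unique h⟩,
    fun h => (hr h.1).congr (Filter.EventuallyEq.refl _ _) h.2⟩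

theorem HasWeakDeriv.comp {j k : ℕ} {f g h : ℝ → ℂ} (hg : HasWeakDeriv j f g)
    (hh : HasWeakDeriv k g h) : HasWeakDeriv (j + k) f h := by
  refine ⟨hg.left, hh.right, fun φ hφ => ?_⟩
  have e : _root_.iteratedDeriv (j + k) φ = _root_.iteratedDeriv j (_root_.iteratedDeriv k φ) := by
    rw [iteratedDeriv_eq_iterate, iteratedDeriv_eq_iterate, iteratedDeriv_eq_iterate,
      Function.iterate_add_apply]
  rw [e, hg.eq _ (hφ.iteratedDeriv k), hh.eq φ hφ, pow_add, mul_assoc]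

theorem HasWeakDeriv.of_le {j k : ℕ} {f g h : ℝ → ℂ} (hg : HasWeakDeriv j f g)
    (hh : HasWeakDeriv (j + k) f h) : HasWeakDeriv k g h := by
  refine ⟨hg.right, hh.right, fun φ hφ => ?_⟩
  have e : _root_.iteratedDeriv (j + k) φ = _root_.iteratedDeriv j (_root_.iteratedDeriv k φ) := by
    rw [iteratedDeriv_eq_iterate, iteratedDeriv_eq_iterate, iteratedDeriv_eq_iterate,
      Function.iterate_add_apply]
  have h1 := hh.eq φ hφ
  rw [e, hg.eq _ (hφ.iteratedDeriv k), pow_add, mul_assoc] at h1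
  exact mul_left_cancel₀ (pow_ne_zero j (neg_ne_zero.2 one_ne_zero)) h1

/-! ### Products of weakly differentiable and smooth functions -/

/-- Smoothness of a on the open half-line suffices: the support of φ stays away from 0, and off the
support of the product the product is locally zero. -/
theorem IsTest.smooth_mul {φ a : ℝ → ℝ} (hφ : IsTest φ) (ha : ContDiffOn ℝ ∞ a (Ioi 0)) :
    IsTest (fun x => a x * φ x) := by
  have hs : tsupport (fun x => a x * φ x) ⊆ tsupport φ := tsupport_mul_subset_right
  refine hφ.of_tsupport (contDiff_iff_contDiffAt.2 fun x => ?_) hs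
  by_cases hx : x ∈ tsupport fun x => a x * φ x
  swap
  · exact contDiffAt_const.congr_of_eventuallyEq (notMem_tsupport_iff_eventuallyEq.1 hx)
  have hx0 : x ∈ Ioi (0 : ℝ) := hφ.supp (hs hx)
  exact ((ha x hx0).contDiffAt (isOpen_Ioi.mem_nhds hx0)).mul hφ.smooth.contDiffAt

theorem _root_.MeasureTheory.LocallyIntegrableOn.ofReal_continuousOn_mul {a : ℝ → ℝ} {f : ℝ → ℂ}
    (hf : LocallyIntegrableOn f (Ioi 0)) (ha : ContinuousOn a (Ioi 0)) :
    LocallyIntegrableOn (fun x => (a x : ℂ) * f x) (Ioi 0) :=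
  hf.continuousOn_mul (Complex.continuous_ofReal.comp_continuousOn ha) isOpen_Ioi.isLocallyClosed

/-- The factor a is moved onto the test function: the weak equation is applied to aφ. -/
theorem HasWeakDeriv.smooth_mul {a a' : ℝ → ℝ} {f g : ℝ → ℂ} (h : HasWeakDeriv 1 f g)
    (ha : ContDiffOn ℝ ∞ a (Ioi 0)) (ha' : ContinuousOn a' (Ioi 0))
    (hd : ∀ x, 0 < x → HasDerivAt a (a' x) x) :
    HasWeakDeriv 1 (fun x => (a x : ℂ) * f x) (fun x => (a' x : ℂ) * f x + (a x : ℂ) * g x) := by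
  have l1 := h.left.ofReal_continuousOn_mul ha.continuousOn
  have l2 := h.right.ofReal_continuousOn_mul ha.continuousOn
  have l3 := h.left.ofReal_continuousOn_mul ha'
  refine ⟨l1, l3.add l2, fun φ hφ => ?_⟩
  have hp := hφ.smooth_mul ha
  have e := h.eq _ hp
  have i0 := fun {f : ℝ → ℂ} hf => hφ.integrableOn 0 (f := f) hf
  have i1 := hφ.integrableOn 1 l1
  simp only [iteratedDeriv_zero] at i0
  have e1 : ∫ x in Ioi 0, iteratedDeriv 1 (fun x => a x * φ x) x • f x
      = (∫ x in Ioi 0, φ x • ((a' x : ℂ) * f x))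
        + ∫ x in Ioi 0, iteratedDeriv 1 φ x • ((a x : ℂ) * f x) := by
    rw [← integral_add (i0 l3) i1]
    refine setIntegral_congr_fun measurableSet_Ioi fun x hx => ?_
    have hd2 := (hd x hx).fun_mul ((hφ.smooth.differentiable (by simp)) x).hasDerivAt
    simp only [iteratedDeriv_one]
    rw [HasDerivAt.deriv hd2]
    simp only [Complex.real_smul]
    push_cast
    ring
  have e2 : ∫ x in Ioi 0, φ x • ((a' x : ℂ) * f x + (a x : ℂ) * g x)
      = (∫ x in Ioi 0, φ x • ((a' x : ℂ) * f x)) + ∫ x in Ioi 0, (a x * φ x) • g x := by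
    rw [← integral_add (i0 l3)]
    · refine integral_congr_ae (Filter.Eventually.of_forall fun x => ?_)
      simp only [Complex.real_smul]
      push_cast
      ring
    · have := hp.integrableOn 0 h.right
      rwa [iteratedDeriv_zero] at this
  rw [e1] at e
  rw [e2]
  linear_combination e

/-! ### The derivatives of the potential -/

/-- The derivatives of the potential on `[0, ∞)`. -/
noncomputable def potDeriv (W : ℝ → ℝ) (k : ℕ) : ℝ → ℝ := iteratedDerivWithin k W (Ici 0)

theorem potDeriv_zero (W : ℝ → ℝ) : potDeriv W 0 = W := iteratedDerivWithin_zero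

section Potential

variable {W : ℝ → ℝ}

theorem continuousOn_potDeriv (hW : ContDiffOn ℝ ∞ W (Ici 0))
    (k : ℕ) : ContinuousOn (potDeriv W k) (Ici 0) :=
  hW.continuousOn_iteratedDerivWithin (by exact_mod_cast le_top) (uniqueDiffOn_Ici 0)

theorem hasDerivAt_potDeriv (hW : ContDiffOn ℝ ∞ W (Ici 0)) (k : ℕ) {x : ℝ} (hx : 0 < x) :
    HasDerivAt (potDeriv W k) (potDeriv W (k + 1) x) x := by
  have h := (hW.differentiableOn_iteratedDerivWithin (m := k) (by exact_mod_cast WithTop.coe_lt_top _)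
    (uniqueDiffOn_Ici 0) x hx.le).hasDerivWithinAt
  rw [← iteratedDerivWithin_succ] at h
  exact h.hasDerivAt (Ici_mem_nhds hx)

theorem contDiffOn_potDeriv (hW : ContDiffOn ℝ ∞ W (Ici 0))
    (k : ℕ) : ContDiffOn ℝ ∞ (potDeriv W k) (Ioi 0) := by
  have h : ∀ n : ℕ, ∀ k, ContDiffOn ℝ n (potDeriv W k) (Ioi 0) := by
    intro n
    induction n with
    | zero =>
      intro k
      exact contDiffOn_zero.2 ((continuousOn_potDeriv hW k).mono Ioi_subset_Ici_self)
    | succ n ih =>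
      intro k
      rw [Nat.cast_add, Nat.cast_one, contDiffOn_succ_iff_deriv_of_isOpen isOpen_Ioi]
      refine ⟨fun x hx => (hasDerivAt_potDeriv hW k hx).differentiableAt.differentiableWithinAt,
        fun h => absurd h (by simp), (ih (k + 1)).congr fun x hx => ?_⟩
      exact (hasDerivAt_potDeriv hW k hx).deriv
  exact contDiffOn_infty.2 fun n => h n k

/-- Weak derivatives of a product of a derivative of the potential with a function. -/
theorem exists_hasWeakDeriv_potDeriv_mul (hW : ContDiffOn ℝ ∞ W (Ici 0))
    (h0 : ∀ x, 0 ≤ x → 0 ≤ W x) {N : ℕ} {M : ℝ} (hM : 0 ≤ M)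
    (hb : ∀ k < N, ∀ x, 0 ≤ x → |potDeriv W k x| ≤ M * W x) (k : ℕ) :
    ∀ i, i + k < N → ∀ d : ℕ → ℝ → ℂ, LocallyIntegrableOn (d 0) (Ioi 0) →
      (∀ j < k, HasWeakDeriv 1 (d j) (d (j + 1))) →
      ∃ e, HasWeakDeriv k (fun x => (potDeriv W i x : ℂ) * d 0 x) e ∧
        ∀ x, 0 < x → ‖e x‖ ≤ 2 ^ k * M * W x * ∑ j ∈ Finset.range (k + 1), ‖d j x‖ := by
  induction k with
  | zero =>
    intro i hi d hl _
    refine ⟨_, hasWeakDeriv_zero_iff.2 ⟨hl.ofReal_continuousOn_mul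
      (contDiffOn_potDeriv hW i).continuousOn, Filter.EventuallyEq.refl _ _⟩, fun x hx => ?_⟩
    rw [norm_mul, Complex.norm_real, Real.norm_eq_abs]
    simpa using mul_le_mul_of_nonneg_right (hb i hi x hx.le) (norm_nonneg (d 0 x))
  | succ k ih =>
    intro i hi d hl hd
    -- One derivative turns W^(i) d₀ into W^(i+1) d₀ + W^(i) d₁, and the induction hypothesis
    -- differentiates each term k more times. This is why i is arbitrary and why the constant
    -- doubles.
    obtain ⟨e1, h1, b1⟩ := ih (i + 1) (by omega) d hl (fun j hj => hd j (by omega))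
    obtain ⟨e2, h2, b2⟩ := ih i (by omega) (fun j => d (j + 1)) (hd 0 (by omega)).right
      (fun j hj => hd (j + 1) (by omega))
    have h3 := (hd 0 (by omega)).smooth_mul (contDiffOn_potDeriv hW i)
      (contDiffOn_potDeriv hW (i + 1)).continuousOn (fun x hx => hasDerivAt_potDeriv hW i hx)
    have h4 := h3.comp (h1.add h2)
    rw [add_comm] at h4
    refine ⟨_, h4, fun x hx => ?_⟩
    have s1 : ∑ j ∈ Finset.range (k + 1), ‖d j x‖ ≤ ∑ j ∈ Finset.range (k + 1 + 1), ‖d j x‖ := by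
      rw [Finset.sum_range_succ _ (k + 1)]
      linarith [norm_nonneg (d (k + 1) x)]
    have s2 : ∑ j ∈ Finset.range (k + 1), ‖d (j + 1) x‖
        ≤ ∑ j ∈ Finset.range (k + 1 + 1), ‖d j x‖ := by
      rw [Finset.sum_range_succ' _ (k + 1)]
      linarith [norm_nonneg (d 0 x)]
    have hc : 0 ≤ 2 ^ k * M * W x := by have := h0 x hx.le; positivity
    calc ‖e1 x + e2 x‖ ≤ ‖e1 x‖ + ‖e2 x‖ := norm_add_le _ _
      _ ≤ 2 ^ k * M * W x * (∑ j ∈ Finset.range (k + 1 + 1), ‖d j x‖)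
          + 2 ^ k * M * W x * (∑ j ∈ Finset.range (k + 1 + 1), ‖d j x‖) :=
        add_le_add ((b1 x hx).trans (mul_le_mul_of_nonneg_left s1 hc))
          ((b2 x hx).trans (mul_le_mul_of_nonneg_left s2 hc))
      _ = _ := by rw [pow_succ]; ring

/-! ### Powers of the differential expression -/

theorem IsTest.schrodingerExpr (hW : ContDiffOn ℝ ∞ W (Ici 0))
    {φ : ℝ → ℝ} (hφ : IsTest φ) : IsTest (schrodingerExpr W φ) := by
  have h0 := contDiffOn_potDeriv hW 0
  rw [potDeriv_zero] at h0
  convert (hφ.smooth_mul h0).sub_const_mul (hφ.iteratedDeriv 2) 1 using 1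
  funext x
  simp only [HalfLine.schrodingerExpr]
  ring

theorem IsTest.schrodingerExpr_iterate (hW : ContDiffOn ℝ ∞ W (Ici 0))
    {φ : ℝ → ℝ} (hφ : IsTest φ) (p : ℕ) :
    IsTest ((HalfLine.schrodingerExpr W)^[p] φ) := by
  induction p with
  | zero => exact hφ
  | succ p ih => rw [Function.iterate_succ_apply']; exact ih.schrodingerExpr hW

/-- The iterated expression of a test function is again a test function, so the equation satisfied
by u and f can be tested on it. This strips one application of the operator. -/
theorem IsSchrodingerPow.succ_iff (hW : ContDiffOn ℝ ∞ W (Ici 0))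
    {p : ℕ} {f g u : ℝ → ℂ} (h : IsSchrodingerPow W 1 u f) :
    IsSchrodingerPow W (p + 1) u g ↔ IsSchrodingerPow W p f g := by
  have key : ∀ φ, IsTest φ → ∫ x in Ioi 0, (schrodingerExpr W)^[p + 1] φ x • u x
      = ∫ x in Ioi 0, (schrodingerExpr W)^[p] φ x • f x := by
    intro φ hφ
    rw [Function.iterate_succ_apply']
    exact h.eq _ (hφ.schrodingerExpr_iterate hW p)
  exact ⟨fun H => ⟨h.right, H.right, fun φ hφ => by rw [← key φ hφ]; exact H.eq φ hφ⟩,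
    fun H => ⟨h.left, H.right, fun φ hφ => by rw [key φ hφ]; exact H.eq φ hφ⟩⟩

theorem integral_schrodingerExpr_smul (hW : ContDiffOn ℝ ∞ W (Ici 0))
    {φ : ℝ → ℝ} (hφ : IsTest φ) {u : ℝ → ℂ}
    (hu : LocallyIntegrableOn u (Ioi 0)) :
    ∫ x in Ioi 0, schrodingerExpr W φ x • u x
      = (∫ x in Ioi 0, φ x • ((W x : ℂ) * u x)) - ∫ x in Ioi 0, iteratedDeriv 2 φ x • u x := by
  have h0 := (contDiffOn_potDeriv hW 0).continuousOn
  rw [potDeriv_zero] at h0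
  have i0 := hφ.integrableOn 0 (hu.ofReal_continuousOn_mul h0)
  rw [iteratedDeriv_zero] at i0
  rw [← integral_sub i0 (hφ.integrableOn 2 hu)]
  refine integral_congr_ae (Filter.Eventually.of_forall fun x => ?_)
  simp only [schrodingerExpr, Complex.real_smul]
  push_cast
  ring

theorem isSchrodingerPow_one_iff (hW : ContDiffOn ℝ ∞ W (Ici 0))
    {u f : ℝ → ℂ} (hu : LocallyIntegrableOn u (Ioi 0))
    (hf : LocallyIntegrableOn f (Ioi 0)) :
    IsSchrodingerPow W 1 u f ↔ HasWeakDeriv 2 u (fun x => (W x : ℂ) * u x - f x) := by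
  have h0 := (contDiffOn_potDeriv hW 0).continuousOn
  rw [potDeriv_zero] at h0
  have lW := hu.ofReal_continuousOn_mul h0
  have key : ∀ φ, IsTest φ → ∫ x in Ioi 0, φ x • ((W x : ℂ) * u x - f x)
      = (∫ x in Ioi 0, φ x • ((W x : ℂ) * u x)) - ∫ x in Ioi 0, φ x • f x := by
    intro φ hφ
    have i0 := fun {f : ℝ → ℂ} hf => hφ.integrableOn 0 (f := f) hf
    simp only [iteratedDeriv_zero] at i0
    simp only [smul_sub]
    exact integral_sub (i0 lW) (i0 hf)
  constructor
  · refine fun h => ⟨hu, lW.sub hf, fun φ hφ => ?_⟩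
    have e := h.eq φ hφ
    rw [Function.iterate_one, integral_schrodingerExpr_smul hW hφ hu] at e
    rw [key φ hφ]
    linear_combination -e
  · refine fun h => ⟨hu, hf, fun φ hφ => ?_⟩
    have e := h.eq φ hφ
    rw [key φ hφ] at e
    rw [Function.iterate_one, integral_schrodingerExpr_smul hW hφ hu]
    linear_combination -e

end Potential

theorem isSchrodingerPow_zero_iff {W : ℝ → ℝ} {f g : ℝ → ℂ} :
    IsSchrodingerPow W 0 f g ↔ HasWeakDeriv 0 f g := by
  refine ⟨fun h => ⟨h.left, h.right, fun φ hφ => ?_⟩, fun h => ⟨h.left, h.right, fun φ hφ => ?_⟩⟩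
  · simpa using h.eq φ hφ
  · simpa using h.eq φ hφ

theorem VanishesAtZero.congr {f g : ℝ → ℂ} (h : VanishesAtZero f) (hfg : f =ᵐ[volPos] g) :
    VanishesAtZero g := by
  obtain ⟨F, hF, e, h0⟩ := h
  exact ⟨F, hF, hfg.symm.trans e, h0⟩

/-- The inductive step for the boundary conditions: the p-th condition on f is the (p+1)-st on u.
Writing p ≤ ⌊(s-1)/2⌋ as 2p < s makes the list empty at s = 0, as the induction requires. -/
theorem forall_boundary_succ_iff {W : ℝ → ℝ} (hW : ContDiffOn ℝ ∞ W (Ici 0)) {u f : ℝ → ℂ}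
    (h : IsSchrodingerPow W 1 u f) (s : ℕ) :
    (∀ p, 2 * p < s + 2 → ∃ g, IsSchrodingerPow W p u g ∧ VanishesAtZero g) ↔
      VanishesAtZero u ∧ ∀ p, 2 * p < s → ∃ g, IsSchrodingerPow W p f g ∧ VanishesAtZero g := by
  constructor
  · refine fun H => ⟨?_, fun p hp => ?_⟩
    · obtain ⟨g, hg, vg⟩ := H 0 (by omega)
      rw [isSchrodingerPow_zero_iff, hasWeakDeriv_zero_iff] at hg
      exact vg.congr hg.2.symm
    · obtain ⟨g, hg, vg⟩ := H (p + 1) (by omega)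
      exact ⟨g, (h.succ_iff hW).1 hg, vg⟩
  · rintro ⟨h0, H⟩ p hp
    rcases p with _ | p
    · exact ⟨u, isSchrodingerPow_zero_iff.2 (hasWeakDeriv_zero_iff.2
        ⟨h.left, Filter.EventuallyEq.refl _ _⟩), h0⟩
    · obtain ⟨g, hg, vg⟩ := H p (by omega)
      exact ⟨g, (h.succ_iff hW).2 hg, vg⟩

/-! ### Cutoff functions and weights -/

/-- Translates of one smooth transition, so the bound K on the derivatives does not depend on the
place R of the cutoff. -/
theorem exists_cutoff : ∃ K : ℝ, 0 ≤ K ∧ ∀ R : ℝ, ∃ e e' e'' : ℝ → ℝ,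
    Continuous e'' ∧ (∀ x, HasDerivAt e (e' x) x) ∧ (∀ x, HasDerivAt e' (e'' x) x) ∧
    (∀ x, 0 ≤ e x ∧ e x ≤ 1) ∧ (∀ x, x ≤ R → e x = 1 ∧ e' x = 0) ∧
    (∀ x, R + 1 ≤ x → e x = 0 ∧ e' x = 0) ∧ ∀ x, |e' x| ≤ K ∧ |e'' x| ≤ K := by
  set S : ℝ → ℝ := Real.smoothTransition
  have hS : ContDiff ℝ ∞ S := Real.smoothTransition.contDiff
  have hS1 : ContDiff ℝ ∞ (deriv S) := (contDiff_infty_iff_deriv.1 hS).2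
  have hS2 : ContDiff ℝ ∞ (deriv (deriv S)) := (contDiff_infty_iff_deriv.1 hS1).2
  have z : ∀ x, x ∉ Icc (0 : ℝ) 1 → deriv S x = 0 := by
    intro x hx
    rw [mem_Icc, not_and_or, not_le, not_le] at hx
    rcases hx with hx | hx
    · have : S =ᶠ[nhds x] fun _ => 0 := by
        filter_upwards [Iio_mem_nhds hx] with y hy
        exact Real.smoothTransition.zero_of_nonpos (le_of_lt hy)
      rw [this.deriv_eq, deriv_const]
    · have : S =ᶠ[nhds x] fun _ => 1 := by
        filter_upwards [Ioi_mem_nhds hx] with y hy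
        exact Real.smoothTransition.one_of_one_le (le_of_lt hy)
      rw [this.deriv_eq, deriv_const]
  have c1 : HasCompactSupport (deriv S) := HasCompactSupport.intro isCompact_Icc z
  obtain ⟨K1, h1⟩ := hS1.continuous.bounded_above_of_compact_support c1
  obtain ⟨K2, h2⟩ := hS2.continuous.bounded_above_of_compact_support c1.deriv
  -- The endpoints 0 and 1 are reached by continuity of the derivative.
  have z' : ∀ x, x ≤ 0 ∨ 1 ≤ x → deriv S x = 0 := by
    have hcl : IsClosed {x | deriv S x = 0} := isClosed_eq hS1.continuous continuous_const
    have h0 : closure (Iio (0 : ℝ)) ⊆ {x | deriv S x = 0} :=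
      closure_minimal (fun x hx => z x fun h => absurd h.1 (not_le.2 hx)) hcl
    have h1 : closure (Ioi (1 : ℝ)) ⊆ {x | deriv S x = 0} :=
      closure_minimal (fun x hx => z x fun h => absurd h.2 (not_le.2 hx)) hcl
    rw [closure_Iio] at h0
    rw [closure_Ioi] at h1
    rintro x (hx | hx)
    · exact h0 hx
    · exact h1 hx
  refine ⟨max K1 K2, le_max_of_le_left ((norm_nonneg _).trans (h1 0)), fun R =>
    ⟨fun x => S (R + 1 - x), fun x => -deriv S (R + 1 - x), fun x => deriv (deriv S) (R + 1 - x),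
      hS2.continuous.comp (by fun_prop), fun x => ?_, fun x => ?_,
      fun x => ⟨Real.smoothTransition.nonneg _, Real.smoothTransition.le_one _⟩,
      fun x hx => ⟨Real.smoothTransition.one_of_one_le (by linarith), ?_⟩,
      fun x hx => ⟨Real.smoothTransition.zero_of_nonpos (by linarith), ?_⟩, fun x => ⟨?_, ?_⟩⟩⟩
  · have hl : HasDerivAt (fun x : ℝ => R + 1 - x) (-1) x := by
      simpa using (hasDerivAt_id x).const_sub (R + 1)
    have := (hS.differentiable (by simp) (R + 1 - x)).hasDerivAt.comp x hl
    simpa [Function.comp_def] using this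
  · have hl : HasDerivAt (fun x : ℝ => R + 1 - x) (-1) x := by
      simpa using (hasDerivAt_id x).const_sub (R + 1)
    have := ((hS1.differentiable (by simp) (R + 1 - x)).hasDerivAt.comp x hl).fun_neg
    simpa [Function.comp_def] using this
  · exact neg_eq_zero.2 (z' _ (Or.inr (by linarith)))
  · exact neg_eq_zero.2 (z' _ (Or.inl (by linarith)))
  · rw [abs_neg]
    exact (h1 _).trans (le_max_left _ _)
  · exact (h2 _).trans (le_max_right _ _)

/-- The bounds `|W⁽ᵏ⁾| ≤ M W` for `k < N`, together with smoothness and `W ≥ 1`. -/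
structure PotBound (W : ℝ → ℝ) (N : ℕ) (M : ℝ) : Prop where
  smooth : ContDiffOn ℝ ∞ W (Ici 0)
  one_le : ∀ x, 0 ≤ x → 1 ≤ W x
  nonneg : 0 ≤ M
  bound : ∀ k < N, ∀ x, 0 ≤ x → |potDeriv W k x| ≤ M * W x

theorem PotBound.mono {W : ℝ → ℝ} {N N' : ℕ} {M : ℝ} (h : PotBound W N M) (hN : N' ≤ N) :
    PotBound W N' M :=
  ⟨h.smooth, h.one_le, h.nonneg, fun k hk => h.bound k (by omega)⟩

theorem PotBound.continuousOn {W : ℝ → ℝ} {N : ℕ} {M : ℝ} (h : PotBound W N M) :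
    ContinuousOn W (Ici 0) := h.smooth.continuousOn

theorem PotBound.pos {W : ℝ → ℝ} {N : ℕ} {M : ℝ} (h : PotBound W N M) {x : ℝ} (hx : 0 ≤ x) :
    0 < W x := lt_of_lt_of_le one_pos (h.one_le x hx)

/-- Powers of W vary slowly relative to themselves because W' and W'' are O(W). This is what lets
them serve as multipliers in the energy estimate. Only two derivatives of W enter, whence the index
3. -/
theorem exists_weight_derivs (M : ℝ) (m : ℕ) : ∃ c : ℝ, 0 ≤ c ∧ ∀ W, PotBound W 3 M →
    ∃ a' a'' : ℝ → ℝ, ContinuousOn a' (Ici 0) ∧ ContinuousOn a'' (Ici 0) ∧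
      (∀ x, 0 < x → HasDerivAt (fun x => W x ^ m) (a' x) x) ∧
      (∀ x, 0 < x → HasDerivAt a' (a'' x) x) ∧
      ∀ x, 0 ≤ x → |a' x| ≤ c * W x ^ m ∧ |a'' x| ≤ c * W x ^ m := by
  induction m with
  | zero =>
    refine ⟨0, le_rfl, fun W hW => ⟨0, 0, continuousOn_const, continuousOn_const, fun x _ => ?_,
      fun x _ => ?_, fun x _ => by simp⟩⟩
    · simpa using hasDerivAt_const x (1 : ℝ)
    · exact hasDerivAt_const x (0 : ℝ)
  | succ m ih =>
    obtain ⟨c, hc, H⟩ := ih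
    -- The constant is chosen before W, so M is not yet known to be nonnegative; hence the absolute
    -- value.
    refine ⟨|M| + 2 * |M| * c + |M| + 2 * c, by positivity, fun W hW => ?_⟩
    obtain ⟨a', a'', ha', ha'', hd, hd', hb⟩ := H W hW
    have hW0 := hW.continuousOn
    have hW1 := continuousOn_potDeriv hW.smooth 1
    have hW2 := continuousOn_potDeriv hW.smooth 2
    have d0 : ∀ x, 0 < x → HasDerivAt W (potDeriv W 1 x) x := fun x hx => by
      simpa [potDeriv_zero] using hasDerivAt_potDeriv hW.smooth 0 hx
    have d1 : ∀ x, 0 < x → HasDerivAt (potDeriv W 1) (potDeriv W 2 x) x := fun x hx =>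
      hasDerivAt_potDeriv hW.smooth 1 hx
    refine ⟨fun x => a' x * W x + W x ^ m * potDeriv W 1 x,
      fun x => (a'' x * W x + a' x * potDeriv W 1 x)
        + (a' x * potDeriv W 1 x + W x ^ m * potDeriv W 2 x), ?_, ?_, ?_, ?_, ?_⟩
    · exact (ha'.mul hW0).add ((hW0.pow m).mul hW1)
    · exact ((ha''.mul hW0).add (ha'.mul hW1)).add ((ha'.mul hW1).add ((hW0.pow m).mul hW2))
    · intro x hx
      simpa [pow_succ] using (hd x hx).fun_mul (d0 x hx)
    · intro x hx
      exact ((hd' x hx).fun_mul (d0 x hx)).fun_add ((hd x hx).fun_mul (d1 x hx))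
    · intro x hx
      obtain ⟨b1, b2⟩ := hb x hx
      have w0 := hW.pos hx
      have wm : 0 < W x ^ m := by positivity
      have p1 := hW.bound 1 (by norm_num) x hx
      have p2 := hW.bound 2 (by norm_num) x hx
      rw [← abs_of_nonneg hW.nonneg] at p1 p2
      have t1 : |a' x * W x| ≤ c * W x ^ m * W x := by
        rw [abs_mul, abs_of_pos w0]; gcongr
      have t2 : |W x ^ m * potDeriv W 1 x| ≤ W x ^ m * (|M| * W x) := by
        rw [abs_mul, abs_of_pos wm]; gcongr
      have t3 : |a'' x * W x| ≤ c * W x ^ m * W x := by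
        rw [abs_mul, abs_of_pos w0]; gcongr
      have t4 : |a' x * potDeriv W 1 x| ≤ c * W x ^ m * (|M| * W x) := by
        rw [abs_mul]; gcongr
      have t5 : |W x ^ m * potDeriv W 2 x| ≤ W x ^ m * (|M| * W x) := by
        rw [abs_mul, abs_of_pos wm]; gcongr
      have q0 : 0 ≤ W x ^ m * W x := by positivity
      have q1 : 0 ≤ c * (W x ^ m * W x) := by positivity
      have q2 : 0 ≤ |M| * (W x ^ m * W x) := by positivity
      have q3 : 0 ≤ |M| * c * (W x ^ m * W x) := by positivity
      rw [pow_succ]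
      constructor
      · refine (abs_add_le _ _).trans ((add_le_add t1 t2).trans ?_)
        nlinarith
      · refine (abs_add_le _ _).trans ((add_le_add ((abs_add_le _ _).trans (add_le_add t3 t4))
          ((abs_add_le _ _).trans (add_le_add t4 t5))).trans ?_)
        nlinarith

/-! ### Energy estimates -/

/-- `v` is a `C¹` solution of `-v'' + W v = g` with derivative `v'` and `v(0) = 0`. -/
structure IsDirichletSol (W : ℝ → ℝ) (v v' g : ℝ → ℂ) : Prop where
  prim : IsPrim v v'
  prim' : IsPrim v' (fun x => (W x : ℂ) * v x - g x)
  zero : v 0 = 0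

theorem intervalIntegrable_of_continuousOn {E : Type*} [NormedAddCommGroup E]
    {f : ℝ → E} (hf : ContinuousOn f (Ici 0)) {a b : ℝ} (ha : 0 ≤ a) (hb : 0 ≤ b) :
    IntervalIntegrable f volume a b :=
  (hf.mono fun _ hx => (le_inf ha hb).trans hx.1).intervalIntegrable

theorem isPrim_ofReal {e e' : ℝ → ℝ} (he : ContinuousOn e (Ici 0)) (he' : ContinuousOn e' (Ici 0))
    (hd : ∀ x, 0 < x → HasDerivAt e (e' x) x) :
    IsPrim (fun x => (e x : ℂ)) (fun x => (e' x : ℂ)) :=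
  isPrim_of_hasDerivAt (Complex.continuous_ofReal.comp_continuousOn he)
    (fun x hx => (hd x hx).ofReal_comp) (Complex.continuous_ofReal.comp_continuousOn he')

/-- With v* the conjugate of v, the integrand is the real part of (e v* v')' - (e' v v*)'/2. The
boundary terms vanish since v(0) = 0 and e, e' vanish at X. Subtracting the second derivative
replaces the cross term e' v* v' by one in e''|v|², so no v' is left to be estimated. -/
theorem IsDirichletSol.energy_identity {W : ℝ → ℝ} {v v' g : ℝ → ℂ} (h : IsDirichletSol W v v' g)
    {e e' e'' : ℝ → ℝ} (he : IsPrim (fun x => (e x : ℂ)) (fun x => (e' x : ℂ)))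
    (he' : IsPrim (fun x => (e' x : ℂ)) (fun x => (e'' x : ℂ))) {X : ℝ} (hX : 0 ≤ X)
    (z : e X = 0) (z' : e' X = 0) :
    IntervalIntegrable (fun x => e x * (‖v' x‖ ^ 2 + W x * ‖v x‖ ^ 2)
      - e x * (g x * starRingEnd ℂ (v x)).re - e'' x * ‖v x‖ ^ 2 / 2) volume 0 X ∧
    ∫ x in (0 : ℝ)..X, (e x * (‖v' x‖ ^ 2 + W x * ‖v x‖ ^ 2)
      - e x * (g x * starRingEnd ℂ (v x)).re - e'' x * ‖v x‖ ^ 2 / 2) = 0 := by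
  have P := (he.mul h.prim.conj).mul h.prim'
  have Q := he'.mul (h.prim.mul h.prim.conj)
  have hP := P.integral_eq_zero hX (by simp [h.zero]) (by simp [z])
  have hQ := Q.integral_eq_zero hX (by simp [h.zero]) (by simp [z'])
  have iQ := (Q.int X hX).const_mul (1 / 2)
  have hs := intervalIntegral.integral_sub (P.int X hX) iQ
  rw [intervalIntegral.integral_const_mul, hP, hQ, mul_zero, sub_zero] at hs
  have iS := (P.int X hX).sub iQ
  have hre := Complex.reCLM.intervalIntegral_comp_comm iS
  have ire : IntervalIntegrable (fun x => Complex.reCLM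
      (((e' x : ℂ) * starRingEnd ℂ (v x) + (e x : ℂ) * starRingEnd ℂ (v' x)) * v' x
        + (e x : ℂ) * starRingEnd ℂ (v x) * ((W x : ℂ) * v x - g x)
        - 1 / 2 * ((e'' x : ℂ) * (v x * starRingEnd ℂ (v x))
          + (e' x : ℂ) * (v' x * starRingEnd ℂ (v x) + v x * starRingEnd ℂ (v' x))))) volume 0 X :=
    ⟨Complex.reCLM.integrable_comp iS.1, Complex.reCLM.integrable_comp iS.2⟩
  have key : (fun x => Complex.reCLM
      (((e' x : ℂ) * starRingEnd ℂ (v x) + (e x : ℂ) * starRingEnd ℂ (v' x)) * v' x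
        + (e x : ℂ) * starRingEnd ℂ (v x) * ((W x : ℂ) * v x - g x)
        - 1 / 2 * ((e'' x : ℂ) * (v x * starRingEnd ℂ (v x))
          + (e' x : ℂ) * (v' x * starRingEnd ℂ (v x) + v x * starRingEnd ℂ (v' x)))))
      = fun x => e x * (‖v' x‖ ^ 2 + W x * ‖v x‖ ^ 2)
      - e x * (g x * starRingEnd ℂ (v x)).re - e'' x * ‖v x‖ ^ 2 / 2 := by
    funext x
    rw [Complex.sq_norm, Complex.sq_norm, Complex.normSq_apply, Complex.normSq_apply]
    simp only [Complex.reCLM_apply, Complex.add_re, Complex.sub_re, Complex.mul_re, Complex.mul_im,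
      Complex.add_im, Complex.sub_im, Complex.ofReal_re, Complex.ofReal_im, Complex.conj_re,
      Complex.conj_im, Complex.one_re, Complex.one_im, Complex.div_ofNat_re, Complex.div_ofNat_im]
    ring
  rw [← key]
  refine ⟨ire, ?_⟩
  exact hre.trans (by rw [hs, map_zero])

theorem integrableOn_Ioi_of_bounded {f : ℝ → ℝ} {I : ℝ}
    (hf : ∀ x, 0 ≤ x → IntervalIntegrable f volume 0 x) (h0 : ∀ x, 0 ≤ x → 0 ≤ f x)
    (hb : ∀ R, 0 ≤ R → ∫ x in (0 : ℝ)..R, f x ≤ I) :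
    IntegrableOn f (Ioi 0) ∧ ∫ x in Ioi 0, f x ≤ I := by
  have ht : Filter.Tendsto (fun n : ℕ => (n : ℝ)) Filter.atTop Filter.atTop :=
    tendsto_natCast_atTop_atTop
  have hi : IntegrableOn f (Ioi 0) := by
    refine integrableOn_Ioi_of_intervalIntegral_norm_bounded I 0
      (fun n : ℕ => (hf n n.cast_nonneg).1) ht (Filter.Eventually.of_forall fun n => ?_)
    rw [intervalIntegral.integral_congr (g := f)]
    · exact hb n n.cast_nonneg
    · intro x hx
      rw [uIcc_of_le n.cast_nonneg] at hx
      exact Real.norm_of_nonneg (h0 x hx.1)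
  exact ⟨hi, le_of_tendsto (intervalIntegral_tendsto_integral_Ioi 0 hi ht)
    (Filter.Eventually.of_forall fun n => hb n n.cast_nonneg)⟩

theorem intervalIntegral_le_setIntegral_Ioi {f : ℝ → ℝ} (hf : IntegrableOn f (Ioi 0))
    (h0 : ∀ x, 0 ≤ x → 0 ≤ f x) {X : ℝ} (hX : 0 ≤ X) :
    ∫ x in (0 : ℝ)..X, f x ≤ ∫ x in Ioi 0, f x := by
  rw [intervalIntegral.integral_of_le hX]
  exact setIntegral_mono_set hf ((ae_restrict_iff' measurableSet_Ioi).2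
    (Filter.Eventually.of_forall fun x hx => h0 x (le_of_lt hx)))
    (Filter.Eventually.of_forall fun x hx => Ioc_subset_Ioi_self hx)

/-- The energy identity with multiplier e = χ W^m, χ a cutoff. A bound on W^m |v|² yields one on
W^(m+1) |v|², so the step can be iterated. -/
theorem energy_step (M : ℝ) (m : ℕ) : ∃ c : ℝ, 0 ≤ c ∧ ∀ W, PotBound W 3 M → ∀ v v' g : ℝ → ℂ,
    IsDirichletSol W v v' g → IntegrableOn (fun x => W x ^ m * ‖v x‖ ^ 2) (Ioi 0) →
    IntegrableOn (fun x => W x ^ (m - 1) * ‖g x‖ ^ 2) (Ioi 0) →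
    IntegrableOn (fun x => W x ^ m * ‖v' x‖ ^ 2) (Ioi 0) ∧
    IntegrableOn (fun x => W x ^ (m + 1) * ‖v x‖ ^ 2) (Ioi 0) ∧
    (∫ x in Ioi 0, W x ^ m * ‖v' x‖ ^ 2) + (∫ x in Ioi 0, W x ^ (m + 1) * ‖v x‖ ^ 2)
      ≤ c * ((∫ x in Ioi 0, W x ^ m * ‖v x‖ ^ 2)
        + ∫ x in Ioi 0, W x ^ (m - 1) * ‖g x‖ ^ 2) := by
  obtain ⟨K, hK, HK⟩ := exists_cutoff
  obtain ⟨c, hc, Hc⟩ := exists_weight_derivs M m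
  -- Bound for |e''| / W^m, where e'' = χ'' W^m + 2 χ' (W^m)' + χ (W^m)''.
  set c' : ℝ := K + 2 * K * c + c
  have hc' : 0 ≤ c' := by positivity
  refine ⟨2 * (c' + 1), by positivity, fun W hW v v' g h h1 h2 => ?_⟩
  obtain ⟨a', a'', ha', ha'', hda, hda', hba⟩ := Hc W hW
  have hWc := hW.continuousOn
  have hv := h.prim.continuousOn
  have hv' := h.prim'.continuousOn
  set I1 := ∫ x in Ioi 0, W x ^ m * ‖v x‖ ^ 2
  set I2 := ∫ x in Ioi 0, W x ^ (m - 1) * ‖g x‖ ^ 2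
  -- Half of W^(m+1) |v|² is given up: it absorbs the part of the term in g that contains v. The
  -- factor 2 in the final constant restores it.
  set F : ℝ → ℝ := fun x => W x ^ m * ‖v' x‖ ^ 2 + W x ^ (m + 1) * ‖v x‖ ^ 2 / 2
  have cF : ContinuousOn F (Ici 0) := by fun_prop
  have F0 : ∀ x, 0 ≤ x → 0 ≤ F x := fun x hx => by have := hW.pos hx; positivity
  have n1 : ∀ x, 0 ≤ x → 0 ≤ W x ^ m * ‖v x‖ ^ 2 := fun x hx => by
    have := hW.pos hx; positivity
  have n2 : ∀ x, 0 ≤ x → 0 ≤ W x ^ (m - 1) * ‖g x‖ ^ 2 := fun x hx => by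
    have := hW.pos hx; positivity
  -- Nothing is known about v' at infinity. The cutoff keeps all integrals on a bounded interval,
  -- and a bound uniform in R gives integrability on the half-line.
  have hF : IntegrableOn F (Ioi 0) ∧ ∫ x in Ioi 0, F x ≤ c' * I1 + I2 := by
    refine integrableOn_Ioi_of_bounded
      (fun x hx => intervalIntegrable_of_continuousOn cF le_rfl hx) F0 fun R hR => ?_
    obtain ⟨χ, χ', χ'', cχ'', dχ, dχ', bχ, oneχ, zχ, kχ⟩ := HK R
    have cχ : Continuous χ := continuous_iff_continuousAt.2 fun x => (dχ x).continuousAt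
    have cχ' : Continuous χ' := continuous_iff_continuousAt.2 fun x => (dχ' x).continuousAt
    set e : ℝ → ℝ := fun x => χ x * W x ^ m
    set e' : ℝ → ℝ := fun x => χ' x * W x ^ m + χ x * a' x
    set e'' : ℝ → ℝ := fun x => (χ'' x * W x ^ m + χ' x * a' x) + (χ' x * a' x + χ x * a'' x)
    have pe : IsPrim (fun x => (e x : ℂ)) (fun x => (e' x : ℂ)) :=
      isPrim_ofReal (by fun_prop) (by fun_prop) fun x hx => (dχ x).fun_mul (hda x hx)
    have pe' : IsPrim (fun x => (e' x : ℂ)) (fun x => (e'' x : ℂ)) :=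
      isPrim_ofReal (by fun_prop) (by fun_prop) fun x hx =>
        ((dχ' x).fun_mul (hda x hx)).fun_add ((dχ x).fun_mul (hda' x hx))
    have hX : 0 ≤ R + 1 := by linarith
    obtain ⟨z1, z2⟩ := zχ (R + 1) le_rfl
    obtain ⟨iE, hE⟩ := h.energy_identity pe pe' hX (by simp [e, z1]) (by simp [e', z1, z2])
    have j1 : IntervalIntegrable (fun x => c' * (W x ^ m * ‖v x‖ ^ 2)) volume 0 (R + 1) := by
      rw [intervalIntegrable_iff_integrableOn_Ioc_of_le hX]
      exact (h1.mono_set Ioc_subset_Ioi_self).const_mul c'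
    have j2 : IntervalIntegrable (fun x => W x ^ (m - 1) * ‖g x‖ ^ 2) volume 0 (R + 1) := by
      rw [intervalIntegrable_iff_integrableOn_Ioc_of_le hX]
      exact h2.mono_set Ioc_subset_Ioi_self
    have iχF : ∀ {a b : ℝ}, 0 ≤ a → 0 ≤ b → IntervalIntegrable (fun x => χ x * F x) volume a b :=
      fun ha hb => intervalIntegrable_of_continuousOn (cχ.continuousOn.mul cF) ha hb
    have s1 : ∫ x in (0 : ℝ)..R, F x ≤ ∫ x in (0 : ℝ)..(R + 1), χ x * F x := by
      rw [← intervalIntegral.integral_add_adjacent_intervals (iχF le_rfl hR) (iχF hR hX)]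
      have e1 : ∫ x in (0 : ℝ)..R, χ x * F x = ∫ x in (0 : ℝ)..R, F x := by
        refine intervalIntegral.integral_congr fun x hx => ?_
        rw [uIcc_of_le hR] at hx
        simp only [(oneχ x hx.2).1, one_mul]
      have e2 : 0 ≤ ∫ x in R..(R + 1), χ x * F x :=
        intervalIntegral.integral_nonneg (by linarith) fun x hx =>
          mul_nonneg (bχ x).1 (F0 x (hR.trans hx.1))
      rw [e1]
      linarith
    have s2 : ∫ x in (0 : ℝ)..(R + 1), χ x * F x
        ≤ ∫ x in (0 : ℝ)..(R + 1), ((e x * (‖v' x‖ ^ 2 + W x * ‖v x‖ ^ 2)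
          - e x * (g x * starRingEnd ℂ (v x)).re - e'' x * ‖v x‖ ^ 2 / 2)
          + (c' * (W x ^ m * ‖v x‖ ^ 2) + W x ^ (m - 1) * ‖g x‖ ^ 2)) := by
      refine intervalIntegral.integral_mono_on hX (iχF le_rfl hX) (iE.add (j1.add j2))
        fun x hx => ?_
      have w1 := hW.one_le x hx.1
      have w0 := hW.pos hx.1
      obtain ⟨b1, b2⟩ := hba x hx.1
      obtain ⟨k1, k2⟩ := kχ x
      obtain ⟨x0, x1⟩ := bχ x
      have wm : 0 < W x ^ m := by positivity
      have be : |e'' x| ≤ c' * W x ^ m := by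
        have t1 : |χ'' x * W x ^ m| ≤ K * W x ^ m := by
          rw [abs_mul, abs_of_pos wm]; gcongr
        have t2 : |χ' x * a' x| ≤ K * (c * W x ^ m) := by
          rw [abs_mul]; gcongr
        have t3 : |χ x * a'' x| ≤ 1 * (c * W x ^ m) := by
          rw [abs_mul, abs_of_nonneg x0]; gcongr
        refine (abs_add_le _ _).trans ((add_le_add ((abs_add_le _ _).trans (add_le_add t1 t2))
          ((abs_add_le _ _).trans (add_le_add t2 t3))).trans ?_)
        simp only [c']
        linarith
      have be2 : e'' x * ‖v x‖ ^ 2 ≤ c' * W x ^ m * ‖v x‖ ^ 2 :=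
        mul_le_mul_of_nonneg_right ((le_abs_self _).trans be) (by positivity)
      have bg : (g x * starRingEnd ℂ (v x)).re ≤ ‖g x‖ * ‖v x‖ := by
        refine (Complex.re_le_norm _).trans ?_
        rw [norm_mul, RCLike.norm_conj]
      have bg2 : W x ^ m * (‖g x‖ * ‖v x‖)
          ≤ W x ^ (m + 1) * ‖v x‖ ^ 2 / 2 + W x ^ (m - 1) * ‖g x‖ ^ 2 / 2 := by
        -- For m = 0 the exponent m - 1 is truncated to 0, and W ≥ 1 compensates.
        rcases m with _ | m
        · simp only [pow_zero, zero_add, pow_one, zero_le, Nat.sub_eq_zero_of_le]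
          nlinarith [sq_nonneg (‖g x‖ - ‖v x‖), sq_nonneg ‖v x‖]
        · have p : 0 ≤ W x ^ m := by positivity
          simp only [Nat.add_sub_cancel]
          have := mul_nonneg p (sq_nonneg (‖g x‖ - W x * ‖v x‖))
          rw [show W x ^ (m + 1 + 1) = W x ^ m * W x * W x by ring, pow_succ]
          nlinarith
      have bg3 : e x * (g x * starRingEnd ℂ (v x)).re
          ≤ χ x * (W x ^ (m + 1) * ‖v x‖ ^ 2 / 2 + W x ^ (m - 1) * ‖g x‖ ^ 2 / 2) := by
        simp only [e]
        rw [mul_assoc]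
        exact mul_le_mul_of_nonneg_left ((mul_le_mul_of_nonneg_left bg wm.le).trans bg2) x0
      have bg4 : χ x * (W x ^ (m - 1) * ‖g x‖ ^ 2) ≤ 1 * (W x ^ (m - 1) * ‖g x‖ ^ 2) :=
        mul_le_mul_of_nonneg_right x1 (n2 x hx.1)
      have p1 := n1 x hx.1
      have p2 := n2 x hx.1
      have p3 := mul_nonneg hc' p1
      simp only [F]
      have e0 : e x * (‖v' x‖ ^ 2 + W x * ‖v x‖ ^ 2)
          = χ x * (W x ^ m * ‖v' x‖ ^ 2 + W x ^ (m + 1) * ‖v x‖ ^ 2) := by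
        simp only [e]; ring
      rw [e0]
      linarith
    refine s1.trans (s2.trans ?_)
    rw [intervalIntegral.integral_add iE (j1.add j2), hE, zero_add,
      intervalIntegral.integral_add j1 j2, intervalIntegral.integral_const_mul]
    exact add_le_add (mul_le_mul_of_nonneg_left
      (intervalIntegral_le_setIntegral_Ioi h1 n1 hX) hc')
      (intervalIntegral_le_setIntegral_Ioi h2 n2 hX)
  have hI1 : 0 ≤ I1 := setIntegral_nonneg measurableSet_Ioi fun x hx => n1 x (le_of_lt hx)
  have hI2 : 0 ≤ I2 := setIntegral_nonneg measurableSet_Ioi fun x hx => n2 x (le_of_lt hx)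
  have m1 : AEStronglyMeasurable (fun x => W x ^ m * ‖v' x‖ ^ 2) (volume.restrict (Ioi 0)) :=
    ContinuousOn.aestronglyMeasurable (by
      have : ContinuousOn (fun x => W x ^ m * ‖v' x‖ ^ 2) (Ici 0) := by fun_prop
      exact this.mono Ioi_subset_Ici_self) measurableSet_Ioi
  have i1 : IntegrableOn (fun x => W x ^ m * ‖v' x‖ ^ 2) (Ioi 0) := by
    refine hF.1.mono' m1 ((ae_restrict_iff' measurableSet_Ioi).2
      (Filter.Eventually.of_forall fun x hx => ?_))
    have := hW.pos (le_of_lt (mem_Ioi.1 hx))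
    rw [Real.norm_of_nonneg (by positivity)]
    simp only [F]
    have : 0 ≤ W x ^ (m + 1) * ‖v x‖ ^ 2 / 2 := by positivity
    linarith
  have i2' : IntegrableOn (fun x => W x ^ (m + 1) * ‖v x‖ ^ 2 / 2) (Ioi 0) := by
    have := hF.1.sub i1
    refine this.congr (Filter.Eventually.of_forall fun x => ?_)
    simp [F]
  have i2 : IntegrableOn (fun x => W x ^ (m + 1) * ‖v x‖ ^ 2) (Ioi 0) := by
    refine (i2'.const_mul 2).congr (Filter.Eventually.of_forall fun x => ?_)
    simp only
    ring
  refine ⟨i1, i2, ?_⟩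
  have hsum := hF.2
  simp only [F] at hsum
  rw [integral_add i1 i2', integral_div] at hsum
  have q1 : 0 ≤ ∫ x in Ioi 0, W x ^ m * ‖v' x‖ ^ 2 :=
    setIntegral_nonneg measurableSet_Ioi fun x hx => by
      have := hW.pos (le_of_lt (mem_Ioi.1 hx)); positivity
  nlinarith

/-- The step is run for m = 0, ..., s + 1, starting from v ∈ L² alone. The final weights are those
of the orders 0 and 1 in the weighted norm of index s + 2. -/
theorem energy_estimate (M : ℝ) (s : ℕ) : ∃ c : ℝ, 0 ≤ c ∧ ∀ W, PotBound W 3 M →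
    ∀ v v' g : ℝ → ℂ, IsDirichletSol W v v' g → IntegrableOn (fun x => ‖v x‖ ^ 2) (Ioi 0) →
    IntegrableOn (fun x => W x ^ s * ‖g x‖ ^ 2) (Ioi 0) →
    AEStronglyMeasurable g volPos →
    IntegrableOn (fun x => W x ^ (s + 1) * ‖v' x‖ ^ 2) (Ioi 0) ∧
    IntegrableOn (fun x => W x ^ (s + 2) * ‖v x‖ ^ 2) (Ioi 0) ∧
    (∫ x in Ioi 0, W x ^ (s + 1) * ‖v' x‖ ^ 2) + (∫ x in Ioi 0, W x ^ (s + 2) * ‖v x‖ ^ 2)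
      ≤ c * ((∫ x in Ioi 0, ‖v x‖ ^ 2) + ∫ x in Ioi 0, W x ^ s * ‖g x‖ ^ 2) := by
  -- Since W ≥ 1, the lower powers of W that occur along the iteration are dominated by W^s.
  have gm : ∀ W, PotBound W 3 M → ∀ g : ℝ → ℂ, AEStronglyMeasurable g volPos →
      IntegrableOn (fun x => W x ^ s * ‖g x‖ ^ 2) (Ioi 0) → ∀ j ≤ s,
      IntegrableOn (fun x => W x ^ j * ‖g x‖ ^ 2) (Ioi 0) ∧
      ∫ x in Ioi 0, W x ^ j * ‖g x‖ ^ 2 ≤ ∫ x in Ioi 0, W x ^ s * ‖g x‖ ^ 2 := by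
    intro W hW g hg hi j hj
    have hle : ∀ x ∈ Ioi (0 : ℝ), W x ^ j * ‖g x‖ ^ 2 ≤ W x ^ s * ‖g x‖ ^ 2 := fun x hx =>
      mul_le_mul_of_nonneg_right (pow_le_pow_right₀ (hW.one_le x (le_of_lt hx)) hj) (by positivity)
    have hj' : IntegrableOn (fun x => W x ^ j * ‖g x‖ ^ 2) (Ioi 0) := by
      refine hi.mono' ?_ ((ae_restrict_iff' measurableSet_Ioi).2
        (Filter.Eventually.of_forall fun x hx => ?_))
      · exact (((hW.continuousOn.pow j).mono Ioi_subset_Ici_self).aestronglyMeasurable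
          measurableSet_Ioi).mul (hg.norm.pow 2)
      · have := hW.pos (le_of_lt (mem_Ioi.1 hx))
        rw [Real.norm_of_nonneg (by positivity)]
        exact hle x hx
    exact ⟨hj', setIntegral_mono_on hj' hi measurableSet_Ioi hle⟩
  have main : ∀ m ≤ s + 1, ∃ c : ℝ, 0 ≤ c ∧ ∀ W, PotBound W 3 M →
    ∀ v v' g : ℝ → ℂ, IsDirichletSol W v v' g → IntegrableOn (fun x => ‖v x‖ ^ 2) (Ioi 0) →
    IntegrableOn (fun x => W x ^ s * ‖g x‖ ^ 2) (Ioi 0) →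
    AEStronglyMeasurable g volPos →
    IntegrableOn (fun x => W x ^ m * ‖v' x‖ ^ 2) (Ioi 0) ∧
    IntegrableOn (fun x => W x ^ (m + 1) * ‖v x‖ ^ 2) (Ioi 0) ∧
    (∫ x in Ioi 0, W x ^ m * ‖v' x‖ ^ 2) + (∫ x in Ioi 0, W x ^ (m + 1) * ‖v x‖ ^ 2)
      ≤ c * ((∫ x in Ioi 0, ‖v x‖ ^ 2) + ∫ x in Ioi 0, W x ^ s * ‖g x‖ ^ 2) := by
    intro m
    induction m with
    | zero =>
      intro _
      obtain ⟨c, hc, H⟩ := energy_step M 0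
      refine ⟨c, hc, fun W hW v v' g h h1 h2 hg => ?_⟩
      obtain ⟨g1, g2⟩ := gm W hW g hg h2 0 (by omega)
      obtain ⟨r1, r2, r3⟩ := H W hW v v' g h (by simpa using h1) g1
      refine ⟨r1, r2, r3.trans (mul_le_mul_of_nonneg_left ?_ hc)⟩
      simp only [pow_zero, one_mul, zero_le, Nat.sub_eq_zero_of_le] at g2 ⊢
      linarith
    | succ m ih =>
      intro hm
      obtain ⟨c, hc, H⟩ := energy_step M (m + 1)
      obtain ⟨c0, hc0, H0⟩ := ih (by omega)
      refine ⟨c * (c0 + 1), by positivity, fun W hW v v' g h h1 h2 hg => ?_⟩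
      obtain ⟨g1, g2⟩ := gm W hW g hg h2 m (by omega)
      obtain ⟨q1, q2, q3⟩ := H0 W hW v v' g h h1 h2 hg
      obtain ⟨r1, r2, r3⟩ := H W hW v v' g h q2 (by simpa using g1)
      refine ⟨r1, r2, r3.trans ?_⟩
      rw [mul_assoc]
      refine mul_le_mul_of_nonneg_left ?_ hc
      have p1 : 0 ≤ ∫ x in Ioi 0, W x ^ m * ‖v' x‖ ^ 2 :=
        setIntegral_nonneg measurableSet_Ioi fun x hx => by
          have := hW.pos (le_of_lt (mem_Ioi.1 hx)); positivity
      have p2 : 0 ≤ ∫ x in Ioi 0, ‖v x‖ ^ 2 :=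
        setIntegral_nonneg measurableSet_Ioi fun x hx => by positivity
      simp only [Nat.add_sub_cancel]
      linarith
  exact main (s + 1) le_rfl

/-! ### Regularity of square integrable functions with weak derivatives -/

theorem intervalIntegrable_of_memLp {f : ℝ → ℂ} (hf : MemLp f 2 volPos) {x : ℝ} (hx : 0 ≤ x) :
    IntervalIntegrable f volume 0 x := by
  rw [intervalIntegrable_iff_integrableOn_Ioc_of_le hx]
  have h : MemLp f 2 (volume.restrict (Ioc 0 x)) :=
    hf.mono_measure (Measure.restrict_mono Ioc_subset_Ioi_self le_rfl)
  exact h.integrable (by norm_num)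

theorem HasWeakDeriv.exists_isPrim_one {u u' : ℝ → ℂ} (h : HasWeakDeriv 1 u u')
    (hu' : ∀ x, 0 ≤ x → IntervalIntegrable u' volume 0 x) : ∃ U, u =ᵐ[volPos] U ∧ IsPrim U u' := by
  obtain ⟨U, hU, hp⟩ := HasWeakDeriv.exists_isPrim (k := 0) h hu'
  exact ⟨U, (hasWeakDeriv_zero_iff.1 hU).2, hp⟩

theorem eqOn_of_ae_eq {F G : ℝ → ℂ} (hF : ContinuousOn F (Ici 0)) (hG : ContinuousOn G (Ici 0))
    (h : F =ᵐ[volPos] G) : EqOn F G (Ici 0) := by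
  refine Measure.eqOn_of_ae_eq (μ := volume) ?_ hF hG (by rw [interior_Ici, closure_Ioi])
  rwa [← Measure.restrict_congr_set (Ioi_ae_eq_Ici (μ := volume) (a := (0 : ℝ)))]

theorem VanishesAtZero.eq_zero {v V : ℝ → ℂ} (h : VanishesAtZero v) (hv : v =ᵐ[volPos] V)
    (hV : ContinuousOn V (Ici 0)) : V 0 = 0 := by
  obtain ⟨G, hG, e, h0⟩ := h
  rw [eqOn_of_ae_eq hV hG (hv.symm.trans e) (self_mem_Ici), h0]

theorem memLp_two_iff {f : ℝ → ℂ} (hf : AEStronglyMeasurable f volPos) :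
    MemLp f 2 volPos ↔ IntegrableOn (fun x => ‖f x‖ ^ 2) (Ioi 0) :=
  memLp_two_iff_integrable_sq_norm hf

theorem aestronglyMeasurable_ofReal {a : ℝ → ℝ} (ha : ContinuousOn a (Ici 0)) :
    AEStronglyMeasurable (fun x => (a x : ℂ)) volPos :=
  ((Complex.continuous_ofReal.comp_continuousOn ha).mono Ioi_subset_Ici_self).aestronglyMeasurable
    measurableSet_Ioi

theorem aestronglyMeasurable_of_continuousOn {f : ℝ → ℂ} (hf : ContinuousOn f (Ici 0)) :
    AEStronglyMeasurable f volPos :=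
  (hf.mono Ioi_subset_Ici_self).aestronglyMeasurable measurableSet_Ioi

theorem memLp_of_continuousOn_of_eq_zero {f : ℝ → ℂ} (hf : ContinuousOn f (Ici 0)) {X : ℝ}
    (hX : ∀ x, X ≤ x → f x = 0) : MemLp f 2 volPos := by
  rw [memLp_two_iff (aestronglyMeasurable_of_continuousOn hf)]
  have h1 : IntegrableOn (fun x => ‖f x‖ ^ 2) (Icc 0 X) :=
    ContinuousOn.integrableOn_Icc ((hf.norm.pow 2).mono Icc_subset_Ici_self)
  refine h1.of_forall_sdiff_eq_zero measurableSet_Ioi fun x hx => ?_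
  have : X < x := by
    by_contra h
    exact hx.2 ⟨le_of_lt hx.1, not_lt.1 h⟩
  simp [hX x this.le]

theorem ae_volPos {p : ℝ → Prop} (h : ∀ x, 0 < x → p x) : ∀ᵐ x ∂volPos, p x :=
  (ae_restrict_iff' measurableSet_Ioi).2 (Filter.Eventually.of_forall fun x hx => h x hx)

/-! ### The domain of the operator -/

/-- Wv - g is integrable up to 0, so integrating twice gives a representative that is C¹ on [0, ∞).
No boundary condition is needed. -/
theorem IsDirichletSol.of_isSchrodingerPow {W : ℝ → ℝ} (hW : ContDiffOn ℝ ∞ W (Ici 0))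
    {v g : ℝ → ℂ} (hv : MemLp v 2 volPos) (hg : MemLp g 2 volPos) (h : IsSchrodingerPow W 1 v g) :
    ∃ V V', v =ᵐ[volPos] V ∧ HasWeakDeriv 1 v V' ∧ IsPrim V V' ∧
      IsPrim V' (fun x => (W x : ℂ) * V x - g x) := by
  rw [isSchrodingerPow_one_iff hW h.left h.right] at h
  have hi : ∀ x, 0 ≤ x → IntervalIntegrable (fun x => (W x : ℂ) * v x - g x) volume 0 x := by
    intro x hx
    refine IntervalIntegrable.sub ?_ (intervalIntegrable_of_memLp hg hx)
    refine (intervalIntegrable_of_memLp hv hx).continuousOn_mul ?_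
    rw [uIcc_of_le hx]
    exact Complex.continuous_ofReal.comp_continuousOn (hW.continuousOn.mono Icc_subset_Ici_self)
  obtain ⟨V', h1, p1⟩ := HasWeakDeriv.exists_isPrim (k := 1) h hi
  obtain ⟨V, e, p⟩ := h1.exists_isPrim_one fun x hx =>
    intervalIntegrable_of_continuousOn p1.continuousOn le_rfl hx
  exact ⟨V, V', e, h1, p, p1.congr (e.mono fun x hx => by simp only [hx])⟩

/-- The energy estimate at s = 0: from v and -v'' + Wv in L² the two terms are separated, and Wv is
itself in L². -/
theorem IsDirichletSol.memLp {W : ℝ → ℝ} {M : ℝ} (hW : PotBound W 3 M) {v v' g : ℝ → ℂ}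
    (h : IsDirichletSol W v v' g) (hv : MemLp v 2 volPos) (hg : MemLp g 2 volPos) :
    MemLp v' 2 volPos ∧ IntegrableOn (fun x => W x * ‖v x‖ ^ 2) (Ioi 0) ∧
      MemLp (fun x => (W x : ℂ) * v x) 2 volPos := by
  obtain ⟨c, hc, H⟩ := energy_estimate M 0
  obtain ⟨r1, r2, -⟩ := H W hW v v' g h ((memLp_two_iff hv.1).1 hv)
    (by simpa using (memLp_two_iff hg.1).1 hg) hg.1
  have hvm := h.prim.continuousOn
  have hvm' := h.prim'.continuousOn
  have hWc := hW.continuousOn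
  have mo : ∀ {f : ℝ → ℝ}, ContinuousOn f (Ici 0) → AEStronglyMeasurable f volPos := fun hf =>
    (hf.mono Ioi_subset_Ici_self).aestronglyMeasurable measurableSet_Ioi
  refine ⟨?_, ?_, ?_⟩
  · rw [memLp_two_iff (aestronglyMeasurable_of_continuousOn hvm')]
    refine r1.mono' (mo (by fun_prop)) (ae_volPos fun x hx => ?_)
    have := hW.one_le x hx.le
    rw [Real.norm_of_nonneg (by positivity)]
    simp only [zero_add, pow_one]
    exact le_mul_of_one_le_left (by positivity) this
  · refine r2.mono' (mo (by fun_prop)) (ae_volPos fun x hx => ?_)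
    have := hW.one_le x hx.le
    rw [Real.norm_of_nonneg (by positivity)]
    refine mul_le_mul_of_nonneg_right ?_ (by positivity)
    rw [zero_add, sq]
    nlinarith
  · have cWv : ContinuousOn (fun x => (W x : ℂ) * v x) (Ici 0) :=
      (Complex.continuous_ofReal.comp_continuousOn hWc).mul hvm
    rw [memLp_two_iff (aestronglyMeasurable_of_continuousOn cWv)]
    refine r2.congr (Filter.Eventually.of_forall fun x => ?_)
    simp only [norm_mul, Complex.norm_real, Real.norm_eq_abs, mul_pow, sq_abs, zero_add]

theorem schrodinger_apply_ae {W : ℝ → ℝ} (u : (schrodinger W).domain) :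
    (schrodinger W u : ℝ → ℂ) =ᵐ[volPos] fun x => -weakDeriv 2 (u : L2) x + (W x : ℂ) * (u : L2) x :=
  MemLp.coeFn_toLp (schrodingerDomain_memLp u.2)

theorem isSchrodingerPow_schrodinger {W : ℝ → ℝ} (hW : ContDiffOn ℝ ∞ W (Ici 0))
    (u : (schrodinger W).domain) : IsSchrodingerPow W 1 (u : L2) (schrodinger W u) := by
  have lu := locallyIntegrableOn_of_memLp (Lp.memLp (u : L2))
  have lf := locallyIntegrableOn_of_memLp (Lp.memLp (schrodinger W u))
  rw [isSchrodingerPow_one_iff hW lu lf]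
  obtain ⟨g, hg, -⟩ := u.2.1 2 le_rfl
  refine (hasWeakDeriv_weakDeriv ⟨g, hg⟩).congr (Filter.EventuallyEq.refl _ _) ?_
  filter_upwards [schrodinger_apply_ae u] with x hx
  rw [hx]
  ring

theorem exists_isDirichletSol {W : ℝ → ℝ} (hW : ContDiffOn ℝ ∞ W (Ici 0)) {v g : L2}
    (h : IsSchrodingerPow W 1 v g) (h0 : VanishesAtZero v) :
    ∃ V V', (v : ℝ → ℂ) =ᵐ[volPos] V ∧ HasWeakDeriv 1 v V' ∧ IsDirichletSol W V V' g := by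
  obtain ⟨V, V', e, hw, p, p'⟩ := IsDirichletSol.of_isSchrodingerPow hW (Lp.memLp v) (Lp.memLp g) h
  exact ⟨V, V', e, hw, p, p', h0.eq_zero e p.continuousOn⟩

/-- Regularity: the separation property upgrades a distributional L² solution with zero boundary
value to an element of D(A). The proof that D(A*) lies in D(A) comes down to this. -/
theorem mem_schrodinger_domain {W : ℝ → ℝ} {M : ℝ} (hW : PotBound W 3 M) {v g : L2}
    (h : IsSchrodingerPow W 1 v g) (h0 : VanishesAtZero v) :
    ∃ hv : v ∈ (schrodinger W).domain, schrodinger W ⟨v, hv⟩ = g := by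
  obtain ⟨V, V', e, hw, hs⟩ := exists_isDirichletSol hW.smooth h h0
  obtain ⟨m1, -, m3⟩ := hs.memLp hW ((Lp.memLp v).ae_eq e) (Lp.memLp g)
  have m3' : MemLp (fun x => (W x : ℂ) * v x) 2 volPos :=
    m3.ae_eq (e.mono fun x hx => by simp only [hx])
  have h2 := (isSchrodingerPow_one_iff hW.smooth h.left h.right).1 h
  have hv : v ∈ (schrodinger W).domain := by
    refine ⟨fun k hk => ?_, h0, m3'⟩
    interval_cases k
    · exact ⟨v, hasWeakDeriv_zero_iff.2 ⟨h.left, Filter.EventuallyEq.refl _ _⟩, Lp.memLp v⟩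
    · exact ⟨V', hw, m1⟩
    · exact ⟨_, h2, m3'.sub (Lp.memLp g)⟩
  refine ⟨hv, Lp.ext ?_⟩
  filter_upwards [schrodinger_apply_ae ⟨v, hv⟩, h2.weakDeriv_eq] with x h1 h2
  rw [h1, h2]
  ring

theorem VanishesAtZero.of_isPrim {v V V' : ℝ → ℂ} (e : v =ᵐ[volPos] V) (hV : IsPrim V V')
    (h : V 0 = 0) : VanishesAtZero v := ⟨V, hV.continuousOn, e, h⟩

/-- Regular functions with compact support in `[0, ∞)` that vanish at `0` are in the domain. -/
theorem mem_schrodinger_domain_of_isPrim {W : ℝ → ℝ} {M : ℝ} (hW : PotBound W 3 M)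
    {F F' F'' : ℝ → ℂ} (hF : IsPrim F F') (hF' : IsPrim F' F'') (h0 : F 0 = 0)
    (hF'' : ContinuousOn F'' (Ici 0)) {X : ℝ} (hX : ∀ x, X ≤ x → F x = 0)
    (hX' : ∀ x, X ≤ x → F'' x = 0) :
    ∃ y : (schrodinger W).domain, ((y : L2) : ℝ → ℂ) =ᵐ[volPos] F ∧
      (schrodinger W y : ℝ → ℂ) =ᵐ[volPos] fun x => (W x : ℂ) * F x - F'' x := by
  have mF : MemLp F 2 volPos := memLp_of_continuousOn_of_eq_zero hF.continuousOn hX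
  have cG : ContinuousOn (fun x => (W x : ℂ) * F x - F'' x) (Ici 0) :=
    ((Complex.continuous_ofReal.comp_continuousOn hW.continuousOn).mul hF.continuousOn).sub hF''
  have mG : MemLp (fun x => (W x : ℂ) * F x - F'' x) 2 volPos :=
    memLp_of_continuousOn_of_eq_zero (X := X) cG fun x hx => by simp [hX x hx, hX' x hx]
  have e1 := mF.coeFn_toLp
  have e2 := mG.coeFn_toLp
  have hs : IsSchrodingerPow W 1 (mF.toLp F) (mG.toLp _) := by
    rw [isSchrodingerPow_one_iff hW.smooth (locallyIntegrableOn_of_memLp (Lp.memLp _))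
      (locallyIntegrableOn_of_memLp (Lp.memLp _))]
    refine (hF.hasWeakDeriv.comp hF'.hasWeakDeriv).congr e1.symm ?_
    filter_upwards [e1, e2] with x h1 h2
    rw [h1, h2]
    ring
  obtain ⟨hv, ha⟩ := mem_schrodinger_domain hW hs (.of_isPrim e1 hF h0)
  exact ⟨⟨_, hv⟩, e1, by rw [ha]; exact e2⟩

theorem IsTest.exists_mem_domain {W : ℝ → ℝ} {M : ℝ} (hW : PotBound W 3 M) {φ : ℝ → ℝ}
    (hφ : IsTest φ) : ∃ y : (schrodinger W).domain,
      ((y : L2) : ℝ → ℂ) =ᵐ[volPos] (fun x => (φ x : ℂ)) ∧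
      (schrodinger W y : ℝ → ℂ) =ᵐ[volPos] fun x => ((HalfLine.schrodingerExpr W φ x : ℝ) : ℂ) := by
  obtain ⟨X, -, hX⟩ := hφ.exists_eq_zero
  have h0 : φ 0 = 0 := by simpa using hφ.eq_zero_of_nonpos 0 le_rfl
  have e2 : ∀ x, _root_.deriv (_root_.deriv φ) x = _root_.iteratedDeriv 2 φ x := fun x => by
    rw [iteratedDeriv_succ, iteratedDeriv_one]
  obtain ⟨y, h1, h2⟩ := mem_schrodinger_domain_of_isPrim hW hφ.isPrim hφ.deriv.isPrim (by simp [h0])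
    (Complex.continuous_ofReal.comp hφ.deriv.deriv.smooth.continuous).continuousOn (X := X)
    (fun x hx => by have := hX 0 x hx; rw [iteratedDeriv_zero] at this; simp [this])
    (fun x hx => by rw [e2, hX 2 x hx, Complex.ofReal_zero])
  refine ⟨y, h1, h2.trans (Filter.Eventually.of_forall fun x => ?_)⟩
  simp only [HalfLine.schrodingerExpr, e2]
  push_cast
  ring

/-- The domain contains the test functions. A vector orthogonal to them is a weak derivative of 0,
hence is 0 by uniqueness of weak derivatives. -/
theorem dense_schrodinger_domain {W : ℝ → ℝ} {M : ℝ} (hW : PotBound W 3 M) :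
    Dense ((schrodinger W).domain : Set L2) := by
  rw [Submodule.dense_iff_topologicalClosure_eq_top, Submodule.topologicalClosure_eq_top_iff,
    Submodule.eq_bot_iff]
  intro w hw
  have lw := locallyIntegrableOn_of_memLp (Lp.memLp w)
  have h1 : HasWeakDeriv 1 0 w := by
    refine ⟨locallyIntegrableOn_zero, lw, fun φ hφ => ?_⟩
    obtain ⟨y, hy, -⟩ := hφ.exists_mem_domain hW
    have h := hw y y.2
    rw [L2.inner_def] at h
    have : ∫ x in Ioi 0, φ x • w x = 0 := by
      rw [← h]
      refine integral_congr_ae (hy.mono fun x hx => ?_)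
      simp only [hx, RCLike.inner_apply, Complex.conj_ofReal, Complex.real_smul]
      ring
    rw [this]
    simp
  have h2 : HasWeakDeriv 1 (0 : ℝ → ℂ) 0 :=
    ⟨locallyIntegrableOn_zero, locallyIntegrableOn_zero, fun φ hφ => by simp⟩
  refine Lp.ext ((h1.unique h2).trans (Lp.coeFn_zero ℂ 2 volPos).symm)

/-! ### The quadratic form -/

/-- `u` is in the form domain of the operator: it is represented by the function `U` with `U(0) = 0`
and derivative `U'`, where `U'` and `W ^ (1/2) U` are square integrable. -/
structure InForm (W : ℝ → ℝ) (u : L2) (U U' : ℝ → ℂ) : Prop where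
  ae_eq : (u : ℝ → ℂ) =ᵐ[volPos] U
  prim : IsPrim U U'
  zero : U 0 = 0
  memLp : MemLp U' 2 volPos
  integrable : IntegrableOn (fun x => W x * ‖U x‖ ^ 2) (Ioi 0)

theorem exists_inForm {W : ℝ → ℝ} {M : ℝ} (hW : PotBound W 3 M) (y : (schrodinger W).domain) :
    ∃ Y Y', InForm W y Y Y' ∧ IsDirichletSol W Y Y' (schrodinger W y) := by
  obtain ⟨Y, Y', e, -, hs⟩ := exists_isDirichletSol hW.smooth
    (isSchrodingerPow_schrodinger hW.smooth y) y.2.2.1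
  obtain ⟨m1, m2, -⟩ := hs.memLp hW ((Lp.memLp (y : L2)).ae_eq e) (Lp.memLp _)
  exact ⟨Y, Y', ⟨e, hs.prim, hs.zero, m1, m2⟩, hs⟩

theorem integrableOn_conj_mul {f g : ℝ → ℂ} (hf : MemLp f 2 volPos) (hg : MemLp g 2 volPos) :
    IntegrableOn (fun x => starRingEnd ℂ (f x) * g x) (Ioi 0) := by
  have hf' : MemLp (fun x => starRingEnd ℂ (f x)) 2 volPos :=
    hf.congr_norm (Complex.continuous_conj.comp_aestronglyMeasurable hf.1)
      (Filter.Eventually.of_forall fun x => (RCLike.norm_conj _).symm)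
  exact hf'.integrable_mul hg

theorem InForm.integrableOn {W : ℝ → ℝ} (hW : ContinuousOn W (Ici 0)) (h0 : ∀ x, 0 ≤ x → 0 ≤ W x)
    {u y : L2} {U U' Y Y' : ℝ → ℂ} (hu : InForm W u U U') (hy : InForm W y Y Y') :
    IntegrableOn (fun x => (W x : ℂ) * (starRingEnd ℂ (U x) * Y x)) (Ioi 0) := by
  have cU := hu.prim.conj.continuousOn
  have cY := hy.prim.continuousOn
  have cW := Complex.continuous_ofReal.comp_continuousOn hW
  refine (hu.integrable.add hy.integrable).mono'
    (aestronglyMeasurable_of_continuousOn (cW.mul (cU.mul cY))) (ae_volPos fun x hx => ?_)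
  have := h0 x hx.le
  simp only [norm_mul, RCLike.norm_conj, Complex.norm_real, Real.norm_of_nonneg this, Pi.add_apply]
  rw [← mul_add]
  refine mul_le_mul_of_nonneg_left ?_ this
  nlinarith [sq_nonneg (‖U x‖ - ‖Y x‖), sq_nonneg ‖U x‖, sq_nonneg ‖Y x‖]

theorem inner_eq_integral {u f : L2} {U g : ℝ → ℂ} (hu : (u : ℝ → ℂ) =ᵐ[volPos] U)
    (hf : (f : ℝ → ℂ) =ᵐ[volPos] g) :
    inner ℂ u f = ∫ x in Ioi 0, starRingEnd ℂ (U x) * g x := by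
  rw [L2.inner_def]
  refine integral_congr_ae ?_
  filter_upwards [hu, hf] with x h1 h2
  rw [h1, h2, RCLike.inner_apply, mul_comm]

/-- Green's formula, with u only in the form domain. The boundary term at 0 vanishes because U(0) =
0. -/
theorem inner_schrodinger {W : ℝ → ℝ} {M : ℝ} (hW : PotBound W 3 M) {u : L2} {U U' : ℝ → ℂ}
    (hu : InForm W u U U') (y : (schrodinger W).domain) {Y Y' : ℝ → ℂ}
    (hy : InForm W y Y Y') (hs : IsDirichletSol W Y Y' (schrodinger W y)) :
    inner ℂ u (schrodinger W y) = (∫ x in Ioi 0, starRingEnd ℂ (U' x) * Y' x)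
      + ∫ x in Ioi 0, (W x : ℂ) * (starRingEnd ℂ (U x) * Y x) := by
  set g : ℝ → ℂ := ((schrodinger W y : L2) : ℝ → ℂ)
  rw [inner_eq_integral hu.ae_eq (Filter.EventuallyEq.refl _ g)]
  have mU : MemLp U 2 volPos := (Lp.memLp u).ae_eq hu.ae_eq
  have i1 := integrableOn_conj_mul hu.memLp hy.memLp
  have i2 := hu.integrableOn hW.continuousOn (fun x hx => (hW.pos hx).le) hy
  have i3 := integrableOn_conj_mul mU (Lp.memLp (schrodinger W y))
  have i4 := integrableOn_conj_mul mU hy.memLp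
  obtain ⟨K, hK, HK⟩ := exists_cutoff
  choose χ χ' χ'' cχ'' dχ dχ' bχ oneχ zχ kχ using fun n : ℕ => HK n
  have cχ : ∀ n, Continuous (χ n) := fun n =>
    continuous_iff_continuousAt.2 fun x => (dχ n x).continuousAt
  have cχ' : ∀ n, Continuous (χ' n) := fun n =>
    continuous_iff_continuousAt.2 fun x => (dχ' n x).continuousAt
  set h : ℝ → ℂ := fun x => starRingEnd ℂ (U' x) * Y' x
    + (W x : ℂ) * (starRingEnd ℂ (U x) * Y x) - starRingEnd ℂ (U x) * g x
  have ih : IntegrableOn h (Ioi 0) := (i1.add i2).sub i3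
  have hzero : ∀ n : ℕ, (∫ x in Ioi 0, ((χ n x : ℂ) * h x
      + (χ' n x : ℂ) * (starRingEnd ℂ (U x) * Y' x))) = 0 := by
    intro n
    have hX : (0 : ℝ) ≤ n + 1 := by positivity
    have pχ : IsPrim (fun x => (χ n x : ℂ)) (fun x => (χ' n x : ℂ)) :=
      isPrim_ofReal (cχ n).continuousOn (cχ' n).continuousOn fun x _ => dχ n x
    have P := (pχ.mul hu.prim.conj).mul hs.prim'
    rw [setIntegral_Ioi_eq_intervalIntegral hX fun x hx => by
      rw [(zχ n x hx.le).1, (zχ n x hx.le).2]; simp]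
    rw [← P.integral_eq_zero hX (by simp [hu.zero]) (by simp [(zχ n _ le_rfl).1])]
    refine intervalIntegral.integral_congr fun x _ => ?_
    simp only [h]
    ring
  -- The boundary term at infinity: χ' is bounded by K, tends to 0 pointwise, and multiplies an
  -- integrable function, so dominated convergence removes it.
  have lim : Filter.Tendsto (fun n : ℕ => ∫ x in Ioi 0, ((χ n x : ℂ) * h x
      + (χ' n x : ℂ) * (starRingEnd ℂ (U x) * Y' x))) Filter.atTop (nhds (∫ x in Ioi 0, h x)) := by
    refine tendsto_integral_of_dominated_convergence
      (fun x => ‖h x‖ + K * ‖starRingEnd ℂ (U x) * Y' x‖) (fun n => ?_)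
      (ih.norm.add (i4.norm.const_mul K)) (fun n => ?_) ?_
    · exact ((aestronglyMeasurable_ofReal (cχ n).continuousOn).mul ih.1).add
        ((aestronglyMeasurable_ofReal (cχ' n).continuousOn).mul i4.1)
    · refine Filter.Eventually.of_forall fun x => (norm_add_le _ _).trans (add_le_add ?_ ?_)
      · rw [norm_mul, Complex.norm_real, Real.norm_of_nonneg (bχ n x).1]
        exact mul_le_of_le_one_left (norm_nonneg _) (bχ n x).2
      · rw [norm_mul, Complex.norm_real, Real.norm_eq_abs]
        exact mul_le_mul_of_nonneg_right (kχ n x).1 (norm_nonneg _)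
    · refine Filter.Eventually.of_forall fun x => tendsto_const_nhds.congr' ?_
      obtain ⟨N, hN⟩ := exists_nat_ge x
      filter_upwards [Filter.eventually_ge_atTop N] with n hn
      have hxn : x ≤ n := hN.trans (by exact_mod_cast hn)
      rw [(oneχ n x hxn).1, (oneχ n x hxn).2]
      simp
  simp only [hzero] at lim
  have h0 := tendsto_nhds_unique lim tendsto_const_nhds
  have i12 : IntegrableOn (fun x => starRingEnd ℂ (U' x) * Y' x
    + (W x : ℂ) * (starRingEnd ℂ (U x) * Y x)) (Ioi 0) := i1.add i2
  simp only [h] at h0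
  rw [integral_sub i12 i3, integral_add i1 i2] at h0
  linear_combination -h0

theorem inner_self_schrodinger {W : ℝ → ℝ} {M : ℝ} (hW : PotBound W 3 M)
    (y : (schrodinger W).domain) {Y Y' : ℝ → ℂ}
    (hy : InForm W y Y Y') (hs : IsDirichletSol W Y Y' (schrodinger W y)) :
    inner ℂ (y : L2) (schrodinger W y)
      = (((∫ x in Ioi 0, ‖Y' x‖ ^ 2) + ∫ x in Ioi 0, W x * ‖Y x‖ ^ 2 : ℝ) : ℂ) := by
  have e : ∀ z : ℂ, starRingEnd ℂ z * z = ((‖z‖ ^ 2 : ℝ) : ℂ) := fun z => by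
    rw [mul_comm, Complex.mul_conj, Complex.sq_norm]
  rw [inner_schrodinger hW hy y hy hs]
  simp only [e]
  push_cast
  rw [← integral_complex_ofReal, ← integral_complex_ofReal]
  push_cast
  rfl

theorem isFormalAdjoint_schrodinger {W : ℝ → ℝ} {M : ℝ} (hW : PotBound W 3 M) :
    (schrodinger W).IsFormalAdjoint (schrodinger W) := by
  intro u y
  obtain ⟨U, U', hu, hsu⟩ := exists_inForm hW u
  obtain ⟨Y, Y', hy, hsy⟩ := exists_inForm hW y
  rw [inner_schrodinger hW hu y hy hsy, ← inner_conj_symm, inner_schrodinger hW hy u hu hsu,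
    map_add, ← integral_conj, ← integral_conj]
  congr 1
  · refine integral_congr_ae (Filter.Eventually.of_forall fun x => ?_)
    simp only [map_mul, Complex.conj_conj, mul_comm]
  · refine integral_congr_ae (Filter.Eventually.of_forall fun x => ?_)
    simp only [map_mul, Complex.conj_conj, Complex.conj_ofReal, mul_comm]

theorem norm_sq_eq_integral {u : L2} {U : ℝ → ℂ} (hu : (u : ℝ → ℂ) =ᵐ[volPos] U) :
    ‖u‖ ^ 2 = ∫ x in Ioi 0, ‖U x‖ ^ 2 := by
  have h := inner_eq_integral hu hu
  have e : ∀ z : ℂ, starRingEnd ℂ z * z = ((‖z‖ ^ 2 : ℝ) : ℂ) := fun z => by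
    rw [mul_comm, Complex.mul_conj, Complex.sq_norm]
  simp only [e] at h
  rw [integral_complex_ofReal, inner_self_eq_norm_sq_to_K] at h
  have h' : ((‖u‖ : ℝ) : ℂ) ^ 2 = ((∫ x in Ioi 0, ‖U x‖ ^ 2 : ℝ) : ℂ) := h
  exact_mod_cast h'

theorem norm_sq_le_inner_schrodinger {W : ℝ → ℝ} {M : ℝ} (hW : PotBound W 3 M)
    (y : (schrodinger W).domain) :
    ‖(y : L2)‖ ^ 2 ≤ (inner ℂ (y : L2) (schrodinger W y)).re := by
  obtain ⟨Y, Y', hy, hs⟩ := exists_inForm hW y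
  rw [inner_self_schrodinger hW y hy hs, Complex.ofReal_re, norm_sq_eq_integral hy.ae_eq]
  have h1 : 0 ≤ ∫ x in Ioi 0, ‖Y' x‖ ^ 2 := integral_nonneg fun x => by positivity
  have mY : MemLp Y 2 volPos := (Lp.memLp (y : L2)).ae_eq hy.ae_eq
  have h2 : ∫ x in Ioi 0, ‖Y x‖ ^ 2 ≤ ∫ x in Ioi 0, W x * ‖Y x‖ ^ 2 :=
    setIntegral_mono_on ((memLp_two_iff mY.1).1 mY) hy.integrable measurableSet_Ioi fun x hx =>
      le_mul_of_one_le_left (by positivity) (hW.one_le x (le_of_lt hx))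
  linarith

/-! ### Self-adjointness -/

theorem isSchrodingerPow_of_forall_inner {W : ℝ → ℝ} {M : ℝ} (hW : PotBound W 3 M) {v g : L2}
    (h : ∀ y : (schrodinger W).domain, inner ℂ g (y : L2) = inner ℂ v (schrodinger W y)) :
    IsSchrodingerPow W 1 v g := by
  refine ⟨locallyIntegrableOn_of_memLp (Lp.memLp v), locallyIntegrableOn_of_memLp (Lp.memLp g),
    fun φ hφ => ?_⟩
  obtain ⟨y, e1, e2⟩ := hφ.exists_mem_domain hW
  have h1 := congrArg (starRingEnd ℂ) (h y)
  rw [inner_eq_integral (Filter.EventuallyEq.refl _ _) e1,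
    inner_eq_integral (Filter.EventuallyEq.refl _ _) e2, ← integral_conj, ← integral_conj] at h1
  simp only [map_mul, Complex.conj_conj, Complex.conj_ofReal] at h1
  simp only [Function.iterate_one, Complex.real_smul]
  simp only [mul_comm] at h1 ⊢
  exact h1.symm

/-- Test with b(x) = x χ(x), which lies in the domain and has b(0) = 0, b'(0) = 1. Two integrations
by parts leave only the boundary term at 0, the conjugate of V(0), which must therefore vanish. -/
theorem vanishesAtZero_of_forall_inner {W : ℝ → ℝ} {M : ℝ} (hW : PotBound W 3 M) {v g : L2}
    (h : ∀ y : (schrodinger W).domain, inner ℂ g (y : L2) = inner ℂ v (schrodinger W y)) :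
    VanishesAtZero v := by
  obtain ⟨V, V', e, -, p, p'⟩ := IsDirichletSol.of_isSchrodingerPow hW.smooth (Lp.memLp v)
    (Lp.memLp g) (isSchrodingerPow_of_forall_inner hW h)
  refine .of_isPrim e p ?_
  obtain ⟨K, -, HK⟩ := exists_cutoff
  obtain ⟨χ, χ', χ'', cχ'', dχ, dχ', -, oneχ, zχ, -⟩ := HK 1
  have cχ : Continuous χ := continuous_iff_continuousAt.2 fun x => (dχ x).continuousAt
  have cχ' : Continuous χ' := continuous_iff_continuousAt.2 fun x => (dχ' x).continuousAt
  -- The cutoff at R = 1 gives χ' = 0 on [2, ∞). Differentiating there requires a neighbourhood, and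
  -- 3 leaves the room.
  have zχ'' : ∀ x : ℝ, 3 ≤ x → χ'' x = 0 := by
    intro x hx
    have : χ' =ᶠ[nhds x] fun _ => 0 := by
      filter_upwards [Ioi_mem_nhds (show (2 : ℝ) < x by linarith)] with t ht
      exact (zχ t (by linarith [mem_Ioi.1 ht])).2
    rw [← (dχ' x).deriv, this.deriv_eq, deriv_const]
  set b : ℝ → ℝ := fun x => x * χ x
  set b' : ℝ → ℝ := fun x => 1 * χ x + x * χ' x
  set b'' : ℝ → ℝ := fun x => 1 * χ' x + (1 * χ' x + x * χ'' x)
  have pb : IsPrim (fun x => (b x : ℂ)) (fun x => (b' x : ℂ)) :=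
    isPrim_ofReal (by fun_prop) (by fun_prop) fun x _ => (hasDerivAt_id x).fun_mul (dχ x)
  have pb' : IsPrim (fun x => (b' x : ℂ)) (fun x => (b'' x : ℂ)) :=
    isPrim_ofReal (by fun_prop) (by fun_prop) fun x _ =>
      ((dχ x).const_mul 1).fun_add ((hasDerivAt_id x).fun_mul (dχ' x))
  have hb : ∀ x : ℝ, 3 ≤ x → b x = 0 ∧ b' x = 0 ∧ b'' x = 0 := fun x hx => by
    have := zχ x (by linarith)
    simp [b, b', b'', this.1, this.2, zχ'' x hx]
  have cb'' : ContinuousOn (fun x => (b'' x : ℂ)) (Ici 0) := by fun_prop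
  obtain ⟨y, e1, e2⟩ := mem_schrodinger_domain_of_isPrim hW pb pb' (by simp [b])
    cb'' (X := 3)
    (fun x hx => by rw [(hb x hx).1, Complex.ofReal_zero])
    (fun x hx => by rw [(hb x hx).2.2, Complex.ofReal_zero])
  have hy := h y
  have i1 : IntegrableOn (fun x => starRingEnd ℂ (g x) * (b x : ℂ)) (Ioi 0) :=
    integrableOn_conj_mul (Lp.memLp g) ((Lp.memLp (y : L2)).ae_eq e1)
  have i2 := integrableOn_conj_mul ((Lp.memLp v).ae_eq e) ((Lp.memLp (schrodinger W y)).ae_eq e2)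
  rw [inner_eq_integral (Filter.EventuallyEq.refl _ _) e1, inner_eq_integral e e2,
    ← sub_eq_zero, ← integral_sub i1 i2] at hy
  rw [setIntegral_Ioi_eq_intervalIntegral (X := 3) (by norm_num) fun x hx => by
    simp [(hb x (le_of_lt hx)).1, (hb x (le_of_lt hx)).2.2]] at hy
  have P := p.conj.mul pb'
  have Q := p'.conj.mul pb
  have hP := P.eq 3 (by norm_num)
  have hQ := Q.eq 3 (by norm_num)
  have hsub := intervalIntegral.integral_sub (P.int 3 (by norm_num)) (Q.int 3 (by norm_num))
  have e3 : ∫ x in (0 : ℝ)..3, (starRingEnd ℂ (g x) * (b x : ℂ)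
      - starRingEnd ℂ (V x) * ((W x : ℂ) * (b x : ℂ) - (b'' x : ℂ)))
      = ∫ x in (0 : ℝ)..3, ((starRingEnd ℂ (V' x) * (b' x : ℂ) + starRingEnd ℂ (V x) * (b'' x : ℂ))
        - (starRingEnd ℂ ((W x : ℂ) * V x - g x) * (b x : ℂ)
          + starRingEnd ℂ (V' x) * (b' x : ℂ))) := by
    refine intervalIntegral.integral_congr fun x _ => ?_
    simp only [map_sub, map_mul, Complex.conj_ofReal]
    ring
  rw [e3, hsub] at hy
  have b0 : b 0 = 0 := by simp [b]
  have b0' : b' 0 = 1 := by simp [b', (oneχ 0 (by norm_num)).1]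
  have b3 := hb 3 le_rfl
  rw [b3.2.1, b0'] at hP
  rw [b3.1, b0] at hQ
  simp only [Complex.ofReal_zero, mul_zero, Complex.ofReal_one, mul_one, zero_add] at hP hQ
  rw [← hQ, sub_zero] at hy
  rw [hy, add_zero] at hP
  exact (map_eq_zero _).1 hP.symm

/-- Symmetry gives A ⊆ A*. An element of D(A*) satisfies the equation in distributions and vanishes
at 0, so regularity puts it back into D(A). -/
theorem isSelfAdjoint_schrodinger {W : ℝ → ℝ} {M : ℝ} (hW : PotBound W 3 M) :
    IsSelfAdjoint (schrodinger W) := by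
  rw [LinearPMap.isSelfAdjoint_def]
  have hd := dense_schrodinger_domain hW
  have hle := (isFormalAdjoint_schrodinger hW).le_adjoint hd
  refine (LinearPMap.eq_of_le_of_domain_eq hle (le_antisymm hle.1 fun v hv => ?_)).symm
  have h : ∀ y : (schrodinger W).domain,
      inner ℂ ((schrodinger W).adjoint ⟨v, hv⟩) (y : L2) = inner ℂ v (schrodinger W y) := fun y =>
    LinearPMap.adjoint_isFormalAdjoint hd ⟨v, hv⟩ y
  exact (mem_schrodinger_domain hW (isSchrodingerPow_of_forall_inner hW h)
    (vanishesAtZero_of_forall_inner hW h)).1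

theorem IsAdmissible.exists_potBound {W : ℝ → ℝ} (hW : IsAdmissible W) (N : ℕ) :
    ∃ M, PotBound W N M := by
  choose C hC hb using hW.deriv_le
  refine ⟨∑ k ∈ Finset.range N, C k, hW.smooth, hW.one_le,
    Finset.sum_nonneg fun k _ => (hC k).le, fun k hk x hx => (hb k x hx).trans ?_⟩
  have : 0 ≤ W x := zero_le_one.trans (hW.one_le x hx)
  exact mul_le_mul_of_nonneg_right
    (Finset.single_le_sum (fun j _ => (hC j).le) (Finset.mem_range.2 hk)) this

/-! ### Self-adjoint operators with bounded inverse and their square roots -/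

section Abstract

variable {H : Type*} [NormedAddCommGroup H] [InnerProductSpace ℂ H]

/-- The bounded operator `S` is the inverse of the unbounded operator `B`. -/
structure IsInv (B : H →ₗ.[ℂ] H) (S : H →L[ℂ] H) : Prop where
  right : ∀ f, ∃ h : S f ∈ B.domain, B ⟨S f, h⟩ = f
  left : ∀ u : B.domain, S (B u) = u

theorem IsInv.mem_iff {B : H →ₗ.[ℂ] H} {S : H →L[ℂ] H} (h : IsInv B S) {u : H} :
    u ∈ B.domain ↔ ∃ f, S f = u :=
  ⟨fun hu => ⟨B ⟨u, hu⟩, h.left ⟨u, hu⟩⟩, by rintro ⟨f, rfl⟩; exact (h.right f).1⟩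

theorem IsInv.ext {B B' : H →ₗ.[ℂ] H} {S : H →L[ℂ] H} (h : IsInv B S) (h' : IsInv B' S) :
    B = B' := by
  have hd : B.domain = B'.domain := by
    ext u
    rw [h.mem_iff, h'.mem_iff]
  refine LinearPMap.ext hd ?_
  rintro u hu hu'
  obtain ⟨f, rfl⟩ := h.mem_iff.1 hu
  rw [(h.right f).2, (h'.right f).2]

theorem IsInv.unique {B : H →ₗ.[ℂ] H} {S S' : H →L[ℂ] H} (h : IsInv B S) (h' : IsInv B S') :
    S = S' := by
  ext f
  obtain ⟨h1, h2⟩ := h.right f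
  have := h'.left ⟨S f, h1⟩
  rw [h2] at this
  exact this.symm

theorem IsInv.opComp {S T : H →ₗ.[ℂ] H} {S' T' : H →L[ℂ] H} (hS : IsInv S S') (hT : IsInv T T') :
    IsInv (opComp S T) (T' * S') := by
  refine ⟨fun f => ?_, ?_⟩
  · obtain ⟨h1, e1⟩ := hS.right f
    obtain ⟨h2, e2⟩ := hT.right (S' f)
    have h3 : T ⟨T' (S' f), h2⟩ ∈ S.domain := by rw [e2]; exact h1
    refine ⟨mem_opComp_domain.2 ⟨h2, h3⟩, ?_⟩
    change S ⟨T ⟨T' (S' f), h2⟩, _⟩ = f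
    simp only [e2, e1]
  · rintro ⟨u, hu⟩
    obtain ⟨h1, h2⟩ := mem_opComp_domain.1 hu
    change T' (S' (S ⟨T ⟨u, h1⟩, h2⟩)) = u
    rw [hS.left ⟨T ⟨u, h1⟩, h2⟩, hT.left ⟨u, h1⟩]

theorem IsInv.opPow {B : H →ₗ.[ℂ] H} {S : H →L[ℂ] H} (h : IsInv B S) (n : ℕ) :
    IsInv (opPow B n) (S ^ n) := by
  induction n with
  | zero => exact ⟨fun f => ⟨trivial, rfl⟩, fun u => rfl⟩
  | succ n ih =>
    rw [pow_succ]
    exact h.opComp ih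

/-- The unbounded inverse of an injective bounded operator. -/
noncomputable def invOp (S : H →L[ℂ] H) (hS : Function.Injective S) : H →ₗ.[ℂ] H where
  domain := LinearMap.range (S : H →ₗ[ℂ] H)
  toFun := ((LinearEquiv.ofInjective (S : H →ₗ[ℂ] H) hS).symm :
    LinearMap.range (S : H →ₗ[ℂ] H) →ₗ[ℂ] H)

theorem isInv_invOp (S : H →L[ℂ] H) (hS : Function.Injective S) : IsInv (invOp S hS) S := by
  refine ⟨fun f => ⟨⟨f, rfl⟩, ?_⟩, fun u => ?_⟩
  · exact LinearEquiv.ofInjective_symm_apply (f := (S : H →ₗ[ℂ] H)) (h := hS) ⟨S f, ⟨f, rfl⟩⟩ |>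
      fun h => hS h
  · exact LinearEquiv.ofInjective_symm_apply (f := (S : H →ₗ[ℂ] H)) (h := hS) u

variable [CompleteSpace H]

theorem _root_.IsSelfAdjoint.exists_mem_domain {A : H →ₗ.[ℂ] H} (hA : IsSelfAdjoint A) {v g : H}
    (h : ∀ x : A.domain, inner ℂ g (x : H) = inner ℂ v (A x)) :
    ∃ hv : v ∈ A.domain, A ⟨v, hv⟩ = g := by
  have key : ∃ hv : v ∈ A.adjoint.domain, A.adjoint ⟨v, hv⟩ = g :=
    ⟨LinearPMap.mem_adjoint_domain_of_exists v ⟨g, h⟩,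
      LinearPMap.adjoint_apply_eq hA.dense_domain _ h⟩
  rw [LinearPMap.isSelfAdjoint_def] at hA
  rwa [hA] at key

theorem _root_.IsSelfAdjoint.inner_left {A : H →ₗ.[ℂ] H} (hA : IsSelfAdjoint A)
    (x y : A.domain) : inner ℂ (A x) (y : H) = inner ℂ (x : H) (A y) := by
  have h := LinearPMap.adjoint_isFormalAdjoint (T := A) hA.dense_domain
  rw [LinearPMap.isSelfAdjoint_def] at hA
  rw [hA] at h
  exact h x y

/-- Boundedness of the inverse is free: it is symmetric and defined everywhere, so
Hellinger–Toeplitz applies. -/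
theorem exists_isInv {A : H →ₗ.[ℂ] H} (hA : IsSelfAdjoint A)
    (hn : ∀ u : A.domain, 0 ≤ (inner ℂ (A u) (u : H)).re)
    (hi : ∀ u : A.domain, A u = 0 → u = 0) (hs : ∀ f, ∃ u : A.domain, A u = f) :
    ∃ S : H →L[ℂ] H, IsInv A S ∧ 0 ≤ S := by
  have inj : Function.Injective A.toFun := by
    rw [injective_iff_map_eq_zero]
    exact hi
  let E : A.domain ≃ₗ[ℂ] H := LinearEquiv.ofBijective A.toFun ⟨inj, hs⟩
  have hE : ∀ u, E u = A u := fun u => rfl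
  let S0 : H →ₗ[ℂ] H := A.domain.subtype ∘ₗ (E.symm : H →ₗ[ℂ] A.domain)
  have hS0 : ∀ f, S0 f = (E.symm f : H) := fun f => rfl
  have hAS : ∀ f, A (E.symm f) = f := fun f => E.apply_symm_apply f
  have sym : S0.IsSymmetric := by
    intro f g
    rw [hS0, hS0]
    nth_rw 1 [← hAS g]
    nth_rw 2 [← hAS f]
    exact (hA.inner_left _ _).symm
  refine ⟨⟨S0, sym.continuous⟩, ⟨fun f => ⟨(E.symm f).2, hAS f⟩, fun u => ?_⟩, ?_⟩
  · change (E.symm (A u) : H) = u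
    rw [← hE, E.symm_apply_apply]
  · rw [ContinuousLinearMap.nonneg_iff_isPositive, ContinuousLinearMap.isPositive_def]
    refine ⟨sym, fun f => ?_⟩
    have := hn (E.symm f)
    rw [hAS, ← Complex.conj_re, inner_conj_symm] at this
    exact this

/-- Coercivity gives ‖u‖ ≤ ‖Au‖. With the closed graph this makes the range closed; it is dense
since a vector orthogonal to it lies in the kernel of A* = A, which is trivial. -/
theorem surjective_of_coercive {A : H →ₗ.[ℂ] H} (hA : IsSelfAdjoint A)
    (hc : ∀ u : A.domain, ‖(u : H)‖ ^ 2 ≤ (inner ℂ (u : H) (A u)).re) :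
    ∀ f, ∃ u : A.domain, A u = f := by
  have hle : ∀ u : A.domain, ‖(u : H)‖ ≤ ‖A u‖ := by
    intro u
    have h1 := (hc u).trans ((Complex.re_le_norm _).trans (norm_inner_le_norm _ _))
    rcases (norm_nonneg (u : H)).eq_or_lt with h | h
    · rw [← h]; exact norm_nonneg _
    · rw [sq] at h1
      exact le_of_mul_le_mul_left h1 h
  have hcl : IsClosed (LinearMap.range A.toFun : Set H) := by
    refine IsSeqClosed.isClosed fun x f hx hf => ?_
    choose u hu using hx
    have hcau : CauchySeq fun n => (u n : H) := by
      refine (cauchySeq_iff_le_tendsto_0.2 ?_)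
      obtain ⟨b, b0, hb, hb'⟩ := cauchySeq_iff_le_tendsto_0.1 hf.cauchySeq
      refine ⟨b, b0, fun n m N hn hm => ?_, hb'⟩
      refine le_trans ?_ (hb n m N hn hm)
      rw [dist_eq_norm, dist_eq_norm, ← hu n, ← hu m, ← map_sub]
      exact hle (u n - u m)
    obtain ⟨v, hv⟩ := cauchySeq_tendsto_of_complete hcau
    have hg : IsClosed (A.graph : Set (H × H)) := hA.isClosed
    have hmem : (v, f) ∈ A.graph := by
      refine hg.mem_of_tendsto (hv.prodMk_nhds hf) (Filter.Eventually.of_forall fun n => ?_)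
      change ((u n : H), x n) ∈ A.graph
      rw [← hu n]
      exact A.mem_graph (u n)
    obtain ⟨y, hy1, hy2⟩ := (LinearPMap.mem_graph_iff A).1 hmem
    exact ⟨y, hy2⟩
  have hdense : (LinearMap.range A.toFun)ᗮ = ⊥ := by
    rw [Submodule.eq_bot_iff]
    intro w hw
    obtain ⟨h1, h2⟩ := hA.exists_mem_domain (v := w) (g := 0) (fun x => by
      rw [inner_zero_left, ← inner_conj_symm, hw (A x) ⟨x, rfl⟩, map_zero])
    have := hle ⟨w, h1⟩
    rw [h2, norm_zero] at this
    exact norm_le_zero_iff.1 this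
  intro f
  have hf : f ∈ (LinearMap.range A.toFun).topologicalClosure := by
    rw [(Submodule.topologicalClosure_eq_top_iff).2 hdense]
    trivial
  have hf' : f ∈ LinearMap.range A.toFun := by
    rwa [IsClosed.submodule_topologicalClosure_eq hcl] at hf
  exact hf'

theorem exists_isInv_of_coercive {A : H →ₗ.[ℂ] H} (hA : IsSelfAdjoint A)
    (hc : ∀ u : A.domain, ‖(u : H)‖ ^ 2 ≤ (inner ℂ (u : H) (A u)).re) :
    ∃ T : H →L[ℂ] H, IsInv A T ∧ 0 ≤ T := by
  refine exists_isInv hA (fun u => ?_) (fun u hu => ?_) (surjective_of_coercive hA hc)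
  · rw [hA.inner_left]
    exact (sq_nonneg _).trans (hc u)
  · have := hc u
    rw [hu, inner_zero_right, Complex.zero_re] at this
    have h0 : ‖(u : H)‖ = 0 := by nlinarith [norm_nonneg (u : H)]
    exact Subtype.ext (norm_eq_zero.1 h0)

/-- B inherits injectivity and surjectivity from B ∘ B = A, so it too has a bounded inverse, whose
square inverts A. -/
theorem IsPosSqrt.exists_isInv {A B : H →ₗ.[ℂ] H} {T : H →L[ℂ] H} (hT : IsInv A T)
    (hB : IsPosSqrt A B) : ∃ S : H →L[ℂ] H, IsInv B S ∧ 0 ≤ S ∧ S * S = T := by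
  have hsq := hB.sq
  obtain ⟨S, hS, hS0⟩ := HalfLine.exists_isInv hB.selfAdjoint hB.nonneg (fun u hu => by
    have hm : (u : H) ∈ (HalfLine.opComp B B).domain :=
      mem_opComp_domain.2 ⟨u.2, by rw [hu]; exact B.domain.zero_mem⟩
    have hv : HalfLine.opComp B B ⟨u, hm⟩ = 0 := by
      change B ⟨B u, _⟩ = 0
      have : (⟨B u, by rw [hu]; exact B.domain.zero_mem⟩ : B.domain) = 0 := Subtype.ext hu
      rw [this, LinearPMap.map_zero]
    have h2 : ∀ C : H →ₗ.[ℂ] H, C = A → ∀ h : (u : H) ∈ C.domain, C ⟨u, h⟩ = 0 → (u : H) = 0 := by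
      rintro C rfl h hz
      rw [← hT.left ⟨u, h⟩, hz, map_zero]
    exact Subtype.ext (h2 _ hsq hm hv)) (fun f => by
    have h2 : ∀ C : H →ₗ.[ℂ] H, C = A → ∃ h : T f ∈ C.domain, C ⟨T f, h⟩ = f := by
      rintro C rfl
      exact hT.right f
    obtain ⟨h, e⟩ := h2 _ hsq
    obtain ⟨h3, h4⟩ := mem_opComp_domain.1 h
    exact ⟨⟨B ⟨T f, h3⟩, h4⟩, e⟩)
  refine ⟨S, hS, hS0, ?_⟩
  have := hS.opComp hS
  rw [hsq] at this
  exact this.unique hT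

/-- Symmetry of S gives v = S(B* v) for every v in D(B*), so v lies in the range of S, which is
D(B). Density holds because S is symmetric and injective. -/
theorem IsInv.isSelfAdjoint {B : H →ₗ.[ℂ] H} {S : H →L[ℂ] H} (h : IsInv B S) (h0 : 0 ≤ S) :
    IsSelfAdjoint B ∧ ∀ u : B.domain, 0 ≤ (inner ℂ (B u) (u : H)).re := by
  rw [ContinuousLinearMap.nonneg_iff_isPositive, ContinuousLinearMap.isPositive_def] at h0
  obtain ⟨sym, pos⟩ := h0
  have inj : ∀ x, S x = 0 → x = 0 := by
    intro x hx
    obtain ⟨h1, h2⟩ := h.right x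
    have : (⟨S x, h1⟩ : B.domain) = 0 := Subtype.ext hx
    rw [← h2, this, LinearPMap.map_zero]
  have hd : Dense (B.domain : Set H) := by
    rw [Submodule.dense_iff_topologicalClosure_eq_top, Submodule.topologicalClosure_eq_top_iff,
      Submodule.eq_bot_iff]
    intro w hw
    refine inj w (inner_self_eq_zero (𝕜 := ℂ).1 ?_)
    have := hw (S (S w)) (h.right _).1
    exact (sym (S w) w).symm.trans this
  have hf : B.IsFormalAdjoint B := by
    intro x y
    have := sym (B x) (B y)
    change inner ℂ (S (B x)) (B y) = inner ℂ (B x) (S (B y)) at this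
    rw [h.left, h.left] at this
    exact this.symm
  refine ⟨?_, fun u => ?_⟩
  · rw [LinearPMap.isSelfAdjoint_def]
    have hle := hf.le_adjoint hd
    refine (LinearPMap.eq_of_le_of_domain_eq hle (le_antisymm hle.1 fun v hv => ?_)).symm
    have hg : S (B.adjoint ⟨v, hv⟩) = v := by
      refine ext_inner_right ℂ fun w => ?_
      have h1 := LinearPMap.adjoint_isFormalAdjoint hd ⟨v, hv⟩ ⟨S w, (h.right w).1⟩
      rw [(h.right w).2] at h1
      exact (sym _ _).trans h1
    rw [← hg]
    exact (h.right _).1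
  · have := pos (B u)
    change 0 ≤ (inner ℂ (S (B u)) (B u)).re at this
    rw [h.left, ← Complex.conj_re, inner_conj_symm] at this
    exact this

theorem IsInv.injective_sqrt {A : H →ₗ.[ℂ] H} {T : H →L[ℂ] H} (hT : IsInv A T) (h0 : 0 ≤ T) :
    Function.Injective (CFC.sqrt T : H →L[ℂ] H) := by
  intro x y h
  have e : T = CFC.sqrt T * CFC.sqrt T := (CFC.sqrt_mul_sqrt_self T h0).symm
  have h' : T x = T y := by
    rw [e]
    exact congrArg (CFC.sqrt T : H →L[ℂ] H) h
  obtain ⟨h1, h2⟩ := hT.right x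
  obtain ⟨h3, h4⟩ := hT.right y
  rw [← h2, ← h4]
  congr 1
  exact Subtype.ext h'

/-- The square root of A is taken to be the unbounded inverse of √T, so the functional calculus is
needed for bounded operators only. -/
theorem exists_isPosSqrt {A : H →ₗ.[ℂ] H} {T : H →L[ℂ] H} (hT : IsInv A T) (h0 : 0 ≤ T) :
    IsPosSqrt A (invOp (CFC.sqrt T) (hT.injective_sqrt h0)) := by
  have hi := isInv_invOp (CFC.sqrt T) (hT.injective_sqrt h0)
  obtain ⟨h1, h2⟩ := hi.isSelfAdjoint (CFC.sqrt_nonneg T)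
  refine ⟨h1, h2, ?_⟩
  have := hi.opComp hi
  rw [CFC.sqrt_mul_sqrt_self T h0] at this
  exact this.ext hT

/-- The inverses of two square roots of A are nonnegative square roots of the same bounded T, hence
equal, and an operator is determined by its inverse. -/
theorem existsUnique_isPosSqrt {A : H →ₗ.[ℂ] H} {T : H →L[ℂ] H} (hT : IsInv A T) (h0 : 0 ≤ T) :
    ∃! B, IsPosSqrt A B := by
  refine ⟨_, exists_isPosSqrt hT h0, fun B hB => ?_⟩
  obtain ⟨S, hS, hS0, e⟩ := hB.exists_isInv hT
  obtain ⟨S', hS', hS0', e'⟩ := (exists_isPosSqrt hT h0).exists_isInv hT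
  have : S = S' := by rw [← CFC.sqrt_unique e hS0, CFC.sqrt_unique e' hS0']
  rw [← this] at hS'
  exact hS.ext hS'

/-- R is the bounded inverse of A^(1/2). Identities between half powers, domains included, reduce to
identities between powers of R. -/
theorem exists_isInv_halfPow {A : H →ₗ.[ℂ] H} {T : H →L[ℂ] H} (hT : IsInv A T) (h0 : 0 ≤ T) :
    ∃ R : H →L[ℂ] H, R * R = T ∧ IsSelfAdjoint (posSqrt A) ∧ halfPow A 1 = posSqrt A ∧
      ∀ s, IsInv (halfPow A s) (R ^ s) := by
  have hex : ∃ B, IsPosSqrt A B := ⟨_, exists_isPosSqrt hT h0⟩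
  have hB : IsPosSqrt A (posSqrt A) := by
    rw [posSqrt, dif_pos hex]
    exact hex.choose_spec
  obtain ⟨R, hR, -, e⟩ := hB.exists_isInv hT
  have h1 := hR.opPow 1
  rw [pow_one] at h1
  exact ⟨R, e, hB.selfAdjoint, h1.ext hR, fun s => hR.opPow s⟩

/-- `A ^ ((s + 2) / 2) = A ^ (s / 2) ∘ A`. -/
theorem halfPow_add_two {A : H →ₗ.[ℂ] H} {T : H →L[ℂ] H} (hT : IsInv A T) (h0 : 0 ≤ T) (s : ℕ) :
    halfPow A (s + 2) = opComp (halfPow A s) A := by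
  obtain ⟨R, e, -, -, hR⟩ := exists_isInv_halfPow hT h0
  have h1 := (hR s).opComp hT
  rw [← e, ← sq, ← pow_add, add_comm] at h1
  exact (hR (s + 2)).ext h1

end Abstract

/-! ### The domain of the square root -/

theorem ae_eq_of_tendsto {f : ℕ → L2} {f₀ : L2} {g : ℝ → ℂ}
    (hf : Filter.Tendsto f Filter.atTop (nhds f₀))
    (hg : ∀ᵐ x ∂volPos, Filter.Tendsto (fun n => f n x) Filter.atTop (nhds (g x))) :
    (f₀ : ℝ → ℂ) =ᵐ[volPos] g := by
  obtain ⟨ns, hns, h⟩ := (tendstoInMeasure_of_tendsto_Lp hf).exists_seq_tendsto_ae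
  filter_upwards [h, hg] with x h1 h2
  exact tendsto_nhds_unique h1 (h2.comp hns.tendsto_atTop)

/-- The integral over (0, x] is the inner product with an indicator function, hence continuous on
L². -/
theorem tendsto_intervalIntegral_of_tendsto {p : ℕ → L2} {p₀ : L2}
    (hp : Filter.Tendsto p Filter.atTop (nhds p₀)) {x : ℝ} (hx : 0 ≤ x) :
    Filter.Tendsto (fun n => ∫ t in (0 : ℝ)..x, p n t) Filter.atTop
      (nhds (∫ t in (0 : ℝ)..x, p₀ t)) := by
  have m1 : MemLp ((Ioc 0 x).indicator fun _ => (1 : ℂ)) 2 volPos :=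
    memLp_indicator_const 2 measurableSet_Ioc 1 (Or.inr (by
      refine ((Measure.restrict_apply_le _ _).trans_lt ?_).ne
      simp))
  have key : ∀ f : L2, inner ℂ (m1.toLp _) f = ∫ t in (0 : ℝ)..x, f t := by
    intro f
    rw [inner_eq_integral m1.coeFn_toLp (Filter.EventuallyEq.refl _ _),
      intervalIntegral.integral_of_le hx]
    have hsub : Ioc 0 x ⊆ Ioi 0 := Ioc_subset_Ioi_self
    rw [setIntegral_eq_of_subset_of_forall_sdiff_eq_zero measurableSet_Ioi hsub]
    · refine setIntegral_congr_fun measurableSet_Ioc fun t ht => ?_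
      simp [indicator_of_mem ht]
    · intro t ht
      simp [indicator_of_notMem ht.2]
  simp only [← key]
  exact tendsto_const_nhds.inner hp

theorem norm_sqrt_mul_sq {W : ℝ → ℝ} {U : ℝ → ℂ} {x : ℝ} (h : 0 ≤ W x) :
    ‖(Real.sqrt (W x) : ℂ) * U x‖ ^ 2 = W x * ‖U x‖ ^ 2 := by
  rw [norm_mul, Complex.norm_real, mul_pow, Real.norm_eq_abs, sq_abs, Real.sq_sqrt h]

theorem InForm.exists_lp {W : ℝ → ℝ} {M : ℝ} (hW : PotBound W 3 M) {u : L2} {U U' : ℝ → ℂ}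
    (hu : InForm W u U U') : ∃ p q : L2, (p : ℝ → ℂ) =ᵐ[volPos] U' ∧
      (q : ℝ → ℂ) =ᵐ[volPos] (fun x => (Real.sqrt (W x) : ℂ) * U x) := by
  have c : ContinuousOn (fun x => (Real.sqrt (W x) : ℂ) * U x) (Ici 0) :=
    (Complex.continuous_ofReal.comp_continuousOn hW.continuousOn.sqrt).mul hu.prim.continuousOn
  have m : MemLp (fun x => (Real.sqrt (W x) : ℂ) * U x) 2 volPos := by
    rw [memLp_two_iff (aestronglyMeasurable_of_continuousOn c)]
    refine hu.integrable.congr_fun (fun x hx => ?_) measurableSet_Ioi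
    exact (norm_sqrt_mul_sq (hW.pos (le_of_lt hx)).le).symm
  exact ⟨_, _, hu.memLp.coeFn_toLp, m.coeFn_toLp⟩

theorem inner_schrodinger_lp {W : ℝ → ℝ} {M : ℝ} (hW : PotBound W 3 M) {u : L2} {U U' : ℝ → ℂ}
    (hu : InForm W u U U') (y : (schrodinger W).domain) {Y Y' : ℝ → ℂ}
    (hy : InForm W y Y Y') (hs : IsDirichletSol W Y Y' (schrodinger W y)) {p q p' q' : L2}
    (hp : (p : ℝ → ℂ) =ᵐ[volPos] U') (hq : (q : ℝ → ℂ) =ᵐ[volPos] fun x => (√(W x) : ℂ) * U x)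
    (hp' : (p' : ℝ → ℂ) =ᵐ[volPos] Y') (hq' : (q' : ℝ → ℂ) =ᵐ[volPos] fun x => (√(W x) : ℂ) * Y x) :
    inner ℂ u (schrodinger W y) = inner ℂ p p' + inner ℂ q q' := by
  rw [inner_schrodinger hW hu y hy hs, inner_eq_integral hp hp', inner_eq_integral hq hq']
  congr 1
  refine setIntegral_congr_fun measurableSet_Ioi fun x hx => ?_
  have : ((√(W x) : ℝ) : ℂ) * (√(W x) : ℝ) = (W x : ℂ) := by
    rw [← Complex.ofReal_mul, Real.mul_self_sqrt (hW.pos (le_of_lt hx)).le]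
  simp only [map_mul, Complex.conj_ofReal]
  rw [← this]
  ring

/-- With w = A^(1/2) u and R the inverse of A^(1/2), take wₙ → w in D(A^(1/2)). Then R wₙ lies in
D(A), where the form is available, and wₙ ↦ (Yₙ', W^(1/2) Yₙ) preserves inner products. Hence these
pairs converge in L², and the norm identity passes to the limit. -/
theorem exists_inForm_halfPow_one {W : ℝ → ℝ} {M : ℝ} (hW : PotBound W 3 M)
    (u : (halfPow (schrodinger W) 1).domain) :
    ∃ U U', InForm W u U U' ∧ ‖halfPow (schrodinger W) 1 u‖ ^ 2
      = (∫ x in Ioi 0, ‖U' x‖ ^ 2) + ∫ x in Ioi 0, W x * ‖U x‖ ^ 2 := by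
  obtain ⟨T, hT, hT0⟩ := exists_isInv_of_coercive (isSelfAdjoint_schrodinger hW)
    (norm_sq_le_inner_schrodinger hW)
  obtain ⟨R, hRT, hB, h1, hR⟩ := exists_isInv_halfPow hT hT0
  have hR1 := hR 1
  rw [pow_one] at hR1
  set w : L2 := halfPow (schrodinger W) 1 u
  have hu : R w = u := hR1.left u
  have sa : IsSelfAdjoint (halfPow (schrodinger W) 1) := by rw [h1]; exact hB
  have symR : ∀ a b : L2, inner ℂ (R a) b = inner ℂ a (R b) := by
    intro a b
    obtain ⟨m1, e1⟩ := hR1.right a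
    obtain ⟨m2, e2⟩ := hR1.right b
    have := sa.inner_left ⟨_, m1⟩ ⟨_, m2⟩
    rw [e1, e2] at this
    exact this.symm
  obtain ⟨wn, hwn, hlim⟩ := mem_closure_iff_seq_limit.1 (sa.dense_domain w)
  choose z hz using fun n => hR1.mem_iff.1 (hwn n)
  -- Writing wₙ = R zₙ gives R wₙ = R² zₙ = T zₙ.
  have hT' : ∀ n, ∃ h : R (wn n) ∈ (schrodinger W).domain, schrodinger W ⟨R (wn n), h⟩ = z n := by
    intro n
    have := hT.right (z n)
    rw [← hRT] at this
    rw [← hz n]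
    exact this
  choose hm hA using hT'
  choose Y Y' hY hsY using fun n => exists_inForm hW ⟨R (wn n), hm n⟩
  choose p q hp hq using fun n => (hY n).exists_lp hW
  -- Green's formula and symmetry of R: the form at (R wₙ, R wₘ) is ⟨R wₙ, zₘ⟩ = ⟨wₙ, R zₘ⟩ = ⟨wₙ,
  -- wₘ⟩.
  have gram : ∀ n m, inner ℂ (p n) (p m) + inner ℂ (q n) (q m) = inner ℂ (wn n) (wn m) := by
    intro n m
    rw [← inner_schrodinger_lp hW (hY n) ⟨R (wn m), hm m⟩ (hY m) (hsY m) (hp n) (hq n) (hp m) (hq m),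
      hA m]
    change inner ℂ (R (wn n)) (z m) = _
    rw [symR, hz m]
  have dist_eq : ∀ n m, ‖p n - p m‖ ^ 2 + ‖q n - q m‖ ^ 2 = ‖wn n - wn m‖ ^ 2 := by
    intro n m
    have g1 := congrArg Complex.re (gram n n)
    have g2 := congrArg Complex.re (gram m m)
    have g3 := congrArg Complex.re (gram n m)
    have e := fun x : L2 => inner_self_eq_norm_sq (𝕜 := ℂ) x
    simp only [RCLike.re_eq_complex_re] at e
    rw [Complex.add_re, e, e, e] at g1 g2
    rw [Complex.add_re] at g3
    rw [norm_sub_sq (𝕜 := ℂ), norm_sub_sq (𝕜 := ℂ), norm_sub_sq (𝕜 := ℂ)]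
    simp only [RCLike.re_eq_complex_re]
    linarith
  have cau := hlim.cauchySeq
  have cauchy_of_le : ∀ r : ℕ → L2, (∀ n m, ‖r n - r m‖ ≤ ‖wn n - wn m‖) → CauchySeq r := by
    intro r hr
    rw [Metric.cauchySeq_iff] at cau ⊢
    intro ε hε
    obtain ⟨N, hN⟩ := cau ε hε
    refine ⟨N, fun m hm n hn => ?_⟩
    rw [dist_eq_norm]
    refine (hr m n).trans_lt ?_
    rw [← dist_eq_norm]
    exact hN m hm n hn
  obtain ⟨p₀, hp₀⟩ := cauchySeq_tendsto_of_complete (cauchy_of_le p fun n m => by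
    refine le_of_sq_le_sq ?_ (norm_nonneg _)
    nlinarith [dist_eq n m, sq_nonneg ‖q n - q m‖])
  obtain ⟨q₀, hq₀⟩ := cauchySeq_tendsto_of_complete (cauchy_of_le q fun n m => by
    refine le_of_sq_le_sq ?_ (norm_nonneg _)
    nlinarith [dist_eq n m, sq_nonneg ‖p n - p m‖])
  -- Since Yₙ(0) = 0, the function Yₙ is the integral of Yₙ' from 0, so L² convergence of Yₙ' forces
  -- pointwise convergence of Yₙ to U. This identifies both other limits.
  set U : ℝ → ℂ := fun x => 0 + ∫ t in (0 : ℝ)..x, p₀ t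
  have pU : IsPrim U p₀ := isPrim_integral (fun x hx => intervalIntegrable_of_memLp (Lp.memLp p₀) hx) 0
  have hlimY : ∀ x, 0 < x → Filter.Tendsto (fun n => Y n x) Filter.atTop (nhds (U x)) := by
    intro x hx
    have := tendsto_intervalIntegral_of_tendsto hp₀ hx.le
    simp only [U, zero_add]
    refine this.congr fun n => ?_
    have pY := (hY n).prim.congr (hp n).symm
    rw [pY.eq x hx.le, (hY n).zero, zero_add]
  have hue : (u : ℝ → ℂ) =ᵐ[volPos] U := by
    have ht : Filter.Tendsto (fun n => R (wn n)) Filter.atTop (nhds (u : L2)) := by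
      rw [← hu]
      exact (R.continuous.tendsto w).comp hlim
    refine ae_eq_of_tendsto ht ?_
    have hall : ∀ᵐ x ∂volPos, ∀ n, R (wn n) x = Y n x := ae_all_iff.2 fun n => (hY n).ae_eq
    filter_upwards [hall, ae_volPos hlimY] with x h1 h2
    simpa only [h1] using h2
  have hqe : (q₀ : ℝ → ℂ) =ᵐ[volPos] fun x => (√(W x) : ℂ) * U x := by
    refine ae_eq_of_tendsto hq₀ ?_
    have hall : ∀ᵐ x ∂volPos, ∀ n, q n x = (√(W x) : ℂ) * Y n x := ae_all_iff.2 fun n => hq n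
    filter_upwards [hall, ae_volPos hlimY] with x h1 h2
    simpa only [h1] using h2.const_mul _
  have hnorm : ‖w‖ ^ 2 = ‖p₀‖ ^ 2 + ‖q₀‖ ^ 2 := by
    have t1 := (hp₀.norm.pow 2).add (hq₀.norm.pow 2)
    have t2 := hlim.norm.pow 2
    refine tendsto_nhds_unique t2 (t1.congr fun n => ?_)
    have g1 := congrArg Complex.re (gram n n)
    have e := fun x : L2 => inner_self_eq_norm_sq (𝕜 := ℂ) x
    simp only [RCLike.re_eq_complex_re] at e
    rw [Complex.add_re, e, e, e] at g1
    exact g1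
  have hsq : ∀ x ∈ Ioi (0 : ℝ), ‖(√(W x) : ℂ) * U x‖ ^ 2 = W x * ‖U x‖ ^ 2 := fun x hx =>
    norm_sqrt_mul_sq (hW.pos (le_of_lt hx)).le
  have mq : MemLp (fun x => (√(W x) : ℂ) * U x) 2 volPos := (Lp.memLp q₀).ae_eq hqe
  refine ⟨U, p₀, ⟨hue, pU, by simp [U], Lp.memLp p₀, ?_⟩, ?_⟩
  · exact ((memLp_two_iff mq.1).1 mq).congr_fun hsq measurableSet_Ioi
  · rw [hnorm, norm_sq_eq_integral (Filter.EventuallyEq.refl _ (p₀ : ℝ → ℂ)),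
      norm_sq_eq_integral hqe, setIntegral_congr_fun measurableSet_Ioi hsq]

/-- By self-adjointness it suffices that w ↦ ⟨u, Bw⟩ is bounded on D(B), where B = A^(1/2). As Bw =
A(T B w), this pairing is the form at (u, T B w), and Cauchy–Schwarz applies since the form at (T B
w, T B w) equals ‖w‖². -/
theorem mem_halfPow_one_of_inForm {W : ℝ → ℝ} {M : ℝ} (hW : PotBound W 3 M) {u : L2}
    {U U' : ℝ → ℂ} (hu : InForm W u U U') : u ∈ (halfPow (schrodinger W) 1).domain := by
  obtain ⟨T, hT, hT0⟩ := exists_isInv_of_coercive (isSelfAdjoint_schrodinger hW)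
    (norm_sq_le_inner_schrodinger hW)
  obtain ⟨R, hRT, hB, h1, hR⟩ := exists_isInv_halfPow hT hT0
  have hR1 := hR 1
  rw [pow_one] at hR1
  set B := halfPow (schrodinger W) 1
  have sa : IsSelfAdjoint B := by rw [h1]; exact hB
  obtain ⟨p, q, hp, hq⟩ := hu.exists_lp hW
  have key : ∀ w : B.domain, ‖inner ℂ u (B w)‖ ≤ (‖p‖ + ‖q‖) * ‖w‖ := by
    intro w
    have hw : R (B w) = w := hR1.left w
    obtain ⟨m, e⟩ := hT.right (B w)
    obtain ⟨Y, Y', hY, hsY⟩ := exists_inForm hW ⟨T (B w), m⟩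
    obtain ⟨p', q', hp', hq'⟩ := hY.exists_lp hW
    have i1 := inner_schrodinger_lp hW hu _ hY hsY hp hq hp' hq'
    have i2 := inner_schrodinger_lp hW hY _ hY hsY hp' hq' hp' hq'
    rw [e] at i1 i2
    change inner ℂ (T (B w)) (B w) = _ at i2
    obtain ⟨m1, e1⟩ := hR1.right (w : L2)
    -- T = R² and R B w = w.
    have e3 : T (B w) = R w := by rw [← hRT, ← hw]; rfl
    have i3 := sa.inner_left ⟨R w, m1⟩ w
    rw [e1] at i3
    change inner ℂ (w : L2) (w : L2) = inner ℂ (R w) (B w) at i3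
    rw [e3, ← i3] at i2
    have e := fun x : L2 => inner_self_eq_norm_sq (𝕜 := ℂ) x
    simp only [RCLike.re_eq_complex_re] at e
    have i4 := congrArg Complex.re i2
    rw [Complex.add_re, e, e, e] at i4
    have n1 : ‖p'‖ ≤ ‖(w : L2)‖ := le_of_sq_le_sq (by nlinarith [sq_nonneg ‖q'‖]) (norm_nonneg _)
    have n2 : ‖q'‖ ≤ ‖(w : L2)‖ := le_of_sq_le_sq (by nlinarith [sq_nonneg ‖p'‖]) (norm_nonneg _)
    rw [i1]
    calc ‖inner ℂ p p' + inner ℂ q q'‖ ≤ ‖p‖ * ‖p'‖ + ‖q‖ * ‖q'‖ :=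
          (norm_add_le _ _).trans (add_le_add (norm_inner_le_norm _ _) (norm_inner_le_norm _ _))
      _ ≤ ‖p‖ * ‖(w : L2)‖ + ‖q‖ * ‖(w : L2)‖ := by gcongr
      _ = _ := by rw [add_mul]; rfl
  have hmem : u ∈ B.adjoint.domain := by
    rw [LinearPMap.mem_adjoint_domain_iff]
    exact AddMonoidHomClass.continuous_of_bound _ (‖p‖ + ‖q‖) key
  rw [LinearPMap.isSelfAdjoint_def] at sa
  rwa [sa] at hmem

/-! ### Weighted norms -/

/-- The function `W ^ ((s - k) / 2) g`. -/
noncomputable def weighted (W : ℝ → ℝ) (s k : ℕ) (g : ℝ → ℂ) : ℝ → ℂ :=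
  fun x => ((W x ^ (((s : ℝ) - k) / 2) : ℝ) : ℂ) * g x

theorem weightedDeriv_eq (W : ℝ → ℝ) (s k : ℕ) (f : ℝ → ℂ) :
    weightedDeriv W s k f = weighted W s k (weakDeriv k f) := rfl

theorem weighted_congr {W : ℝ → ℝ} {s k : ℕ} {g g' : ℝ → ℂ} (h : g =ᵐ[volPos] g') :
    weighted W s k g =ᵐ[volPos] weighted W s k g' :=
  h.mono fun x hx => by simp only [weighted, hx]

/-- The weight depends only on s - k, so f^(k) at index s and u^(k+2) at index s + 2 carry the same
one. -/
theorem weighted_add_two (W : ℝ → ℝ) (s k : ℕ) (g : ℝ → ℂ) :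
    weighted W (s + 2) (k + 2) g = weighted W s k g := by
  funext x
  simp only [weighted]
  push_cast
  ring_nf

theorem norm_weighted_sq {W : ℝ → ℝ} {s k : ℕ} (hk : k ≤ s) {g : ℝ → ℂ} {x : ℝ} (hx : 0 < W x) :
    ‖weighted W s k g x‖ ^ 2 = W x ^ (s - k) * ‖g x‖ ^ 2 := by
  rw [weighted, norm_mul, mul_pow, Complex.norm_real, Real.norm_eq_abs, sq_abs,
    ← Real.rpow_natCast (W x ^ _), ← Real.rpow_mul hx.le, ← Real.rpow_natCast (W x) (s - k), Nat.cast_sub hk]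
  congr 2
  push_cast
  ring

theorem aestronglyMeasurable_weighted {W : ℝ → ℝ} {N : ℕ} {M : ℝ} (hW : PotBound W N M)
    {s k : ℕ} {g : ℝ → ℂ} (hg : LocallyIntegrableOn g (Ioi 0)) :
    AEStronglyMeasurable (weighted W s k g) volPos := by
  have hc : ContinuousOn (fun x => W x ^ (((s : ℝ) - k) / 2)) (Ici 0) :=
    hW.continuousOn.rpow_const fun x hx => Or.inl (hW.pos hx).ne'
  exact (aestronglyMeasurable_ofReal hc).mul hg.aestronglyMeasurable

theorem HasWeakDeriv.weightedDeriv_ae {W : ℝ → ℝ} {s k : ℕ} {f g : ℝ → ℂ}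
    (h : HasWeakDeriv k f g) : weightedDeriv W s k f =ᵐ[volPos] weighted W s k g :=
  weighted_congr h.weakDeriv_eq

theorem toReal_eLpNorm_sq {f : ℝ → ℂ} (hf : MemLp f 2 volPos) :
    (eLpNorm f 2 volPos).toReal ^ 2 = ∫ x in Ioi 0, ‖f x‖ ^ 2 := by
  rw [← Lp.norm_toLp f hf]
  exact norm_sq_eq_integral hf.coeFn_toLp

theorem toReal_eLpNorm_weighted_sq {W : ℝ → ℝ} {N : ℕ} {M : ℝ} (hW : PotBound W N M) {s k : ℕ}
    (hk : k ≤ s) {g : ℝ → ℂ} (hg : MemLp (weighted W s k g) 2 volPos) :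
    (eLpNorm (weighted W s k g) 2 volPos).toReal ^ 2 = ∫ x in Ioi 0, W x ^ (s - k) * ‖g x‖ ^ 2 := by
  rw [toReal_eLpNorm_sq hg]
  exact setIntegral_congr_fun measurableSet_Ioi fun x hx => norm_weighted_sq hk (hW.pos (le_of_lt hx))

theorem memLp_weighted_iff {W : ℝ → ℝ} {N : ℕ} {M : ℝ} (hW : PotBound W N M) {s k : ℕ}
    (hk : k ≤ s) {g : ℝ → ℂ} (hg : LocallyIntegrableOn g (Ioi 0)) :
    MemLp (weighted W s k g) 2 volPos ↔
      IntegrableOn (fun x => W x ^ (s - k) * ‖g x‖ ^ 2) (Ioi 0) := by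
  rw [memLp_two_iff (aestronglyMeasurable_weighted hW hg)]
  exact integrableOn_congr_fun (fun x hx => norm_weighted_sq hk (hW.pos (le_of_lt hx)))
    measurableSet_Ioi

/-- The weights are at least one. -/
theorem norm_le_norm_weighted {W : ℝ → ℝ} {N : ℕ} {M : ℝ} (hW : PotBound W N M) {s k : ℕ}
    (hk : k ≤ s) (g : ℝ → ℂ) {x : ℝ} (hx : 0 < x) : ‖g x‖ ≤ ‖weighted W s k g x‖ := by
  have h1 : 1 ≤ W x ^ (((s : ℝ) - k) / 2) := by
    refine Real.one_le_rpow (hW.one_le x hx.le) ?_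
    have : (k : ℝ) ≤ s := by exact_mod_cast hk
    linarith
  rw [weighted, norm_mul, Complex.norm_real, Real.norm_of_nonneg (zero_le_one.trans h1)]
  exact le_mul_of_one_le_left (norm_nonneg _) h1

theorem HasWeakDeriv.sub {k : ℕ} {f g f' g' : ℝ → ℂ} (h : HasWeakDeriv k f g)
    (h' : HasWeakDeriv k f' g') :
    HasWeakDeriv k (fun x => f x - f' x) (fun x => g x - g' x) := by
  refine (h.add (h'.const_smul (-1))).congr (Filter.Eventually.of_forall fun x => ?_)
    (Filter.Eventually.of_forall fun x => ?_)
  · simp [sub_eq_add_neg]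
  · simp [sub_eq_add_neg]

/-- Weighted estimates for the weak derivatives of `W u`. -/
theorem exists_hasWeakDeriv_pot_mul {W : ℝ → ℝ} {N : ℕ} {M : ℝ} (hW : PotBound W N M) {s k : ℕ}
    (hk : k < N) {u : ℝ → ℂ} (hu : ∀ j ≤ k, ∃ g, HasWeakDeriv j u g) :
    ∃ e, HasWeakDeriv k (fun x => (W x : ℂ) * u x) e ∧
      eLpNorm (weighted W s k e) 2 volPos ≤ ENNReal.ofReal (2 ^ k * M) *
        ∑ j ∈ Finset.range (k + 1), eLpNorm (weightedDeriv W (s + 2) j u) 2 volPos := by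
  have hd : ∀ j ≤ k, HasWeakDeriv j u (weakDeriv j u) := fun j hj =>
    hasWeakDeriv_weakDeriv (hu j hj)
  obtain ⟨e, he, hb⟩ := exists_hasWeakDeriv_potDeriv_mul hW.smooth (fun x hx => (hW.pos hx).le)
    hW.nonneg hW.bound k 0 (by omega) (fun j => weakDeriv j u) (hd 0 (by omega)).right
    (fun j hj => (hd j (by omega)).of_le (hd (j + 1) (by omega)))
  have e0 := (hasWeakDeriv_zero_iff.1 (hd 0 (by omega))).2
  refine ⟨e, he.congr (e0.mono fun x hx => ?_) (Filter.EventuallyEq.refl _ _), ?_⟩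
  · simp only [potDeriv_zero, hx]
  have hm : ∀ j ∈ Finset.range (k + 1), AEStronglyMeasurable
      (fun x => ‖weightedDeriv W (s + 2) j u x‖) volPos := fun j hj =>
    (aestronglyMeasurable_weighted hW
      (hd j (Nat.lt_succ_iff.1 (Finset.mem_range.1 hj))).right).norm
  have h1 : eLpNorm (weighted W s k e) 2 volPos ≤ ENNReal.ofReal (2 ^ k * M) *
      eLpNorm (∑ j ∈ Finset.range (k + 1), fun x => ‖weightedDeriv W (s + 2) j u x‖) 2 volPos := by
    refine eLpNorm_le_mul_eLpNorm_of_ae_le_mul (ae_volPos fun x hx => ?_) 2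
    have w1 := hW.one_le x hx.le
    have w0 := hW.pos hx.le
    have hM := hW.nonneg
    rw [Finset.sum_apply, Real.norm_of_nonneg (Finset.sum_nonneg fun _ _ => norm_nonneg _),
      weighted, norm_mul, Complex.norm_real, Real.norm_of_nonneg (by positivity)]
    calc W x ^ (((s : ℝ) - k) / 2) * ‖e x‖
        ≤ W x ^ (((s : ℝ) - k) / 2) *
          (2 ^ k * M * W x * ∑ j ∈ Finset.range (k + 1), ‖weakDeriv j u x‖) :=
          mul_le_mul_of_nonneg_left (hb x hx) (by positivity)
      _ = 2 ^ k * M * ∑ j ∈ Finset.range (k + 1),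
            W x ^ (((s : ℝ) - k) / 2 + 1) * ‖weakDeriv j u x‖ := by
          rw [← Finset.mul_sum, Real.rpow_add w0, Real.rpow_one]
          ring
      _ ≤ _ := by
          refine mul_le_mul_of_nonneg_left (Finset.sum_le_sum fun j hj => ?_) (by positivity)
          -- For j ≤ k the target exponent (s + 2 - j)/2 is at least (s - k)/2 + 1, and W ≥ 1 makes
          -- the larger exponent the larger weight.
          have hj' : (j : ℝ) ≤ k := by
            exact_mod_cast Nat.lt_succ_iff.1 (Finset.mem_range.1 hj)
          rw [weightedDeriv, norm_mul, Complex.norm_real, Real.norm_of_nonneg (by positivity)]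
          refine mul_le_mul_of_nonneg_right (Real.rpow_le_rpow_of_exponent_le w1 ?_)
            (norm_nonneg _)
          push_cast
          linarith
  refine h1.trans (mul_le_mul_right (((eLpNorm_sum_le hm (by norm_num))).trans
    (Finset.sum_le_sum fun j _ => ?_)) _)
  rw [eLpNorm_norm]

theorem eLpNorm_weighted_sub_le {W : ℝ → ℝ} {N : ℕ} {M : ℝ} (hW : PotBound W N M) {s k : ℕ}
    {f g : ℝ → ℂ} (hf : LocallyIntegrableOn f (Ioi 0)) (hg : LocallyIntegrableOn g (Ioi 0)) :
    eLpNorm (weighted W s k fun x => f x - g x) 2 volPos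
      ≤ eLpNorm (weighted W s k f) 2 volPos + eLpNorm (weighted W s k g) 2 volPos := by
  have : (weighted W s k fun x => f x - g x) = weighted W s k f - weighted W s k g := by
    funext x
    simp only [weighted, Pi.sub_apply]
    ring
  rw [this]
  exact eLpNorm_sub_le (aestronglyMeasurable_weighted hW hf) (aestronglyMeasurable_weighted hW hg)
    (by norm_num)

/-- The weighted norm with values in `[0, ∞]`. -/
noncomputable def eWeightedNorm (W : ℝ → ℝ) (s : ℕ) (f : ℝ → ℂ) : ℝ≥0∞ :=
  ∑ k ∈ Finset.range (s + 1), eLpNorm (weightedDeriv W s k f) 2 volPos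

theorem eLpNorm_le_eWeightedNorm {W : ℝ → ℝ} {s k : ℕ} (hk : k ≤ s) (f : ℝ → ℂ) :
    eLpNorm (weightedDeriv W s k f) 2 volPos ≤ eWeightedNorm W s f :=
  Finset.single_le_sum (f := fun k => eLpNorm (weightedDeriv W s k f) 2 volPos)
    (fun _ _ => zero_le) (Finset.mem_range.2 (by omega))

theorem MemWeighted.eWeightedNorm_ne_top {W : ℝ → ℝ} {s : ℕ} {f : ℝ → ℂ}
    (h : MemWeighted W s f) : eWeightedNorm W s f ≠ ⊤ :=
  ENNReal.sum_ne_top.2 fun k hk =>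
    (h k (Nat.lt_succ_iff.1 (Finset.mem_range.1 hk))).2.eLpNorm_ne_top

theorem MemWeighted.toReal_eWeightedNorm {W : ℝ → ℝ} {s : ℕ} {f : ℝ → ℂ}
    (h : MemWeighted W s f) : (eWeightedNorm W s f).toReal = weightedNorm W s f :=
  ENNReal.toReal_sum fun k hk =>
    (h k (Nat.lt_succ_iff.1 (Finset.mem_range.1 hk))).2.eLpNorm_ne_top

theorem memWeighted_of_lt_top {W : ℝ → ℝ} {N : ℕ} {M : ℝ} (hW : PotBound W N M) {s : ℕ} {f : ℝ → ℂ}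
    (h1 : ∀ k ≤ s, ∃ g, HasWeakDeriv k f g) (h2 : eWeightedNorm W s f < ⊤) : MemWeighted W s f :=
  fun k hk => ⟨h1 k hk, aestronglyMeasurable_weighted hW (hasWeakDeriv_weakDeriv (h1 k hk)).right,
    (eLpNorm_le_eWeightedNorm hk f).trans_lt h2⟩

/-! ### Regularity for the equation `-u'' + W u = f` -/

/-- The bootstrap u^(k+2) = (Wu)^(k) - f^(k): two more derivatives of u from those of order at most
k. -/
theorem eLpNorm_weightedDeriv_succ_le {W : ℝ → ℝ} {N : ℕ} {M : ℝ} (hW : PotBound W N M) {s k : ℕ}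
    (hk : k < N) {u f : ℝ → ℂ} (hu : ∀ j ≤ k, ∃ g, HasWeakDeriv j u g)
    (hf : ∃ g, HasWeakDeriv k f g) (h : HasWeakDeriv 2 u (fun x => (W x : ℂ) * u x - f x)) :
    (∃ g, HasWeakDeriv (k + 2) u g) ∧
    eLpNorm (weightedDeriv W (s + 2) (k + 2) u) 2 volPos ≤ ENNReal.ofReal (2 ^ k * M) *
        (∑ j ∈ Finset.range (k + 1), eLpNorm (weightedDeriv W (s + 2) j u) 2 volPos)
        + eLpNorm (weightedDeriv W s k f) 2 volPos := by
  obtain ⟨e, he, hb⟩ := exists_hasWeakDeriv_pot_mul hW (s := s) hk hu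
  have hf' := hasWeakDeriv_weakDeriv hf
  have h2 := h.comp (he.sub hf')
  rw [add_comm] at h2
  refine ⟨⟨_, h2⟩, ?_⟩
  rw [eLpNorm_congr_ae h2.weightedDeriv_ae, weighted_add_two]
  exact (eLpNorm_weighted_sub_le hW he.right hf'.right).trans (add_le_add_left hb _)

/-- The same identity solved for f^(k). -/
theorem eLpNorm_weightedDeriv_rhs_le {W : ℝ → ℝ} {N : ℕ} {M : ℝ} (hW : PotBound W N M) {s k : ℕ}
    (hk : k < N) {u f : ℝ → ℂ} (hu : ∀ j ≤ k + 2, ∃ g, HasWeakDeriv j u g)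
    (h : HasWeakDeriv 2 u (fun x => (W x : ℂ) * u x - f x)) :
    (∃ g, HasWeakDeriv k f g) ∧
    eLpNorm (weightedDeriv W s k f) 2 volPos ≤ ENNReal.ofReal (2 ^ k * M) *
        (∑ j ∈ Finset.range (k + 1), eLpNorm (weightedDeriv W (s + 2) j u) 2 volPos)
        + eLpNorm (weightedDeriv W (s + 2) (k + 2) u) 2 volPos := by
  obtain ⟨e, he, hb⟩ := exists_hasWeakDeriv_pot_mul hW (s := s) hk (fun j hj => hu j (by omega))
  have hu' := hasWeakDeriv_weakDeriv (hu (k + 2) le_rfl)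
  have h2 : HasWeakDeriv k (fun x => (W x : ℂ) * u x - f x) (weakDeriv (k + 2) u) :=
    h.of_le (by rwa [add_comm])
  have h3 : HasWeakDeriv k f (fun x => e x - weakDeriv (k + 2) u x) :=
    (he.sub h2).congr (Filter.Eventually.of_forall fun x => by ring) (Filter.EventuallyEq.refl _ _)
  refine ⟨⟨_, h3⟩, ?_⟩
  rw [eLpNorm_congr_ae h3.weightedDeriv_ae, weightedDeriv_eq W (s + 2) (k + 2), weighted_add_two]
  exact (eLpNorm_weighted_sub_le hW he.right hu'.right).trans (add_le_add_left hb _)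

theorem exists_eWeightedNorm_rhs_le (M : ℝ) (s : ℕ) : ∃ C : ℝ≥0, ∀ W, PotBound W (s + 1) M →
    ∀ u f : ℝ → ℂ, HasWeakDeriv 2 u (fun x => (W x : ℂ) * u x - f x) → MemWeighted W (s + 2) u →
    MemWeighted W s f ∧ eWeightedNorm W s f ≤ C * eWeightedNorm W (s + 2) u := by
  refine ⟨∑ k ∈ Finset.range (s + 1), (Real.toNNReal (2 ^ k * M) + 1), fun W hW u f h hu => ?_⟩
  have hk : ∀ k ≤ s, (∃ g, HasWeakDeriv k f g) ∧ eLpNorm (weightedDeriv W s k f) 2 volPos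
      ≤ ((Real.toNNReal (2 ^ k * M) + 1 : ℝ≥0) : ℝ≥0∞) * eWeightedNorm W (s + 2) u := by
    intro k hk
    obtain ⟨h1, h2⟩ := eLpNorm_weightedDeriv_rhs_le hW (s := s) (k := k) (by omega)
      (fun j hj => (hu j (by omega)).1) h
    refine ⟨h1, h2.trans ?_⟩
    rw [ENNReal.coe_add, add_mul, ENNReal.coe_one, one_mul]
    refine add_le_add (mul_le_mul_right ?_ _) (eLpNorm_le_eWeightedNorm (by omega) u)
    exact Finset.sum_le_sum_of_subset (Finset.range_mono (by omega))
  have hle : eWeightedNorm W s f ≤ ((∑ k ∈ Finset.range (s + 1),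
      (Real.toNNReal (2 ^ k * M) + 1) : ℝ≥0) : ℝ≥0∞) * eWeightedNorm W (s + 2) u := by
    rw [ENNReal.ofNNReal_finsetSum, Finset.sum_mul]
    exact Finset.sum_le_sum fun k hk' => (hk k (Nat.lt_succ_iff.1 (Finset.mem_range.1 hk'))).2
  exact ⟨memWeighted_of_lt_top hW (fun k h => (hk k h).1)
    (hle.trans_lt (ENNReal.mul_lt_top ENNReal.coe_lt_top hu.eWeightedNorm_ne_top.lt_top)), hle⟩

/-- The weighted norms of `u` and `u'` are controlled by that of `-u'' + W u`. -/
theorem exists_eLpNorm_weightedDeriv_le (M : ℝ) (s : ℕ) : ∃ C : ℝ≥0, ∀ W, PotBound W 3 M →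
    ∀ u : (schrodinger W).domain,
    MemLp (weightedDeriv W s 0 (schrodinger W u)) 2 volPos →
    ∀ k ≤ 1, (∃ g, HasWeakDeriv k (u : L2) g) ∧ eLpNorm (weightedDeriv W (s + 2) k (u : L2)) 2 volPos
      ≤ C * eLpNorm (weightedDeriv W s 0 (schrodinger W u)) 2 volPos := by
  obtain ⟨c, hc, H⟩ := energy_estimate M s
  -- The energy estimate bounds the squares by c(‖u‖² + F²), where F is the weighted norm of f = Au,
  -- and ‖u‖ ≤ ‖f‖ ≤ F by coercivity and W ≥ 1.
  refine ⟨Real.toNNReal (√(2 * c)), fun W hW u hf => ?_⟩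
  obtain ⟨U, U', hU, hs⟩ := exists_inForm hW u
  set f : L2 := schrodinger W u
  have lf := locallyIntegrableOn_of_memLp (Lp.memLp f)
  have lu := locallyIntegrableOn_of_memLp (Lp.memLp (u : L2))
  have f0 : HasWeakDeriv 0 f f := hasWeakDeriv_zero_iff.2 ⟨lf, Filter.EventuallyEq.refl _ _⟩
  have u0 : HasWeakDeriv 0 (u : L2) U := hasWeakDeriv_zero_iff.2 ⟨lu, hU.ae_eq⟩
  have u1 : HasWeakDeriv 1 (u : L2) U' :=
    hU.prim.hasWeakDeriv.congr hU.ae_eq.symm (Filter.EventuallyEq.refl _ _)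
  have mf : MemLp (weighted W s 0 f) 2 volPos := hf.ae_eq f0.weightedDeriv_ae
  have mU : MemLp U 2 volPos := (Lp.memLp (u : L2)).ae_eq hU.ae_eq
  obtain ⟨r1, r2, r3⟩ := H W hW U U' f hs ((memLp_two_iff mU.1).1 mU)
    ((memLp_weighted_iff hW (Nat.zero_le s) lf).1 mf) (Lp.memLp f).1
  have m0 : MemLp (weighted W (s + 2) 0 U) 2 volPos :=
    (memLp_weighted_iff hW (by omega) u0.right).2 r2
  have m1 : MemLp (weighted W (s + 2) 1 U') 2 volPos :=
    (memLp_weighted_iff hW (by omega) u1.right).2 r1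
  have n0 := toReal_eLpNorm_weighted_sq hW (by omega) m0
  have n1 := toReal_eLpNorm_weighted_sq hW (by omega) m1
  have nf := toReal_eLpNorm_weighted_sq hW (Nat.zero_le s) mf
  simp only [Nat.sub_zero] at n0 nf
  simp only [show s + 2 - 1 = s + 1 by omega] at n1
  rw [← n0, ← n1, ← norm_sq_eq_integral hU.ae_eq, ← nf] at r3
  have huf : ‖(u : L2)‖ ≤ ‖f‖ := by
    have h1 := (norm_sq_le_inner_schrodinger hW u).trans
      ((Complex.re_le_norm _).trans (norm_inner_le_norm _ _))
    rcases (norm_nonneg (u : L2)).eq_or_lt with h | h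
    · rw [← h]; exact norm_nonneg _
    · rw [sq] at h1
      exact le_of_mul_le_mul_left h1 h
  have hff : ‖f‖ ≤ (eLpNorm (weighted W s 0 f) 2 volPos).toReal := by
    rw [Lp.norm_def]
    refine ENNReal.toReal_mono mf.eLpNorm_ne_top (eLpNorm_mono_ae (ae_volPos fun x hx => ?_))
    exact norm_le_norm_weighted hW (Nat.zero_le s) _ hx
  set F := (eLpNorm (weighted W s 0 f) 2 volPos).toReal
  have hF : 0 ≤ F := ENNReal.toReal_nonneg
  have hsq : ‖(u : L2)‖ ^ 2 ≤ F ^ 2 := by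
    have := huf.trans hff
    gcongr
  have hbound : ∀ h : ℝ → ℂ, MemLp h 2 volPos → (eLpNorm h 2 volPos).toReal ^ 2 ≤ 2 * c * F ^ 2 →
      eLpNorm h 2 volPos
        ≤ (Real.toNNReal (√(2 * c)) : ℝ≥0∞) * eLpNorm (weighted W s 0 f) 2 volPos := by
    intro h hm hh
    rw [← ENNReal.toReal_le_toReal hm.eLpNorm_ne_top
      (ENNReal.mul_ne_top ENNReal.coe_ne_top mf.eLpNorm_ne_top), ENNReal.toReal_mul,
      ENNReal.coe_toReal, Real.coe_toNNReal _ (Real.sqrt_nonneg _)]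
    refine le_of_sq_le_sq ?_ (by positivity)
    rw [mul_pow, Real.sq_sqrt (by positivity)]
    exact hh
  intro k hk
  rw [eLpNorm_congr_ae f0.weightedDeriv_ae]
  interval_cases k
  · refine ⟨⟨_, u0⟩, ?_⟩
    rw [eLpNorm_congr_ae u0.weightedDeriv_ae]
    refine hbound _ m0 ?_
    nlinarith [sq_nonneg (eLpNorm (weighted W (s + 2) 1 U') 2 volPos).toReal]
  · refine ⟨⟨_, u1⟩, ?_⟩
    rw [eLpNorm_congr_ae u1.weightedDeriv_ae]
    refine hbound _ m1 ?_
    nlinarith [sq_nonneg (eLpNorm (weighted W (s + 2) 0 U) 2 volPos).toReal]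

/-- Orders 0 and 1 come from the energy estimate and the others from the equation, one at a time.
The bootstrap uses derivatives of W up to order s and the energy estimate up to order 2; s + 3
covers both. -/
theorem exists_eWeightedNorm_le_rhs (M : ℝ) (s : ℕ) : ∃ C : ℝ≥0, ∀ W, PotBound W (s + 3) M →
    ∀ u : (schrodinger W).domain, MemWeighted W s (schrodinger W u) →
    MemWeighted W (s + 2) (u : L2) ∧
      eWeightedNorm W (s + 2) (u : L2) ≤ C * eWeightedNorm W s (schrodinger W u) := by
  have main : ∀ n ≤ s + 1, ∃ C : ℝ≥0, ∀ W, PotBound W (s + 3) M →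
      ∀ u : (schrodinger W).domain, MemWeighted W s (schrodinger W u) → ∀ k ≤ n + 1,
      (∃ g, HasWeakDeriv k (u : L2) g) ∧ eLpNorm (weightedDeriv W (s + 2) k (u : L2)) 2 volPos
        ≤ C * eWeightedNorm W s (schrodinger W u) := by
    intro n
    induction n with
    | zero =>
      intro _
      obtain ⟨C, H⟩ := exists_eLpNorm_weightedDeriv_le M s
      refine ⟨C, fun W hW u hf k hk => ?_⟩
      obtain ⟨h1, h2⟩ := H W (hW.mono (by omega)) u (hf 0 (Nat.zero_le s)).2 k (by omega)
      exact ⟨h1, h2.trans (mul_le_mul_right (eLpNorm_le_eWeightedNorm (Nat.zero_le s) _) _)⟩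
    | succ n ih =>
      intro hn
      obtain ⟨C, H⟩ := ih (by omega)
      -- C keeps the bounds already obtained. The rest serves order n + 2: the Leibniz constant
      -- times n + 1 old terms, plus 1 for f^(n).
      refine ⟨C + (Real.toNNReal (2 ^ n * M) * ((n + 1) * C) + 1), fun W hW u hf k hk => ?_⟩
      have H' := H W hW u hf
      set E := eWeightedNorm W s (schrodinger W u)
      have hC : ∀ D : ℝ≥0, (C : ℝ≥0∞) * E ≤ ((C + D : ℝ≥0) : ℝ≥0∞) * E := fun D =>
        mul_le_mul_left (by exact_mod_cast le_self_add) _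
      rcases Nat.lt_or_ge k (n + 2) with hlt | hge
      · obtain ⟨h1, h2⟩ := H' k (by omega)
        exact ⟨h1, h2.trans (hC _)⟩
      · obtain rfl : k = n + 2 := by omega
        have hs := isSchrodingerPow_schrodinger hW.smooth u
        obtain ⟨h1, h2⟩ := eLpNorm_weightedDeriv_succ_le hW (s := s) (k := n) (by omega)
          (fun j hj => (H' j (by omega)).1) (hf n (by omega)).1
          ((isSchrodingerPow_one_iff hW.smooth hs.left hs.right).1 hs)
        refine ⟨h1, h2.trans ?_⟩
        have h3 : ∑ j ∈ Finset.range (n + 1), eLpNorm (weightedDeriv W (s + 2) j (u : L2)) 2 volPos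
            ≤ ((n + 1 : ℕ) : ℝ≥0∞) * (C * E) := by
          refine (Finset.sum_le_card_nsmul _ _ _ fun j hj =>
            (H' j (by have := Finset.mem_range.1 hj; omega)).2).trans ?_
          rw [Finset.card_range, nsmul_eq_mul]
        have h4 : eLpNorm (weightedDeriv W s n (schrodinger W u)) 2 volPos ≤ E :=
          eLpNorm_le_eWeightedNorm (by omega) _
        refine (add_le_add (mul_le_mul_right h3 _) h4).trans ?_
        rw [ENNReal.coe_add, add_mul]
        refine le_trans (le_of_eq ?_) (self_le_add_left _ _)
        push_cast
        rw [ENNReal.ofReal]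
        ring
  obtain ⟨C, H⟩ := main (s + 1) le_rfl
  refine ⟨(s + 3) * C, fun W hW u hf => ?_⟩
  have H' := H W hW u hf
  have hle : eWeightedNorm W (s + 2) (u : L2)
      ≤ (((s + 3) * C : ℝ≥0) : ℝ≥0∞) * eWeightedNorm W s (schrodinger W u) := by
    refine (Finset.sum_le_card_nsmul _ _ _ fun j hj =>
      (H' j (by have := Finset.mem_range.1 hj; omega)).2).trans (le_of_eq ?_)
    rw [Finset.card_range, nsmul_eq_mul]
    push_cast
    ring
  exact ⟨memWeighted_of_lt_top hW (fun k h => (H' k (by omega)).1)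
    (hle.trans_lt (ENNReal.mul_lt_top ENNReal.coe_lt_top hf.eWeightedNorm_ne_top.lt_top)), hle⟩

/-- All weights are at least 1, which gives H², and W^((s+2)/2) ≥ W gives Wu ∈ L². -/
theorem MemWeighted.mem_schrodinger_domain {W : ℝ → ℝ} {N : ℕ} {M : ℝ} (hW : PotBound W N M)
    {s : ℕ} {u : L2} (h : MemWeighted W (s + 2) u) (h0 : VanishesAtZero u) :
    u ∈ (schrodinger W).domain := by
  have hd : ∀ k ≤ 2, HasWeakDeriv k u (weakDeriv k u) := fun k hk =>
    hasWeakDeriv_weakDeriv (h k (by omega)).1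
  refine ⟨fun k hk => ⟨_, hd k hk, (h k (by omega)).2.of_le (hd k hk).right.aestronglyMeasurable
    (ae_volPos fun x hx => norm_le_norm_weighted hW (by omega) _ hx)⟩, h0, ?_⟩
  have e0 := (hasWeakDeriv_zero_iff.1 (hd 0 (by omega))).2
  refine (h 0 (by omega)).2.of_le (((aestronglyMeasurable_ofReal hW.continuousOn)).mul
    (Lp.memLp u).1) ?_
  filter_upwards [e0, ae_volPos (p := fun x => 0 < x) fun x hx => hx] with x h1 hx
  have w1 := hW.one_le x hx.le
  have w0 := hW.pos hx.le
  rw [weightedDeriv, norm_mul, norm_mul, ← h1, Complex.norm_real, Complex.norm_real,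
    Real.norm_of_nonneg w0.le, Real.norm_of_nonneg (by positivity)]
  refine mul_le_mul_of_nonneg_right ?_ (norm_nonneg _)
  nth_rw 1 [← Real.rpow_one (W x)]
  refine Real.rpow_le_rpow_of_exponent_le w1 ?_
  have : (0 : ℝ) ≤ s := s.cast_nonneg
  push_cast
  linarith

/-! ### The domains of the powers of the square root -/

/-- The description of `D(A ^ (s / 2))` and of its norm, with constant `C`. -/
def DomainDescription (W : ℝ → ℝ) (s : ℕ) (C : ℝ≥0) : Prop :=
  ∀ u : L2, (u ∈ (halfPow (schrodinger W) s).domain ↔ MemWeighted W s u ∧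
      ∀ p, 2 * p < s → ∃ g, IsSchrodingerPow W p u g ∧ VanishesAtZero g) ∧
    ∀ hu : u ∈ (halfPow (schrodinger W) s).domain,
      eWeightedNorm W s u ≤ C * ‖halfPow (schrodinger W) s ⟨u, hu⟩‖ₑ ∧
      ‖halfPow (schrodinger W) s ⟨u, hu⟩‖ₑ ≤ C * eWeightedNorm W s u

theorem domainDescription_zero {W : ℝ → ℝ} {N : ℕ} {M : ℝ} (hW : PotBound W N M) :
    DomainDescription W 0 1 := by
  intro u
  have u0 : HasWeakDeriv 0 u u := hasWeakDeriv_zero_iff.2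
    ⟨locallyIntegrableOn_of_memLp (Lp.memLp u), Filter.EventuallyEq.refl _ _⟩
  have e1 : weighted W 0 0 u = u := by
    funext x
    simp [weighted]
  have e2 : eWeightedNorm W 0 u = ‖u‖ₑ := by
    rw [eWeightedNorm, Finset.sum_range_one, eLpNorm_congr_ae u0.weightedDeriv_ae, e1, Lp.enorm_def]
  have hv : ∀ hu : u ∈ (halfPow (schrodinger W) 0).domain,
      halfPow (schrodinger W) 0 ⟨u, hu⟩ = u := fun _ => rfl
  refine ⟨⟨fun _ => ⟨?_, fun p hp => by omega⟩, fun _ => trivial⟩, fun hu => ?_⟩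
  · refine memWeighted_of_lt_top hW (fun k hk => ?_) (by rw [e2]; exact enorm_lt_top)
    obtain rfl : k = 0 := by omega
    exact ⟨_, u0⟩
  · rw [hv, e2, ENNReal.coe_one, one_mul]
    exact ⟨le_rfl, le_rfl⟩

theorem domainDescription_one {W : ℝ → ℝ} {M : ℝ} (hW : PotBound W 3 M) :
    DomainDescription W 1 2 := by
  intro u
  have lu := locallyIntegrableOn_of_memLp (Lp.memLp u)
  have forward : ∀ {U U' : ℝ → ℂ}, InForm W u U U' → MemWeighted W 1 u ∧
      (eLpNorm (weightedDeriv W 1 0 u) 2 volPos).toReal ^ 2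
        = ∫ x in Ioi 0, W x * ‖U x‖ ^ 2 ∧
      (eLpNorm (weightedDeriv W 1 1 u) 2 volPos).toReal ^ 2 = ∫ x in Ioi 0, ‖U' x‖ ^ 2 := by
    intro U U' hU
    have u0 : HasWeakDeriv 0 u U := hasWeakDeriv_zero_iff.2 ⟨lu, hU.ae_eq⟩
    have u1 : HasWeakDeriv 1 u U' :=
      hU.prim.hasWeakDeriv.congr hU.ae_eq.symm (Filter.EventuallyEq.refl _ _)
    have m0 : MemLp (weighted W 1 0 U) 2 volPos := by
      rw [memLp_weighted_iff hW (by omega) u0.right]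
      simpa using hU.integrable
    have m1 : MemLp (weighted W 1 1 U') 2 volPos := by
      rw [memLp_weighted_iff hW (by omega) u1.right]
      simpa using (memLp_two_iff hU.memLp.1).1 hU.memLp
    refine ⟨fun k hk => ?_, ?_, ?_⟩
    · interval_cases k
      · exact ⟨⟨_, u0⟩, m0.ae_eq u0.weightedDeriv_ae.symm⟩
      · exact ⟨⟨_, u1⟩, m1.ae_eq u1.weightedDeriv_ae.symm⟩
    · rw [eLpNorm_congr_ae u0.weightedDeriv_ae, toReal_eLpNorm_weighted_sq hW (by omega) m0]
      simp
    · rw [eLpNorm_congr_ae u1.weightedDeriv_ae, toReal_eLpNorm_weighted_sq hW (by omega) m1]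
      simp
  refine ⟨⟨fun hu => ?_, ?_⟩, fun hu => ?_⟩
  · obtain ⟨U, U', hU, -⟩ := exists_inForm_halfPow_one hW ⟨u, hu⟩
    refine ⟨(forward hU).1, fun p hp => ?_⟩
    obtain rfl : p = 0 := by omega
    exact ⟨u, isSchrodingerPow_zero_iff.2 (hasWeakDeriv_zero_iff.2
      ⟨lu, Filter.EventuallyEq.refl _ _⟩), .of_isPrim hU.ae_eq hU.prim hU.zero⟩
  · rintro ⟨hm, hb⟩
    have h1 := hasWeakDeriv_weakDeriv (hm 1 le_rfl).1
    have m1 : MemLp (weakDeriv 1 u) 2 volPos :=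
      (hm 1 le_rfl).2.of_le h1.right.aestronglyMeasurable
        (ae_volPos fun x hx => norm_le_norm_weighted hW le_rfl _ hx)
    obtain ⟨U, e, p⟩ := h1.exists_isPrim_one fun x hx => intervalIntegrable_of_memLp m1 hx
    obtain ⟨g, hg, vg⟩ := hb 0 (by omega)
    rw [isSchrodingerPow_zero_iff, hasWeakDeriv_zero_iff] at hg
    have u0 : HasWeakDeriv 0 u U := hasWeakDeriv_zero_iff.2 ⟨lu, e⟩
    have m0 := (memLp_weighted_iff hW (by omega) u0.right).1
      ((hm 0 (by omega)).2.ae_eq u0.weightedDeriv_ae)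
    exact mem_halfPow_one_of_inForm hW (U := U) ⟨e, p, (vg.congr hg.2.symm).eq_zero e p.continuousOn,
      m1, by simpa using m0⟩
  · obtain ⟨U, U', hU, hn⟩ := exists_inForm_halfPow_one hW ⟨u, hu⟩
    obtain ⟨hm, e0, e1⟩ := forward hU
    rw [← e0, ← e1] at hn
    have ht := hm.eWeightedNorm_ne_top
    have hs : (eWeightedNorm W 1 u).toReal = (eLpNorm (weightedDeriv W 1 0 u) 2 volPos).toReal
        + (eLpNorm (weightedDeriv W 1 1 u) 2 volPos).toReal := by
      rw [hm.toReal_eWeightedNorm, weightedNorm, Finset.sum_range_succ, Finset.sum_range_one]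
    set a := (eLpNorm (weightedDeriv W 1 0 u) 2 volPos).toReal
    set b := (eLpNorm (weightedDeriv W 1 1 u) 2 volPos).toReal
    set t := halfPow (schrodinger W) 1 ⟨u, hu⟩
    have ha : 0 ≤ a := ENNReal.toReal_nonneg
    have hb : 0 ≤ b := ENNReal.toReal_nonneg
    have ht0 := norm_nonneg t
    rw [← ENNReal.toReal_le_toReal ht (ENNReal.mul_ne_top ENNReal.coe_ne_top enorm_ne_top),
      ← ENNReal.toReal_le_toReal enorm_ne_top (ENNReal.mul_ne_top ENNReal.coe_ne_top ht),
      ENNReal.toReal_mul, ENNReal.toReal_mul, toReal_enorm, hs, ENNReal.coe_toReal, NNReal.coe_ofNat]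
    constructor
    -- With t the operator applied to u, ‖t‖² = a² + b², so (a + b)² ≤ 2‖t‖² and ‖t‖ ≤ a + b; the
    -- constant 2 covers both bounds.
    · nlinarith [sq_nonneg (a - b)]
    · refine le_of_sq_le_sq ?_ (by positivity)
      nlinarith [mul_nonneg ha hb]

/-- Apply the case s to f = Au and translate norms and boundary conditions from f to u. The constant
is produced before W, which is the uniformity claimed in the theorem. -/
theorem exists_domainDescription (M : ℝ) (s : ℕ) :
    ∃ C : ℝ≥0, ∀ W, PotBound W (s + 3) M → DomainDescription W s C := by
  induction s using Nat.twoStepInduction with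
  | zero => exact ⟨1, fun W hW => domainDescription_zero hW⟩
  | one => exact ⟨2, fun W hW => domainDescription_one (hW.mono (by omega))⟩
  | more s ih _ =>
    obtain ⟨C, H⟩ := ih
    obtain ⟨C₁, H₁⟩ := exists_eWeightedNorm_rhs_le M s
    obtain ⟨C₂, H₂⟩ := exists_eWeightedNorm_le_rhs M s
    -- C₂ C serves the bound on the weighted norm and C C₁ the bound on the operator norm.
    refine ⟨C₂ * C + C * C₁, fun W hW u => ?_⟩
    have hW3 : PotBound W 3 M := hW.mono (by omega)
    have D := H W (hW.mono (by omega))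
    have E₁ := H₁ W (hW.mono (by omega))
    have E₂ := H₂ W (hW.mono (by omega))
    obtain ⟨T, hT, hT0⟩ := exists_isInv_of_coercive (isSelfAdjoint_schrodinger hW3)
      (norm_sq_le_inner_schrodinger hW3)
    have weq : ∀ v : (schrodinger W).domain,
        HasWeakDeriv 2 (v : L2) (fun x => (W x : ℂ) * (v : L2) x - schrodinger W v x) := fun v =>
      have hs := isSchrodingerPow_schrodinger hW.smooth v
      (isSchrodingerPow_one_iff hW.smooth hs.left hs.right).1 hs
    rw [halfPow_add_two hT hT0]
    refine ⟨mem_opComp_domain.trans ⟨?_, ?_⟩, fun hu => ?_⟩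
    · rintro ⟨h1, h2⟩
      obtain ⟨h3, h4⟩ := (D _).1.1 h2
      exact ⟨(E₂ ⟨u, h1⟩ h3).1, (forall_boundary_succ_iff hW.smooth
        (isSchrodingerPow_schrodinger hW.smooth ⟨u, h1⟩) s).2 ⟨h1.2.1, h4⟩⟩
    · rintro ⟨h1, h2⟩
      have h0 : VanishesAtZero u := by
        obtain ⟨g, hg, vg⟩ := h2 0 (by omega)
        rw [isSchrodingerPow_zero_iff, hasWeakDeriv_zero_iff] at hg
        exact vg.congr hg.2.symm
      have hu := h1.mem_schrodinger_domain hW h0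
      exact ⟨hu, (D _).1.2 ⟨(E₁ u _ (weq ⟨u, hu⟩) h1).1, ((forall_boundary_succ_iff hW.smooth
        (isSchrodingerPow_schrodinger hW.smooth ⟨u, hu⟩) s).1 h2).2⟩⟩
    · obtain ⟨h1, h2⟩ := mem_opComp_domain.1 hu
      change eWeightedNorm W (s + 2) u ≤ _ * ‖halfPow (schrodinger W) s ⟨schrodinger W ⟨u, h1⟩, h2⟩‖ₑ
        ∧ ‖halfPow (schrodinger W) s ⟨schrodinger W ⟨u, h1⟩, h2⟩‖ₑ ≤ _
      obtain ⟨h3, -⟩ := (D _).1.1 h2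
      obtain ⟨b1, b2⟩ := (D _).2 h2
      obtain ⟨m, c2⟩ := E₂ ⟨u, h1⟩ h3
      obtain ⟨-, c1⟩ := E₁ u _ (weq ⟨u, h1⟩) m
      push_cast
      rw [add_mul, add_mul, mul_assoc, mul_assoc, mul_assoc, mul_assoc]
      exact ⟨(c2.trans (mul_le_mul_right b1 _)).trans le_self_add,
        (b2.trans (mul_le_mul_right c1 _)).trans le_add_self⟩

theorem boundaryConditions_iff {W : ℝ → ℝ} {s : ℕ} (hs : 1 ≤ s) {f : ℝ → ℂ} :
    BoundaryConditions W s f ↔ ∀ p, 2 * p < s → ∃ g, IsSchrodingerPow W p f g ∧ VanishesAtZero g :=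
  ⟨fun h p hp => h p (by omega), fun h p hp => h p (by omega)⟩

end HalfLine

/-! ### The theorem: domains for each W, and norm equivalence uniform in W. -/

theorem mainTheorem6 :
    (∀ W : ℝ → ℝ, HalfLine.IsAdmissible W →
      IsSelfAdjoint (HalfLine.schrodinger W) ∧
      (∀ u : (HalfLine.schrodinger W).domain, u ≠ 0 →
        0 < (inner ℂ (HalfLine.schrodinger W u) (u : HalfLine.L2)).re) ∧
      (∃! B : HalfLine.L2 →ₗ.[ℂ] HalfLine.L2, HalfLine.IsPosSqrt (HalfLine.schrodinger W) B) ∧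
      ∀ s : ℕ, 1 ≤ s → ∀ u : HalfLine.L2,
        u ∈ (HalfLine.halfPow (HalfLine.schrodinger W) s).domain ↔
          HalfLine.MemWeighted W s u ∧ HalfLine.BoundaryConditions W s u) ∧
    (∀ s : ℕ, 1 ≤ s → ∃ K : Finset ℕ, ∀ C : ℕ → ℝ, ∃ c₁ c₂ : ℝ, 0 < c₁ ∧ 0 < c₂ ∧
      ∀ W : ℝ → ℝ, HalfLine.IsAdmissible W →
        (∀ k ∈ K, ∀ x : ℝ, 0 ≤ x →
          |iteratedDerivWithin k W (Set.Ici 0) x| ≤ C k * W x) →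
        ∀ u : (HalfLine.halfPow (HalfLine.schrodinger W) s).domain,
          c₁ * HalfLine.weightedNorm W s (u : HalfLine.L2)
              ≤ ‖HalfLine.halfPow (HalfLine.schrodinger W) s u‖ ∧
            ‖HalfLine.halfPow (HalfLine.schrodinger W) s u‖
              ≤ c₂ * HalfLine.weightedNorm W s (u : HalfLine.L2)) := by
  refine ⟨fun W hW => ?_, fun s _ => ⟨Finset.range (s + 3), fun C => ?_⟩⟩
  · obtain ⟨M, hM⟩ := hW.exists_potBound 3
    have sa := HalfLine.isSelfAdjoint_schrodinger hM
    have co := HalfLine.norm_sq_le_inner_schrodinger hM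
    obtain ⟨T, hT, hT0⟩ := HalfLine.exists_isInv_of_coercive sa co
    refine ⟨sa, fun u hu => ?_, HalfLine.existsUnique_isPosSqrt hT hT0, fun s hs u => ?_⟩
    · rw [sa.inner_left]
      have : 0 < ‖(u : HalfLine.L2)‖ := norm_pos_iff.2 fun h => hu (Subtype.ext h)
      exact (by positivity : 0 < ‖(u : HalfLine.L2)‖ ^ 2).trans_le (co u)
    · obtain ⟨M', hM'⟩ := hW.exists_potBound (s + 3)
      obtain ⟨C, H⟩ := HalfLine.exists_domainDescription M' s
      rw [HalfLine.boundaryConditions_iff hs]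
      exact (H W hM' u).1
  -- A common bound M built only from C_k with k < s + 3. The C_k here are arbitrary reals, whence
  -- the absolute values.
  · obtain ⟨D, H⟩ := HalfLine.exists_domainDescription (∑ k ∈ Finset.range (s + 3), |C k|) s
    have hD : (0 : ℝ) < D + 1 := by positivity
    -- D may be 0 as far as is known; D + 1 is invertible and still an upper bound.
    refine ⟨((D : ℝ) + 1)⁻¹, D + 1, inv_pos.2 hD, hD, fun W hW hb u => ?_⟩
    have hP : HalfLine.PotBound W (s + 3) (∑ k ∈ Finset.range (s + 3), |C k|) := by
      refine ⟨hW.smooth, hW.one_le, Finset.sum_nonneg fun k _ => abs_nonneg _, fun k hk x hx =>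
        (hb k (Finset.mem_range.2 hk) x hx).trans (mul_le_mul_of_nonneg_right ?_
          (zero_le_one.trans (hW.one_le x hx)))⟩
      exact (le_abs_self _).trans (Finset.single_le_sum (f := fun k => |C k|)
        (fun j _ => abs_nonneg _) (Finset.mem_range.2 hk))
    obtain ⟨h1, h2⟩ := H W hP u
    obtain ⟨b1, b2⟩ := h2 u.2
    have hm := (h1.1 u.2).1
    have ht := hm.eWeightedNorm_ne_top
    rw [← ENNReal.toReal_le_toReal ht (ENNReal.mul_ne_top ENNReal.coe_ne_top enorm_ne_top),
      ENNReal.toReal_mul, toReal_enorm, hm.toReal_eWeightedNorm, ENNReal.coe_toReal] at b1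
    rw [← ENNReal.toReal_le_toReal enorm_ne_top (ENNReal.mul_ne_top ENNReal.coe_ne_top ht),
      ENNReal.toReal_mul, toReal_enorm, hm.toReal_eWeightedNorm, ENNReal.coe_toReal] at b2
    have n1 := norm_nonneg (HalfLine.halfPow (HalfLine.schrodinger W) s u)
    have n2 : 0 ≤ HalfLine.weightedNorm W s (u : HalfLine.L2) := by
      rw [← hm.toReal_eWeightedNorm]
      exact ENNReal.toReal_nonneg
    constructor
    · rw [inv_mul_le_iff₀ hD]
      change _ ≤ ((D : ℝ) + 1) * ‖HalfLine.halfPow (HalfLine.schrodinger W) s u‖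
      change _ ≤ (D : ℝ) * ‖HalfLine.halfPow (HalfLine.schrodinger W) s u‖ at b1
      linarith
    · change ‖HalfLine.halfPow (HalfLine.schrodinger W) s u‖ ≤ _ at b2
      linarith
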